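/- Let $\mu>0$, $v>0$, $\tau\in\mathbb{R}\setminus\{0,\pm1\}$ and $\omega>\frac{v^2}{(\tau^2+1)^2}$. Let $$\phi_\omega(x)=(\omega(\mu+1))^{\frac1{2\mu}}\cosh^{-\frac1\mu}(\mu\sqrt{\omega}\,x),$$ $$\widetilde T_-=\frac{1}{|\tau|^{2\mu+4}-1}\Big(\frac{v}{\sqrt\omega}-\tau^2 R\Big),\qquad \widetilde T_+=\frac{1}{|\tau|^{2\mu+4}-1}\Big(|\tau|^{2\mu+2}\frac{v}{\sqrt\omega}-R\Big),$$ $$R=\sqrt{\tfrac{v^2}{\omega}|\tau|^{2\mu}+(|\tau|^{2\mu+4}-1)(|\tau|^{2\mu}-1)},$$ let $\widetilde x_\pm\in\mathbb{R}$ be given by $\widetilde T_\pm=\tanh(\mu\sqrt\omega\,\widetilde x_\pm)$, and let $$u_{\widetilde T}(x)=\begin{cases}\phi_\omega(x+\widetilde x_-), & x<0,\\ \operatorname{sgn}(\tau)\,\phi_\omega(x+\widetilde x_+), & x>0.\end{cases}$$ In the complex Hilbert space $L^2(\mathbb{R})$, consider the operators $$L_1a=-a''+\omega a-(2\mu+1)|u_{\widetilde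 T}|^{2\mu}a,\qquad L_2b=-b''+\omega b-|u_{\widetilde T}|^{2\mu}b,$$ with the Fülöp–Tsutsui domain $$D(L_1)=D(L_2)=\{u\in H^2(\mathbb{R}\setminus\{0\}):\ u(0+)=\tau u(0-),\ u'(0-)-\tau u'(0+)=v\,u(0-)\},$$ where derivatives are taken on $\mathbb{R}\setminus\{0\}$. Then: 1. $L_1$ has trivial kernel and exactly one negative eigenvalue, which is simple (its eigenspace has dimension one). 2. $L_2\ge 0$, that is, $(L_2u,u)$ is real and nonnegative for every $u\in D(L_2)$, and $\operatorname{Ker}L_2=\operatorname{span}\{u_{\widetilde T}\}$. -/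

import Mathlib

open MeasureTheory Filter Topology
open scoped ENNReal

noncomputable section

namespace FulopTsutsui

/-- The complex Hilbert space `L²(ℝ)`. -/
abbrev L2 : Type := Lp ℂ 2 (volume : Measure ℝ)

/-- `g ∈ L²(ℝ)` is the weak derivative of `u ∈ L²(ℝ)` on the open set `ℝ \ {0}`. -/
def IsWeakDeriv (u g : L2) : Prop :=
  ∀ φ : ℝ → ℝ, ContDiff ℝ ((⊤ : ℕ∞) : WithTop ℕ∞) φ → HasCompactSupport φ → tsupport φ ⊆ {0}ᶜ →
    ∫ x, deriv φ x • u x = -∫ x, φ x • g x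

/-- `a = u(0-)`. Elements of `L²` are classes of functions, so the limit is the limit outside null
sets; for `u ∈ H¹(ℝ \ {0})` it is the limit at `0-` of the continuous representative. -/
def LeftTrace (u : L2) (a : ℂ) : Prop := Tendsto u (𝓝[<] (0 : ℝ) ⊓ ae volume) (𝓝 a)

/-- `a = u(0+)`, see `LeftTrace`. -/
def RightTrace (u : L2) (a : ℂ) : Prop := Tendsto u (𝓝[>] (0 : ℝ) ⊓ ae volume) (𝓝 a)

/-- The Fülöp–Tsutsui conditions for a function `u` with derivative `g`:
`u(0+) = τ u(0-)` and `u'(0-) - τ u'(0+) = v u(0-)`. -/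
def BoundaryCondition (τ v : ℝ) (u g : L2) : Prop :=
  ∃ uL uR gL gR : ℂ, LeftTrace u uL ∧ RightTrace u uR ∧ LeftTrace g gL ∧ RightTrace g gR ∧
    uR = τ * uL ∧ gL - τ * gR = v * uL

/-! ### Elementary facts needed to define the operators -/

lemma integrable_smul_of_test {φ : ℝ → ℝ} (hφ : Continuous φ) (hc : HasCompactSupport φ)
    (u : L2) : Integrable (fun x => φ x • u x) :=
  ((Lp.memLp u).locallyIntegrable (by norm_num)).integrable_smul_left_of_hasCompactSupport hφ hc

lemma IsWeakDeriv.add {u g u' g' : L2} (h : IsWeakDeriv u g) (h' : IsWeakDeriv u' g') :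
    IsWeakDeriv (u + u') (g + g') := by
  intro φ hφ hc hs
  have hd : Continuous (deriv φ) := hφ.continuous_deriv (by simp)
  have e1 : (fun x => deriv φ x • (u + u') x) =ᵐ[volume]
      fun x => deriv φ x • u x + deriv φ x • u' x := by
    filter_upwards [Lp.coeFn_add u u'] with x hx
    rw [hx, Pi.add_apply, smul_add]
  have e2 : (fun x => φ x • (g + g') x) =ᵐ[volume] fun x => φ x • g x + φ x • g' x := by
    filter_upwards [Lp.coeFn_add g g'] with x hx
    rw [hx, Pi.add_apply, smul_add]
  rw [integral_congr_ae e1, integral_congr_ae e2,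
    integral_add (integrable_smul_of_test hd hc.deriv u) (integrable_smul_of_test hd hc.deriv u'),
    integral_add (integrable_smul_of_test hφ.continuous hc g)
      (integrable_smul_of_test hφ.continuous hc g'), h φ hφ hc hs, h' φ hφ hc hs, neg_add]

lemma IsWeakDeriv.smul {u g : L2} (c : ℂ) (h : IsWeakDeriv u g) :
    IsWeakDeriv (c • u) (c • g) := by
  intro φ hφ hc hs
  have e1 : (fun x => deriv φ x • (c • u) x) =ᵐ[volume] fun x => c • (deriv φ x • u x) := by
    filter_upwards [Lp.coeFn_smul c u] with x hx
    rw [hx, Pi.smul_apply, smul_comm]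
  have e2 : (fun x => φ x • (c • g) x) =ᵐ[volume] fun x => c • (φ x • g x) := by
    filter_upwards [Lp.coeFn_smul c g] with x hx
    rw [hx, Pi.smul_apply, smul_comm]
  rw [integral_congr_ae e1, integral_congr_ae e2, integral_smul, integral_smul, h φ hφ hc hs,
    smul_neg]

lemma isWeakDeriv_zero : IsWeakDeriv 0 0 := by
  intro φ _ _ _
  have h := Lp.coeFn_zero ℂ 2 (volume : Measure ℝ)
  have e1 : (fun x => deriv φ x • (0 : L2) x) =ᵐ[volume] fun _ => 0 := by
    filter_upwards [h] with x hx
    rw [hx, Pi.zero_apply, smul_zero]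
  have e2 : (fun x => φ x • (0 : L2) x) =ᵐ[volume] fun _ => 0 := by
    filter_upwards [h] with x hx
    rw [hx, Pi.zero_apply, smul_zero]
  rw [integral_congr_ae e1, integral_congr_ae e2]
  simp

/-- The weak derivative is unique. -/
lemma IsWeakDeriv.unique {u g : L2} (hu : u = 0) (h : IsWeakDeriv u g) : g = 0 := by
  subst hu
  have hloc : LocallyIntegrableOn (g : ℝ → ℂ) {0}ᶜ volume :=
    ((Lp.memLp g).locallyIntegrable (by norm_num)).locallyIntegrableOn _
  have key := (isOpen_compl_singleton (x := (0 : ℝ))).ae_eq_zero_of_integral_contDiff_smul_eq_zero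
    hloc (fun φ hφ hc hs => by
      have e1 : (fun x => deriv φ x • (0 : L2) x) =ᵐ[volume] fun _ => 0 := by
        filter_upwards [Lp.coeFn_zero ℂ 2 (volume : Measure ℝ)] with x hx
        rw [hx, Pi.zero_apply, smul_zero]
      have := h φ hφ hc hs
      rw [integral_congr_ae e1, integral_zero] at this
      exact neg_eq_zero.mp this.symm)
  have hne : ∀ᵐ x : ℝ, x ≠ 0 := by simp [ae_iff]
  refine (Lp.eq_zero_iff_ae_eq_zero (f := g)).mpr ?_
  filter_upwards [key, hne] with x hx hx0 using hx hx0

lemma tendsto_add_inf_ae {l : Filter ℝ} {u w : L2} {a b : ℂ}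
    (hu : Tendsto u (l ⊓ ae volume) (𝓝 a)) (hw : Tendsto w (l ⊓ ae volume) (𝓝 b)) :
    Tendsto (u + w : L2) (l ⊓ ae volume) (𝓝 (a + b)) :=
  (hu.add hw).congr' (((Lp.coeFn_add u w).symm.filter_mono inf_le_right))

lemma tendsto_smul_inf_ae {l : Filter ℝ} {u : L2} {a : ℂ} (c : ℂ)
    (hu : Tendsto u (l ⊓ ae volume) (𝓝 a)) :
    Tendsto (c • u : L2) (l ⊓ ae volume) (𝓝 (c * a)) :=
  (hu.const_mul c).congr' (((Lp.coeFn_smul c u).symm.filter_mono inf_le_right))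

lemma tendsto_zero_inf_ae {l : Filter ℝ} :
    Tendsto (0 : L2) (l ⊓ ae volume) (𝓝 0) :=
  (tendsto_const_nhds (x := (0 : ℂ))).congr'
    (((Lp.coeFn_zero ℂ 2 (volume : Measure ℝ)).symm.filter_mono inf_le_right))

/-! ### The Laplacian with the Fülöp–Tsutsui conditions at the origin -/

/-- The graph of the operator `H_{τ,v}`: the pairs `(u, -u'')` with `u ∈ H²(ℝ \ {0})`, that is,
with `u`, `u' = g` and `u''` in `L²(ℝ)`, such that `u` satisfies the Fülöp–Tsutsui conditions. -/
def hamiltonianGraph (τ v : ℝ) : Submodule ℂ (L2 × L2) where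
  carrier := {p | ∃ g : L2, IsWeakDeriv p.1 g ∧ IsWeakDeriv g (-p.2) ∧
    BoundaryCondition τ v p.1 g}
  zero_mem' := ⟨0, isWeakDeriv_zero, by simpa using isWeakDeriv_zero,
    0, 0, 0, 0, tendsto_zero_inf_ae, tendsto_zero_inf_ae, tendsto_zero_inf_ae,
    tendsto_zero_inf_ae, by simp, by simp⟩
  add_mem' := by
    rintro ⟨u, w⟩ ⟨u', w'⟩ ⟨g, h1, h2, a, b, c, d, ha, hb, hc, hd, e1, e2⟩
      ⟨g', h1', h2', a', b', c', d', ha', hb', hc', hd', e1', e2'⟩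
    refine ⟨g + g', h1.add h1', ?_, a + a', b + b', c + c', d + d', tendsto_add_inf_ae ha ha',
      tendsto_add_inf_ae hb hb', tendsto_add_inf_ae hc hc', tendsto_add_inf_ae hd hd', ?_, ?_⟩
    · have := h2.add h2'
      rwa [← neg_add] at this
    · rw [e1, e1']; ring
    · linear_combination e2 + e2'
  smul_mem' := by
    rintro k ⟨u, w⟩ ⟨g, h1, h2, a, b, c, d, ha, hb, hc, hd, e1, e2⟩
    refine ⟨k • g, h1.smul k, ?_, k * a, k * b, k * c, k * d, tendsto_smul_inf_ae k ha,
      tendsto_smul_inf_ae k hb, tendsto_smul_inf_ae k hc, tendsto_smul_inf_ae k hd, ?_, ?_⟩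
    · have := h2.smul k
      rwa [smul_neg] at this
    · rw [e1]; ring
    · linear_combination k * e2

lemma hamiltonianGraph_snd_eq_zero (τ v : ℝ) (p : L2 × L2) (hp : p ∈ hamiltonianGraph τ v)
    (h0 : p.1 = 0) : p.2 = 0 := by
  obtain ⟨g, h1, h2, -⟩ := hp
  exact neg_eq_zero.mp (h2.unique (h1.unique h0))

/-- The operator `H_{τ,v}` in `L²(ℝ)`, acting as `u ↦ -u''` on
`{u ∈ H²(ℝ \ {0}) : u(0+) = τ u(0-), u'(0-) - τ u'(0+) = v u(0-)}`. -/
def hamiltonian (τ v : ℝ) : L2 →ₗ.[ℂ] L2 := (hamiltonianGraph τ v).toLinearPMap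

lemma mem_hamiltonian_domain_iff (τ v : ℝ) (u : L2) :
    u ∈ (hamiltonian τ v).domain ↔
      ∃ g h : L2, IsWeakDeriv u g ∧ IsWeakDeriv g h ∧ BoundaryCondition τ v u g := by
  constructor
  · rintro ⟨⟨u', w⟩, ⟨g, h1, h2, h3⟩, rfl⟩
    exact ⟨g, -w, h1, h2, h3⟩
  · rintro ⟨g, h, h1, h2, h3⟩
    exact ⟨(u, -h), ⟨g, h1, by simpa using h2, h3⟩, rfl⟩

lemma hamiltonian_apply (τ v : ℝ) (u : (hamiltonian τ v).domain) {g h : L2}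
    (h1 : IsWeakDeriv u g) (h2 : IsWeakDeriv g h) (h3 : BoundaryCondition τ v u g) :
    hamiltonian τ v u = -h := by
  have hu := (hamiltonianGraph τ v).mem_graph_toLinearPMap (hamiltonianGraph_snd_eq_zero τ v) u
  have hv : ((u : L2), -h) ∈ hamiltonianGraph τ v := ⟨g, h1, by simpa using h2, h3⟩
  have := hamiltonianGraph_snd_eq_zero τ v _ (Submodule.sub_mem _ hu hv) (by simp)
  exact sub_eq_zero.mp this

/-- Multiplication by a bounded real function `V`, as a bounded operator in `L²(ℝ)`. -/
def mulOperator (V : ℝ → ℝ) (hV : MemLp (fun x => (V x : ℂ)) ∞ volume) : L2 →L[ℂ] L2 :=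
  (ContinuousLinearMap.mul ℂ ℂ).holderL volume ∞ 2 2 hV.toLp

/-- The operator `-d²/dx² + ω - c V` in `L²(ℝ)` with the Fülöp–Tsutsui domain. -/
def schrodinger (τ v ω c : ℝ) (V : ℝ → ℝ) (hV : MemLp (fun x => (V x : ℂ)) ∞ volume) :
    L2 →ₗ.[ℂ] L2 where
  domain := (hamiltonian τ v).domain
  toFun := (hamiltonian τ v).toFun +
    ((ω : ℂ) • LinearMap.id - (c : ℂ) • (mulOperator V hV : L2 →ₗ[ℂ] L2)) ∘ₗ
      (hamiltonian τ v).domain.subtype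

/-! ### The stationary state `u_{T̃}` -/

/-- The soliton `φ_ω(x) = (ω(μ+1))^{1/(2μ)} cosh^{-1/μ}(μ √ω x)`. -/
def soliton (μ ω x : ℝ) : ℝ :=
  (ω * (μ + 1)) ^ (1 / (2 * μ)) * Real.cosh (μ * √ω * x) ^ (-(1 / μ))

/-- The square root in the formulas for `T̃_±`. -/
def rootTerm (μ τ v ω : ℝ) : ℝ :=
  √(v ^ 2 / ω * |τ| ^ (2 * μ) + (|τ| ^ (2 * μ + 4) - 1) * (|τ| ^ (2 * μ) - 1))

/-- `T̃_-(ω)`. -/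
def TMinus (μ τ v ω : ℝ) : ℝ :=
  1 / (|τ| ^ (2 * μ + 4) - 1) * (v / √ω - τ ^ 2 * rootTerm μ τ v ω)

/-- `T̃_+(ω)`. -/
def TPlus (μ τ v ω : ℝ) : ℝ :=
  1 / (|τ| ^ (2 * μ + 4) - 1) * (|τ| ^ (2 * μ + 2) * (v / √ω) - rootTerm μ τ v ω)

/-- `x̃_-`, given by `T̃_- = tanh(μ √ω x̃_-)`. -/
def xMinus (μ τ v ω : ℝ) : ℝ := Real.artanh (TMinus μ τ v ω) / (μ * √ω)

/-- `x̃_+`, given by `T̃_+ = tanh(μ √ω x̃_+)`. -/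
def xPlus (μ τ v ω : ℝ) : ℝ := Real.artanh (TPlus μ τ v ω) / (μ * √ω)

/-- The stationary state `u_{T̃}`: `φ_ω(x + x̃_-)` on the negative half-line and `φ_ω(x + x̃_+)` on
the positive one, the latter with the sign of `τ` (so without a sign when `τ > 0`). -/
def state (μ τ v ω x : ℝ) : ℝ :=
  if x < 0 then soliton μ ω (x + xMinus μ τ v ω)
  else Real.sign τ * soliton μ ω (x + xPlus μ τ v ω)

/-- The potential `|u_{T̃}|^{2μ}`. -/
def potential (μ τ v ω x : ℝ) : ℝ := |state μ τ v ω x| ^ (2 * μ)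

lemma continuous_soliton (μ ω : ℝ) : Continuous (soliton μ ω) := by
  unfold soliton
  refine continuous_const.mul (Continuous.rpow_const (by fun_prop) fun x => Or.inl ?_)
  exact (Real.cosh_pos _).ne'

lemma measurable_state (μ τ v ω : ℝ) : Measurable (state μ τ v ω) := by
  have h := (continuous_soliton μ ω).measurable
  exact Measurable.ite measurableSet_Iio (h.comp (measurable_id.add_const _))
    ((h.comp (measurable_id.add_const _)).const_mul _)

lemma abs_soliton_le {μ : ℝ} (hμ : 0 < μ) (ω x : ℝ) :
    |soliton μ ω x| ≤ |(ω * (μ + 1)) ^ (1 / (2 * μ))| := by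
  unfold soliton
  rw [abs_mul]
  refine mul_le_of_le_one_right (abs_nonneg _) ?_
  rw [abs_of_pos (Real.rpow_pos_of_pos (Real.cosh_pos _) _)]
  exact Real.rpow_le_one_of_one_le_of_nonpos (Real.one_le_cosh _) (by simp [hμ.le])

lemma abs_sign_mul_le (τ y : ℝ) : |Real.sign τ * y| ≤ |y| := by
  rcases Real.sign_apply_eq τ with h | h | h <;> simp [h]

lemma memLp_potential {μ : ℝ} (hμ : 0 < μ) (τ v ω : ℝ) :
    MemLp (fun x => (potential μ τ v ω x : ℂ)) ∞ volume := by
  refine memLp_top_of_bound (C := |(ω * (μ + 1)) ^ (1 / (2 * μ))| ^ (2 * μ)) ?_ ?_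
  · refine (Complex.measurable_ofReal.comp ?_).aestronglyMeasurable
    exact (measurable_state μ τ v ω).abs.pow_const _
  · refine ae_of_all _ fun x => ?_
    rw [Complex.norm_real, Real.norm_eq_abs]
    unfold potential
    rw [abs_of_nonneg (Real.rpow_nonneg (abs_nonneg _) _)]
    refine Real.rpow_le_rpow (abs_nonneg _) ?_ (by positivity)
    unfold state
    split_ifs
    · exact abs_soliton_le hμ _ _
    · exact (abs_sign_mul_le _ _).trans (abs_soliton_le hμ _ _)

lemma integrable_exp_neg_abs {b : ℝ} (hb : 0 < b) :
    Integrable (fun x : ℝ => Real.exp (-(b * |x|))) := by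
  rw [← integrableOn_univ, ← Set.Iic_union_Ioi (a := (0 : ℝ))]
  refine IntegrableOn.union ?_ ?_
  · refine (integrableOn_exp_mul_Iic hb 0).congr_fun (fun x hx => ?_) measurableSet_Iic
    simp only [abs_of_nonpos (Set.mem_Iic.mp hx)]
    ring_nf
  · refine (integrableOn_exp_mul_Ioi (neg_neg_of_pos hb) 0).congr_fun (fun x hx => ?_)
      measurableSet_Ioi
    simp only [abs_of_pos (Set.mem_Ioi.mp hx)]
    ring_nf

lemma memLp_soliton {μ ω : ℝ} (hμ : 0 < μ) (hω : 0 < ω) : MemLp (soliton μ ω) 2 volume := by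
  have hk : 0 < μ * √ω := by positivity
  rw [memLp_two_iff_integrable_sq (continuous_soliton μ ω).aestronglyMeasurable]
  set A := (ω * (μ + 1)) ^ (1 / (2 * μ)) with hA
  have hint := (integrable_exp_neg_abs (b := √ω * 2) (by positivity)).const_mul
    (A ^ 2 * ((2 : ℝ) ^ (1 / μ)) ^ 2)
  refine hint.mono' ((continuous_soliton μ ω).pow 2).aestronglyMeasurable (ae_of_all _ fun x => ?_)
  rw [Real.norm_eq_abs, abs_of_nonneg (sq_nonneg _)]
  have hc : Real.exp (μ * √ω * |x|) / 2 ≤ Real.cosh (μ * √ω * x) := by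
    rw [← Real.cosh_abs, abs_mul, abs_of_pos hk, Real.cosh_eq]
    have := Real.exp_pos (-(μ * √ω * |x|))
    linarith
  have h1 : Real.cosh (μ * √ω * x) ^ (-(1 / μ)) ≤ 2 ^ (1 / μ) * Real.exp (-(√ω * |x|)) := by
    refine (Real.rpow_le_rpow_of_nonpos (by positivity) hc (by simp [hμ.le])).trans_eq ?_
    rw [Real.div_rpow (Real.exp_pos _).le (by norm_num), ← Real.exp_mul,
      Real.rpow_neg (by norm_num), div_inv_eq_mul, mul_comm]
    congr 2
    field_simp
  have h0 : 0 ≤ Real.cosh (μ * √ω * x) ^ (-(1 / μ)) :=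
    Real.rpow_nonneg (Real.cosh_pos _).le _
  have h2 : Real.exp (-(√ω * 2 * |x|)) = Real.exp (-(√ω * |x|)) ^ 2 := by
    rw [← Real.exp_nat_mul]; congr 1; push_cast; ring
  unfold soliton
  have h3 := pow_le_pow_left₀ h0 h1 2
  have h4 := mul_le_mul_of_nonneg_left h3 (sq_nonneg A)
  rw [h2, ← hA, mul_pow]
  exact h4.trans_eq (by ring)

lemma memLp_state {μ ω : ℝ} (hμ : 0 < μ) (hω : 0 < ω) (τ v : ℝ) :
    MemLp (fun x => (state μ τ v ω x : ℂ)) 2 volume := by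
  have h : ∀ y, MemLp (fun x => soliton μ ω (x + y)) 2 volume := fun y =>
    (memLp_soliton hμ hω).comp_measurePreserving (measurePreserving_add_right volume y)
  refine MemLp.ofReal ?_
  refine ((h (xMinus μ τ v ω)).norm.add (h (xPlus μ τ v ω)).norm).mono'
    (measurable_state μ τ v ω).aestronglyMeasurable (ae_of_all _ fun x => ?_)
  simp only [Pi.add_apply, Real.norm_eq_abs]
  change |state μ τ v ω x| ≤ _
  unfold state
  split_ifs
  · exact le_add_of_nonneg_right (abs_nonneg _)
  · exact (abs_sign_mul_le _ _).trans (le_add_of_nonneg_left (abs_nonneg _))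

/-- `u_{T̃}` as an element of `L²(ℝ)`. -/
def stateL2 {μ ω : ℝ} (hμ : 0 < μ) (hω : 0 < ω) (τ v : ℝ) : L2 :=
  (memLp_state hμ hω τ v).toLp

/-! ### The linearized operators -/

/-- `L₁ a = -a'' + ω a - (2μ+1) |u_{T̃}|^{2μ} a`. -/
def linearized₁ {μ : ℝ} (hμ : 0 < μ) (τ v ω : ℝ) : L2 →ₗ.[ℂ] L2 :=
  schrodinger τ v ω (2 * μ + 1) (potential μ τ v ω) (memLp_potential hμ τ v ω)

/-- `L₂ b = -b'' + ω b - |u_{T̃}|^{2μ} b`. -/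
def linearized₂ {μ : ℝ} (hμ : 0 < μ) (τ v ω : ℝ) : L2 →ₗ.[ℂ] L2 :=
  schrodinger τ v ω 1 (potential μ τ v ω) (memLp_potential hμ τ v ω)

/-- The eigenspace `{u ∈ D(L) : L u = z u}`, as a subspace of `L²(ℝ)`. -/
def eigenspace (L : L2 →ₗ.[ℂ] L2) (z : ℂ) : Submodule ℂ L2 :=
  (LinearMap.ker (L.toFun - z • L.domain.subtype)).map L.domain.subtype

/-- `z` is an eigenvalue of `L`. -/
def IsEigenvalue (L : L2 →ₗ.[ℂ] L2) (z : ℂ) : Prop := ∃ u : L.domain, u ≠ 0 ∧ L u = z • (u : L2)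

/-- The kernel of `L`, as a subspace of `L²(ℝ)`. -/
def kernel (L : L2 →ₗ.[ℂ] L2) : Submodule ℂ L2 :=
  (LinearMap.ker L.toFun).map L.domain.subtype

end FulopTsutsui

end

namespace FulopTsutsui

/-! ### Absolutely continuous functions on the half-line -/

/-! Reflecting the negative half-line turns everything into two problems on `[0, ∞)`, coupled at
`0`. A function in the domain becomes a pair of branches `Um`, `Up` of class `C¹` with `Up 0 = τ *
Um 0` and `Um' 0 + τ * Up' 0 = -(v * Um 0)`, and the potential becomes `φ_ω(x + s)^{2μ} = ω(μ+1)(1 -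
T²)` with `T = tanh(μ√ω(x + s))` and `s = -x̃_-`, respectively `s = x̃_+`. Let `Sm`, `Sp` be the
values of `T` at `0`. The definition of `T̃_±` is used only through `√ω(τ²Sp + Sm) = v`, the
matching of the solitons at `0`, and the strict sign of one determinant, which equals `-μ(1 -
T̃_-²)R` (`shiftRelations`).

Lower bounds. If `p' = Q - p²`, that is, `p` is the logarithmic derivative of a solution of `ψ'' =
Qψ`, then `|U'|² + Q|U|² = |U' - pU|² + (p|U|²)'`, so the form of `-d²/dx² + Q` on the half-line is
at least `-p(0)|U(0)|²` (`riccati_Ioi`). For `L₂` the choice `ψ = φ_ω(x + s)` makes the boundary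
terms of the two half-lines cancel `v|Um(0)|²` exactly, hence `L₂ ≥ 0`. For `L₁` the choice is `ψ =
φ_ω'(x + s)`, which vanishes at `-s`. As `τ²Sp + Sm > 0`, at most one of the shifts is negative. If
one is, the bound survives for functions vanishing at that pole (`riccati_singular`), and the
boundary terms have a good sign thanks to the determinant; if none is, the condition `Um(0) = 0`
suffices. So the form of `L₁` is nonnegative on the kernel of one linear functional
(`ShiftRelations.exists_functional`). Eigenvectors of two distinct negative eigenvalues would span a
plane on which the form is negative definite, and this plane would meet that kernel
(`eigenvalue_unique`).

Kernels and multiplicities. The Wronskian of two square integrable solutions on the half-line is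
constant and integrable, hence zero, so such solutions have proportional data at `0`; since `τ ≠ 0`,
the conditions at the origin carry the data across. Therefore every eigenvalue is simple, and the
kernel of `L₂` is spanned by the stationary state. A function in the kernel of `L₁` has branches
proportional to `φ_ω'(x + s)`; matching them is a linear system with the determinant above, so the
kernel is trivial.

Existence of a negative eigenvalue. For `κ ≥ √ω` a Volterra equation yields decaying solutions
`e^{-κx}h(κ, x)` on each half-line (`exists_jostFamily`). Their matching determinant at `0` is
continuous in `κ`, positive at `κ = √ω`, where the solutions are multiples of `φ_ω'`, and behaves
like `-(1 + τ²)κ` for large `κ`. A zero `κ > √ω` gives the eigenvalue `ω - κ² < 0`. -/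

lemma absolutelyContinuous_intervalIntegral_complex {f : ℝ → ℂ} {a b c : ℝ}
    (h : IntervalIntegrable f volume a b) (hc : c ∈ Set.uIcc a b)
    (hcx : ∀ x ∈ Set.uIcc a b, IntervalIntegrable f volume c x) :
    AbsolutelyContinuousOnInterval (fun x => ∫ t in c..x, f t) a b := by
  have hre : IntervalIntegrable (fun x => (f x).re) volume a b := ⟨h.1.re, h.2.re⟩
  have him : IntervalIntegrable (fun x => (f x).im) volume a b := ⟨h.1.im, h.2.im⟩
  have c1 : AbsolutelyContinuousOnInterval (fun _ => (1 : ℂ)) a b :=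
    (contDiff_const (n := 1)).contDiffOn.absolutelyContinuousOnInterval
  have cI : AbsolutelyContinuousOnInterval (fun _ => Complex.I) a b :=
    (contDiff_const (n := 1)).contDiffOn.absolutelyContinuousOnInterval
  -- Absolute continuity of a primitive is taken for real integrands and applied to the real and
  -- imaginary parts.
  have key := ((hre.absolutelyContinuousOnInterval_intervalIntegral hc).smul c1).add
    ((him.absolutelyContinuousOnInterval_intervalIntegral hc).smul cI)
  have e : ∀ x ∈ Set.uIcc a b, ∫ t in c..x, f t =
      ((∫ t in c..x, (f t).re : ℝ) : ℂ) + ((∫ t in c..x, (f t).im : ℝ) : ℂ) * Complex.I := by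
    intro x hx
    have hf := hcx x hx
    have e1 := Complex.reCLM.intervalIntegral_comp_comm hf
    have e2 := Complex.imCLM.intervalIntegral_comp_comm hf
    simp only [Complex.reCLM_apply, Complex.imCLM_apply] at e1 e2
    rw [e1, e2, Complex.re_add_im]
  rw [absolutelyContinuousOnInterval_iff] at key ⊢
  intro ε hε
  obtain ⟨δ, hδ, H⟩ := key ε hε
  refine ⟨δ, hδ, fun E hE hlt => ?_⟩
  refine lt_of_eq_of_lt (Finset.sum_congr rfl fun i hi => ?_) (H E hE hlt)
  have hm := hE.1 i hi
  rw [e _ hm.1, e _ hm.2]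
  simp [Complex.real_smul]

/-- Integration by parts for a `C¹` function and an indefinite integral. -/
lemma integral_mul_add_deriv_mul {A A' G H : ℝ → ℂ} (hA : ∀ x, HasDerivAt A (A' x) x)
    (hA' : Continuous A') (hH : LocallyIntegrable H) (hG : ∀ x, G x = G 0 + ∫ t in (0 : ℝ)..x, H t)
    (a b : ℝ) : ∫ x in a..b, (A' x * G x + A x * H x) = A b * G b - A a * G a := by
  have hHi : ∀ a b, IntervalIntegrable H volume a b := fun a b =>
    (hH.integrableOn_isCompact isCompact_uIcc).intervalIntegrable
  have cA : Continuous A := continuous_iff_continuousAt.2 fun x => (hA x).continuousAt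
  have hG2 : ∀ x, G x = G a + ∫ t in a..x, H t := by
    intro x
    rw [hG x, hG a, add_assoc, intervalIntegral.integral_add_adjacent_intervals (hHi _ _) (hHi _ _)]
  have cG : Continuous G := by
    have : G = fun x => G 0 + ∫ t in (0 : ℝ)..x, H t := funext hG
    rw [this]
    exact continuous_const.add (intervalIntegral.continuous_primitive hHi 0)
  have hAac : AbsolutelyContinuousOnInterval A a b := by
    refine ContDiffOn.absolutelyContinuousOnInterval (ContDiff.contDiffOn ?_)
    rw [contDiff_one_iff_deriv]
    exact ⟨fun x => (hA x).differentiableAt, by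
      rwa [show deriv A = A' from funext fun x => (hA x).deriv]⟩
  have hGac : AbsolutelyContinuousOnInterval G a b := by
    have : G = fun x => G a + ∫ t in a..x, H t := funext hG2
    rw [this]
    exact ((contDiff_const (n := 1)).contDiffOn.absolutelyContinuousOnInterval).add
      (absolutelyContinuous_intervalIntegral_complex (hHi a b) Set.left_mem_uIcc
        fun x _ => hHi a x)
  have hint : ∀ a b, IntervalIntegrable (fun x => A' x * G x + A x * H x) volume a b :=
    fun a b => ((hA'.mul cG).intervalIntegrable a b).add
      ((hHi a b).continuousOn_mul cA.continuousOn)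
  have hIac := absolutelyContinuous_intervalIntegral_complex (hint a b) Set.left_mem_uIcc
        fun x _ => hint a x
  -- `A G` minus the primitive of its expected derivative is absolutely continuous with derivative
  -- zero almost everywhere, hence constant.
  have hD := (hAac.smul hGac).sub hIac
  obtain ⟨C, hC⟩ := hD.const_of_ae_hasDerivAt_zero (by
    filter_upwards [(hHi a b).ae_hasDerivAt_integral, (hint a b).ae_hasDerivAt_integral]
      with x h1 h2 hx
    have h1' := h1 hx a Set.left_mem_uIcc
    have h2' := h2 hx a Set.left_mem_uIcc
    have h3 : HasDerivAt G (H x) x := by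
      have : G = fun x => G a + ∫ t in a..x, H t := funext hG2
      rw [this]
      exact h1'.const_add _
    have := ((hA x).mul h3).sub h2'
    rw [sub_self] at this
    exact this)
  have e1 := hC a Set.left_mem_uIcc
  have e2 := hC b Set.right_mem_uIcc
  simp only [Pi.sub_apply, smul_eq_mul, Pi.mul_apply, intervalIntegral.integral_same,
    sub_zero] at e1 e2
  linear_combination e1 - e2

/-- A test function on the half-line has support in some `[a, b]` with `0 < a`. -/
lemma exists_Icc_of_compact {K : Set ℝ} (hK : IsCompact K) (hs : K ⊆ Set.Ioi 0) :
    ∃ a b : ℝ, 0 < a ∧ a ≤ b ∧ K ⊆ Set.Icc a b := by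
  rcases K.eq_empty_or_nonempty with rfl | hne
  · exact ⟨1, 1, one_pos, le_rfl, Set.empty_subset _⟩
  · obtain ⟨a, ha, hla⟩ := hK.exists_isLeast hne
    obtain ⟨b, hb, hlb⟩ := hK.exists_isGreatest hne
    exact ⟨a, b, hs ha, hla hb, fun x hx => ⟨hla hx, hlb hx⟩⟩

/-- The lemma of du Bois-Reymond on the half-line. -/
lemma ae_const_of_integral_deriv_smul_eq_zero {f : ℝ → ℂ} (hf : LocallyIntegrable f)
    (h : ∀ φ : ℝ → ℝ, ContDiff ℝ ((⊤ : ℕ∞) : WithTop ℕ∞) φ → HasCompactSupport φ →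
      tsupport φ ⊆ Set.Ioi 0 → ∫ x, deriv φ x • f x = 0) :
    ∃ c : ℂ, ∀ᵐ x, x ∈ Set.Ioi (0 : ℝ) → f x = c := by
  -- A bump supported in `[1, 3]`, away from `0`. Normalized to have integral one, it reads off the
  -- constant as `c = ∫ χ f`.
  let B : ContDiffBump (2 : ℝ) := ⟨1 / 2, 1, by norm_num, by norm_num⟩
  set χ : ℝ → ℝ := B.normed volume with hχ
  have χs : ContDiff ℝ ((⊤ : ℕ∞) : WithTop ℕ∞) χ := B.contDiff_normed
  have χc : HasCompactSupport χ := B.hasCompactSupport_normed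
  have χt : tsupport χ ⊆ Set.Ioi 0 := by
    rw [hχ, B.tsupport_normed_eq]
    intro x hx
    simp only [Metric.mem_closedBall, Real.dist_eq, B] at hx
    have := (abs_le.1 hx).1
    simp only [Set.mem_Ioi]
    linarith
  have χi : ∫ x, χ x = 1 := B.integral_normed
  have hfi : ∀ ψ : ℝ → ℝ, Continuous ψ → HasCompactSupport ψ →
      Integrable (fun x => ψ x • f x) := fun ψ h1 h2 =>
    hf.integrable_smul_left_of_hasCompactSupport h1 h2
  set c := ∫ x, χ x • f x with hc
  refine ⟨c, ?_⟩
  have key := (isOpen_Ioi (a := (0 : ℝ))).ae_eq_zero_of_integral_contDiff_smul_eq_zero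
    (μ := volume) (f := fun x => f x - c)
    ((hf.sub (locallyIntegrable_const c)).locallyIntegrableOn _) ?_
  · filter_upwards [key] with x hx hx0
    exact sub_eq_zero.1 (hx hx0)
  intro ψ ψs ψc ψt
  set m := ∫ x, ψ x with hm
  -- Removing the mean of `ψ` along `χ` leaves a function of integral zero, whose primitive is again
  -- a test function on the half-line; testing with this primitive gives the claim for `ψ`.
  set θ : ℝ → ℝ := fun x => ψ x - m * χ x with hθ
  have θs : ContDiff ℝ ((⊤ : ℕ∞) : WithTop ℕ∞) θ := ψs.sub (contDiff_const.mul χs)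
  have iψ : Integrable ψ := ψs.continuous.integrable_of_hasCompactSupport ψc
  have iχ : Integrable χ := χs.continuous.integrable_of_hasCompactSupport χc
  obtain ⟨a, b, ha, hab, hK⟩ := exists_Icc_of_compact (K := tsupport ψ ∪ tsupport χ)
    (ψc.isCompact.union χc.isCompact) (Set.union_subset ψt χt)
  have θ0 : ∀ x, x ∉ Set.Icc a b → θ x = 0 := by
    intro x hx
    have h1 : x ∉ tsupport ψ := fun h => hx (hK (Or.inl h))
    have h2 : x ∉ tsupport χ := fun h => hx (hK (Or.inr h))
    simp only [hθ, image_eq_zero_of_notMem_tsupport h1, image_eq_zero_of_notMem_tsupport h2,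
      mul_zero, sub_zero]
  have θi : ∫ x, θ x = 0 := by
    rw [hθ, integral_sub iψ (iχ.const_mul m), integral_const_mul, χi, mul_one, sub_self]
  set φ : ℝ → ℝ := fun x => ∫ t in a..x, θ t with hφ
  have φd : ∀ x, HasDerivAt φ (θ x) x := fun x =>
    intervalIntegral.integral_hasDerivAt_right (θs.continuous.intervalIntegrable _ _)
      (θs.continuous.stronglyMeasurableAtFilter _ _) θs.continuous.continuousAt
  have φd' : deriv φ = θ := funext fun x => (φd x).deriv
  have φs : ContDiff ℝ ((⊤ : ℕ∞) : WithTop ℕ∞) φ := by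
    rw [contDiff_infty_iff_deriv]
    exact ⟨fun x => (φd x).differentiableAt, by rw [φd']; exact θs⟩
  have φ0 : ∀ x, x ∉ Set.Icc a b → φ x = 0 := by
    intro x hx
    rw [Set.mem_Icc, not_and_or, not_le, not_le] at hx
    rcases hx with hx | hx
    · rw [hφ]
      refine intervalIntegral.integral_zero_ae ?_
      have hne : ∀ᵐ t : ℝ, t ≠ a := by simp [ae_iff]
      filter_upwards [hne] with t hta ht
      rw [Set.uIoc_of_ge hx.le] at ht
      exact θ0 t fun h => hta (le_antisymm ht.2 h.1)
    · have hsub : Function.support θ ⊆ Set.Ioc a x ∪ {a} := by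
        intro t ht
        have ht' : t ∈ Set.Icc a b := by
          by_contra hcon
          exact ht (θ0 t hcon)
        rcases ht'.1.eq_or_lt with h | h
        · exact Or.inr h.symm
        · exact Or.inl ⟨h, ht'.2.trans hx.le⟩
      rw [hφ]
      simp only
      rw [intervalIntegral.integral_of_le (hab.trans hx.le), ← θi,
        ← integral_indicator measurableSet_Ioc]
      refine integral_congr_ae ?_
      have hne : ∀ᵐ t : ℝ, t ≠ a := by simp [ae_iff]
      filter_upwards [hne] with t hta
      by_cases ht : t ∈ Set.Ioc a x
      · rw [Set.indicator_of_mem ht]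
      · rw [Set.indicator_of_notMem ht]
        by_contra hcon
        exact (hsub (fun h => hcon h.symm)).elim ht hta
  have φt : tsupport φ ⊆ Set.Icc a b := by
    refine closure_minimal (fun x hx => ?_) isClosed_Icc
    by_contra hcon
    exact hx (φ0 x hcon)
  have φc : HasCompactSupport φ := isCompact_Icc.of_isClosed_subset (isClosed_tsupport _) φt
  have := h φ φs φc (φt.trans fun x hx => lt_of_lt_of_le ha hx.1)
  rw [φd'] at this
  have e1 : ∀ x, θ x • f x = ψ x • f x - m • (χ x • f x) := by
    intro x
    simp only [hθ, sub_smul, smul_smul]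
  simp_rw [e1] at this
  rw [integral_sub (hfi ψ ψs.continuous ψc) ((hfi χ χs.continuous χc).fun_smul m), integral_smul,
    ← hc, sub_eq_zero] at this
  simp_rw [smul_sub]
  rw [integral_sub (hfi ψ ψs.continuous ψc) (iψ.smul_const c), integral_smul_const, ← hm, this,
    sub_self]

/-- A function with a weak derivative on the half-line is an indefinite integral there. -/
lemma ae_eq_integral_of_weakDeriv {f g : ℝ → ℂ} (hf : LocallyIntegrable f)
    (hg : LocallyIntegrable g)
    (h : ∀ φ : ℝ → ℝ, ContDiff ℝ ((⊤ : ℕ∞) : WithTop ℕ∞) φ → HasCompactSupport φ →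
      tsupport φ ⊆ Set.Ioi 0 → ∫ x, deriv φ x • f x = -∫ x, φ x • g x) :
    ∃ c : ℂ, ∀ᵐ x, x ∈ Set.Ioi (0 : ℝ) → f x = c + ∫ t in (0 : ℝ)..x, g t := by
  have hgi : ∀ a b, IntervalIntegrable g volume a b := fun a b =>
    (hg.integrableOn_isCompact isCompact_uIcc).intervalIntegrable
  set F : ℝ → ℂ := fun x => ∫ t in (0 : ℝ)..x, g t with hF
  have cF : Continuous F := intervalIntegral.continuous_primitive hgi 0
  -- The primitive `F` of `g` has the same weak derivative as `f`, so `f - F` has weak derivative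
  -- zero.
  obtain ⟨c, hc⟩ := ae_const_of_integral_deriv_smul_eq_zero (f := fun x => f x - F x)
    (hf.sub cF.locallyIntegrable) (by
      intro φ φs φc φt
      have dφ : Continuous (deriv φ) := φs.continuous_deriv (by simp)
      obtain ⟨a, b, ha, hab, hK⟩ := exists_Icc_of_compact φc.isCompact φt
      have φ0 : ∀ x, x ∉ Set.Icc a b → φ x = 0 := fun x hx =>
        image_eq_zero_of_notMem_tsupport fun h => hx (hK h)
      have dφ0 : ∀ x, x ∉ Set.Icc a b → deriv φ x = 0 := fun x hx =>
        image_eq_zero_of_notMem_tsupport fun h => hx (hK (tsupport_deriv_subset h))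
      -- The interval ends at `b + 1` because `φ0` gives vanishing only outside `Icc a b`, not at
      -- `b` itself.
      have ibp := integral_mul_add_deriv_mul (A := fun x => (φ x : ℂ))
        (A' := fun x => ((deriv φ x : ℝ) : ℂ)) (G := F) (H := g)
        (fun x => (φs.differentiable (by simp) x).hasDerivAt.ofReal_comp)
        (Complex.continuous_ofReal.comp dφ) hg (fun x => by simp [hF]) 0 (b + 1)
      have z0 : φ 0 = 0 := φ0 0 fun h => absurd h.1 (not_le.2 ha)
      have zb : φ (b + 1) = 0 := φ0 _ fun h => by linarith [h.2]
      simp only [z0, zb, Complex.ofReal_zero, zero_mul, sub_self] at ibp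
      have i1 : Integrable (fun x => deriv φ x • F x) :=
        cF.locallyIntegrable.integrable_smul_left_of_hasCompactSupport dφ φc.deriv
      have i2 : Integrable (fun x => φ x • g x) :=
        hg.integrable_smul_left_of_hasCompactSupport φs.continuous φc
      have e : ∫ x, (deriv φ x • F x + φ x • g x) = 0 := by
        rw [intervalIntegral.integral_of_le (by linarith),
          ← integral_indicator measurableSet_Ioc] at ibp
        rw [← ibp]
        congr 1
        ext x
        by_cases hx : x ∈ Set.Ioc 0 (b + 1)
        · rw [Set.indicator_of_mem hx]; simp
        · rw [Set.indicator_of_notMem hx]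
          have : x ∉ Set.Icc a b := fun h => hx ⟨ha.trans_le h.1, h.2.trans (by linarith)⟩
          rw [φ0 x this, dφ0 x this]; simp
      rw [integral_add i1 i2] at e
      simp_rw [smul_sub]
      rw [integral_sub (hf.integrable_smul_left_of_hasCompactSupport dφ φc.deriv) i1,
        h φ φs φc φt]
      linear_combination -e)
  refine ⟨c, ?_⟩
  filter_upwards [hc] with x hx hx0
  rw [← hx hx0]; ring

/-! ### Functions of class `H²` on the half-line -/

/-- `U` is of class `C¹` with derivative `G`, an indefinite integral of `H`, and `U`, `G`, `H` are
square integrable on the half-line. -/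
structure HalfLineH2 (U G H : ℝ → ℂ) : Prop where
  hasDerivAt : ∀ x, HasDerivAt U (G x) x
  eq_integral : ∀ x, G x = G 0 + ∫ t in (0 : ℝ)..x, H t
  memLp_fun : MemLp U 2 (volume.restrict (Set.Ioi 0))
  memLp_deriv : MemLp G 2 (volume.restrict (Set.Ioi 0))
  memLp_second : MemLp H 2 volume

lemma locallyIntegrable_of_memLp_two {f : ℝ → ℂ} (hf : MemLp f 2 volume) : LocallyIntegrable f :=
  hf.locallyIntegrable (by norm_num)

lemma integrable_conj_mul {f g : ℝ → ℂ} {μ : Measure ℝ} (hf : MemLp f 2 μ) (hg : MemLp g 2 μ) :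
    Integrable (fun x => starRingEnd ℂ (f x) * g x) μ :=
  hf.star.integrable_mul hg

lemma continuous_primitive_of_memLp {h : ℝ → ℂ} (hh : MemLp h 2 volume) (c : ℂ) :
    Continuous fun x => c + ∫ t in (0 : ℝ)..x, h t :=
  continuous_const.add (intervalIntegral.continuous_primitive (fun _ _ =>
    ((locallyIntegrable_of_memLp_two hh).integrableOn_isCompact
      isCompact_uIcc).intervalIntegrable) 0)

namespace HalfLineH2

variable {U G H U₁ G₁ H₁ U₂ G₂ H₂ : ℝ → ℂ}

lemma continuous (h : HalfLineH2 U G H) : Continuous U :=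
  continuous_iff_continuousAt.2 fun x => (h.hasDerivAt x).continuousAt

lemma continuous_deriv (h : HalfLineH2 U G H) : Continuous G := by
  rw [show G = fun x => G 0 + ∫ t in (0 : ℝ)..x, H t from funext h.eq_integral]
  exact continuous_primitive_of_memLp h.memLp_second _

lemma linearCombination (h₁ : HalfLineH2 U₁ G₁ H₁) (h₂ : HalfLineH2 U₂ G₂ H₂) (α β : ℂ) :
    HalfLineH2 (fun x => α * U₁ x + β * U₂ x) (fun x => α * G₁ x + β * G₂ x)
      (fun x => α * H₁ x + β * H₂ x) where
  hasDerivAt x := ((h₁.hasDerivAt x).const_mul α).add ((h₂.hasDerivAt x).const_mul β)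
  eq_integral x := by
    have i₁ := ((locallyIntegrable_of_memLp_two h₁.memLp_second).integrableOn_isCompact
      (isCompact_uIcc (a := 0) (b := x))).intervalIntegrable
    have i₂ := ((locallyIntegrable_of_memLp_two h₂.memLp_second).integrableOn_isCompact
      (isCompact_uIcc (a := 0) (b := x))).intervalIntegrable
    rw [intervalIntegral.integral_add (i₁.const_mul α) (i₂.const_mul β),
      intervalIntegral.integral_const_mul, intervalIntegral.integral_const_mul,
      h₁.eq_integral x, h₂.eq_integral x]
    ring
  memLp_fun := (h₁.memLp_fun.const_mul α).add (h₂.memLp_fun.const_mul β)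
  memLp_deriv := (h₁.memLp_deriv.const_mul α).add (h₂.memLp_deriv.const_mul β)
  memLp_second := (h₁.memLp_second.const_mul α).add (h₂.memLp_second.const_mul β)

/-- Both `|U|²` and its derivative are integrable on the half-line: the second fact gives a limit,
the first forces it to be zero. -/
lemma tendsto_normSq (h : HalfLineH2 U G H) :
    Tendsto (fun x => Complex.normSq (U x)) atTop (𝓝 0) := by
  have hd : ∀ x ∈ Set.Ioi (0 : ℝ), HasDerivAt (fun x => starRingEnd ℂ (U x) * U x)
      (starRingEnd ℂ (G x) * U x + starRingEnd ℂ (U x) * G x) x := fun x _ =>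
    (h.hasDerivAt x).star.mul (h.hasDerivAt x)
  have ht := tendsto_zero_of_hasDerivAt_of_integrableOn_Ioi hd
    ((integrable_conj_mul h.memLp_deriv h.memLp_fun).add
      (integrable_conj_mul h.memLp_fun h.memLp_deriv))
    (integrable_conj_mul h.memLp_fun h.memLp_fun)
  have := (Complex.continuous_re.tendsto 0).comp ht
  refine this.congr fun x => ?_
  simp [Complex.normSq_apply]

/-- Integration by parts on the half-line. -/
lemma integral_conj_mul (h₁ : HalfLineH2 U₁ G₁ H₁) (h₂ : HalfLineH2 U₂ G₂ H₂) :
    ∫ x in Set.Ioi (0 : ℝ), starRingEnd ℂ (U₁ x) * H₂ x =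
      -(starRingEnd ℂ (U₁ 0) * G₂ 0) - ∫ x in Set.Ioi (0 : ℝ), starRingEnd ℂ (G₁ x) * G₂ x := by
  have i₁ := integrable_conj_mul h₁.memLp_deriv h₂.memLp_deriv
  have i₂ := integrable_conj_mul h₁.memLp_fun (h₂.memLp_second.restrict (Set.Ioi 0))
  have i₃ := integrable_conj_mul h₁.memLp_fun h₂.memLp_deriv
  have key : ∀ b, starRingEnd ℂ (U₁ b) * G₂ b = starRingEnd ℂ (U₁ 0) * G₂ 0 +
      ∫ x in (0 : ℝ)..b, (starRingEnd ℂ (G₁ x) * G₂ x + starRingEnd ℂ (U₁ x) * H₂ x) := by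
    intro b
    rw [integral_mul_add_deriv_mul (A := fun x => starRingEnd ℂ (U₁ x))
      (A' := fun x => starRingEnd ℂ (G₁ x)) (fun x => (h₁.hasDerivAt x).star)
      (Complex.continuous_conj.comp h₁.continuous_deriv)
      (locallyIntegrable_of_memLp_two h₂.memLp_second) h₂.eq_integral 0 b]
    ring
  have lim := (intervalIntegral_tendsto_integral_Ioi 0 (i₁.add i₂) tendsto_id).const_add
    (starRingEnd ℂ (U₁ 0) * G₂ 0)
  have lim' : Tendsto (fun x => starRingEnd ℂ (U₁ x) * G₂ x) atTop
      (𝓝 (starRingEnd ℂ (U₁ 0) * G₂ 0 + ∫ x in Set.Ioi (0 : ℝ),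
        (starRingEnd ℂ (G₁ x) * G₂ x + starRingEnd ℂ (U₁ x) * H₂ x))) :=
    lim.congr fun x => (key x).symm
  -- The boundary term at infinity converges and is itself integrable near infinity, where the
  -- measure is infinite, so its limit is zero.
  have z := IntegrableAtFilter.eq_zero_of_tendsto (μ := volume)
    ⟨Set.Ioi 0, Ioi_mem_atTop _, i₃⟩ (by
      intro s hs
      rcases mem_atTop_sets.1 hs with ⟨b, hb⟩
      rw [← top_le_iff, ← Real.volume_Ici (a := b)]
      exact measure_mono hb) lim'
  rw [integral_add i₁ i₂] at z
  linear_combination z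

end HalfLineH2

/-- Square integrable functions with two weak derivatives on the half-line are of class
`HalfLineH2`. -/
lemma exists_halfLineH2 {f g h : ℝ → ℂ} (hf : MemLp f 2 volume) (hg : MemLp g 2 volume)
    (hh : MemLp h 2 volume)
    (h₁ : ∀ φ : ℝ → ℝ, ContDiff ℝ ((⊤ : ℕ∞) : WithTop ℕ∞) φ → HasCompactSupport φ →
      tsupport φ ⊆ Set.Ioi 0 → ∫ x, deriv φ x • f x = -∫ x, φ x • g x)
    (h₂ : ∀ φ : ℝ → ℝ, ContDiff ℝ ((⊤ : ℕ∞) : WithTop ℕ∞) φ → HasCompactSupport φ →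
      tsupport φ ⊆ Set.Ioi 0 → ∫ x, deriv φ x • g x = -∫ x, φ x • h x) :
    ∃ U G : ℝ → ℂ, HalfLineH2 U G h ∧ ∀ᵐ x, x ∈ Set.Ioi (0 : ℝ) → f x = U x ∧ g x = G x := by
  obtain ⟨c, hc⟩ := ae_eq_integral_of_weakDeriv (locallyIntegrable_of_memLp_two hf)
    (locallyIntegrable_of_memLp_two hg) h₁
  obtain ⟨d, hd⟩ := ae_eq_integral_of_weakDeriv (locallyIntegrable_of_memLp_two hg)
    (locallyIntegrable_of_memLp_two hh) h₂
  -- The formulas define `G` and `U` on the whole line, which avoids one-sided derivatives at `0`;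
  -- only their values on the positive half-line are related to `g` and `f`.
  set G : ℝ → ℂ := fun x => d + ∫ t in (0 : ℝ)..x, h t with hG
  have cG : Continuous G := continuous_primitive_of_memLp hh d
  set U : ℝ → ℂ := fun x => c + ∫ t in (0 : ℝ)..x, G t with hU
  have hae : ∀ᵐ x, x ∈ Set.Ioi (0 : ℝ) → f x = U x ∧ g x = G x := by
    filter_upwards [hc, hd] with x h1 h2 hx
    refine ⟨?_, h2 hx⟩
    rw [h1 hx, hU]
    congr 1
    refine intervalIntegral.integral_congr_ae ?_
    filter_upwards [hd] with y hy hyx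
    rw [Set.uIoc_of_le (le_of_lt hx)] at hyx
    exact hy hyx.1
  have hae' : ∀ᵐ x ∂(volume.restrict (Set.Ioi (0 : ℝ))), f x = U x ∧ g x = G x :=
    (ae_restrict_iff' measurableSet_Ioi).2 hae
  refine ⟨U, G, ⟨fun x => ?_, fun x => by simp [hG], ?_, ?_, hh⟩, hae⟩
  · exact (intervalIntegral.integral_hasDerivAt_right (cG.intervalIntegrable _ _)
      (cG.stronglyMeasurableAtFilter _ _) cG.continuousAt).const_add c
  · exact (hf.restrict _).ae_eq (hae'.mono fun x hx => hx.1)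
  · exact (hg.restrict _).ae_eq (hae'.mono fun x hx => hx.2)

/-! ### The two branches of a function on the line -/

lemma measurePreserving_neg : MeasurePreserving (fun x : ℝ => -x) volume volume :=
  Measure.measurePreserving_neg volume

lemma ae_neg {p : ℝ → Prop} (h : ∀ᵐ x, p x) : ∀ᵐ x, p (-x) :=
  measurePreserving_neg.quasiMeasurePreserving.ae h

lemma IsWeakDeriv.right {u g : L2} (h : IsWeakDeriv u g) (φ : ℝ → ℝ)
    (hφ : ContDiff ℝ ((⊤ : ℕ∞) : WithTop ℕ∞) φ) (hc : HasCompactSupport φ)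
    (hs : tsupport φ ⊆ Set.Ioi 0) : ∫ x, deriv φ x • u x = -∫ x, φ x • g x :=
  h φ hφ hc (hs.trans fun _ hx => ne_of_gt hx)

/-- The sign is that of the chain rule: reflecting the test function changes the sign of its
derivative, so the weak derivative of `u(-x)` is `-g(-x)`. -/
lemma IsWeakDeriv.left {u g : L2} (h : IsWeakDeriv u g) (φ : ℝ → ℝ)
    (hφ : ContDiff ℝ ((⊤ : ℕ∞) : WithTop ℕ∞) φ) (hc : HasCompactSupport φ)
    (hs : tsupport φ ⊆ Set.Ioi 0) :
    ∫ x, deriv φ x • u (-x) = ∫ x, φ x • g (-x) := by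
  have key := h (fun x => φ (-x)) (hφ.comp contDiff_neg)
    (hc.comp_homeomorph (Homeomorph.neg ℝ)) (by
      intro x hx
      have h1 : tsupport (φ ∘ Homeomorph.neg ℝ) = (Homeomorph.neg ℝ) ⁻¹' tsupport φ :=
        tsupport_comp_eq_preimage φ (Homeomorph.neg ℝ)
      have h2 : x ∈ (Homeomorph.neg ℝ) ⁻¹' tsupport φ := h1 ▸ hx
      have h3 : (0 : ℝ) < -x := hs h2
      rw [Set.mem_compl_singleton_iff]
      linarith)
  have e : ∀ x, deriv (fun x => φ (-x)) x = -deriv φ (-x) := fun x => deriv_comp_neg φ x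
  simp_rw [e] at key
  rw [← integral_neg_eq_self, ← integral_neg_eq_self (fun x => φ x • g (-x))]
  simp only [neg_neg]
  simp only [neg_smul, integral_neg] at key
  exact neg_injective key

/-- Intervals `(0, b)` have positive measure. This makes limits outside null sets unique, so a trace
equals the value at `0` of a continuous branch. -/
lemma neBot_nhdsGT_inf_ae : (𝓝[>] (0 : ℝ) ⊓ ae volume).NeBot := by
  rw [Filter.inf_neBot_iff]
  intro s hs t ht
  obtain ⟨b, hb, hbs⟩ := mem_nhdsGT_iff_exists_Ioo_subset.1 hs
  by_contra hcon
  rw [Set.not_nonempty_iff_eq_empty] at hcon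
  have h1 : Set.Ioo 0 b ⊆ tᶜ := fun x hx hxt =>
    (Set.eq_empty_iff_forall_notMem.1 hcon x) ⟨hbs hx, hxt⟩
  have h2 : volume (Set.Ioo (0 : ℝ) b) = 0 := measure_mono_null h1 (mem_ae_iff.1 ht)
  rw [Real.volume_Ioo, sub_zero, ENNReal.ofReal_eq_zero] at h2
  exact absurd hb (not_lt.2 h2)

lemma tendsto_neg_inf_ae :
    Tendsto (fun x : ℝ => -x) (𝓝[>] (0 : ℝ) ⊓ ae volume) (𝓝[<] (0 : ℝ) ⊓ ae volume) := by
  refine tendsto_inf.2 ⟨Tendsto.mono_left ?_ inf_le_left, Tendsto.mono_left ?_ inf_le_right⟩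
  · have := tendsto_neg_nhdsGT (a := (0 : ℝ))
    rwa [neg_zero] at this
  · exact measurePreserving_neg.quasiMeasurePreserving.tendsto_ae

lemma tendsto_neg_inf_ae' :
    Tendsto (fun x : ℝ => -x) (𝓝[<] (0 : ℝ) ⊓ ae volume) (𝓝[>] (0 : ℝ) ⊓ ae volume) := by
  refine tendsto_inf.2 ⟨Tendsto.mono_left ?_ inf_le_left, Tendsto.mono_left ?_ inf_le_right⟩
  · have := tendsto_neg_nhdsLT (a := (0 : ℝ))
    rwa [neg_zero] at this
  · exact measurePreserving_neg.quasiMeasurePreserving.tendsto_ae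

lemma tendsto_of_ae_eq_right {f U : ℝ → ℂ} (hU : ContinuousAt U 0)
    (h : ∀ᵐ x, x ∈ Set.Ioi (0 : ℝ) → f x = U x) :
    Tendsto f (𝓝[>] (0 : ℝ) ⊓ ae volume) (𝓝 (U 0)) := by
  have h1 : Tendsto U (𝓝[>] (0 : ℝ) ⊓ ae volume) (𝓝 (U 0)) :=
    hU.tendsto.mono_left (inf_le_left.trans nhdsWithin_le_nhds)
  refine h1.congr' ?_
  have h2 : ∀ᶠ x in 𝓝[>] (0 : ℝ) ⊓ ae volume, x ∈ Set.Ioi (0 : ℝ) :=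
    Filter.Eventually.filter_mono inf_le_left self_mem_nhdsWithin
  filter_upwards [h2, h.filter_mono inf_le_right] with x hx hx'
  exact (hx' hx).symm

lemma RightTrace.eq {u : L2} {a : ℂ} (ha : RightTrace u a) {U : ℝ → ℂ} (hU : ContinuousAt U 0)
    (h : ∀ᵐ x, x ∈ Set.Ioi (0 : ℝ) → u x = U x) : a = U 0 :=
  haveI := neBot_nhdsGT_inf_ae
  tendsto_nhds_unique ha (tendsto_of_ae_eq_right hU h)

lemma LeftTrace.eq {u : L2} {a : ℂ} (ha : LeftTrace u a) {U : ℝ → ℂ} (hU : ContinuousAt U 0)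
    (h : ∀ᵐ x, x ∈ Set.Ioi (0 : ℝ) → u (-x) = U x) : a = U 0 :=
  haveI := neBot_nhdsGT_inf_ae
  tendsto_nhds_unique (ha.comp tendsto_neg_inf_ae)
    (tendsto_of_ae_eq_right (f := fun x => u (-x)) hU h)

lemma leftTrace_of_ae_eq {u : L2} {U : ℝ → ℂ} (hU : ContinuousAt U 0)
    (h : ∀ᵐ x, x ∈ Set.Ioi (0 : ℝ) → u (-x) = U x) : LeftTrace u (U 0) := by
  have := (tendsto_of_ae_eq_right (f := fun x => u (-x)) hU h).comp tendsto_neg_inf_ae'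
  refine this.congr fun x => ?_
  simp

/-- The branches of `u` on the two half-lines (the left one reflected), when `u` satisfies the
Fülöp–Tsutsui conditions and has second derivative `w`. -/
structure Branches (τ v : ℝ) (u w : L2) (Um Gm Up Gp : ℝ → ℂ) : Prop where
  right : HalfLineH2 Up Gp w
  left : HalfLineH2 Um Gm (fun x => w (-x))
  ae_right : ∀ᵐ x, x ∈ Set.Ioi (0 : ℝ) → u x = Up x
  ae_left : ∀ᵐ x, x ∈ Set.Ioi (0 : ℝ) → u (-x) = Um x
  jump : Up 0 = τ * Um 0
  jump_deriv : Gm 0 + τ * Gp 0 = -(v * Um 0)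

lemma memLp_comp_neg (u : L2) : MemLp (fun x => u (-x)) 2 volume :=
  (Lp.memLp u).comp_measurePreserving measurePreserving_neg

/-- The left branch is `u(-x)`, so `Gm` is `-u'(-x)`, while the second derivative keeps its sign.
This is why `u'(0-) - τ u'(0+) = v u(0-)` becomes `Gm 0 + τ * Gp 0 = -(v * Um 0)`. -/
lemma exists_branches {τ v : ℝ} {u w : L2} (h : (u, w) ∈ hamiltonianGraph τ v) :
    ∃ Um Gm Up Gp, Branches τ v u (-w) Um Gm Up Gp := by
  obtain ⟨g, h1, h2, uL, uR, gL, gR, huL, huR, hgL, hgR, e1, e2⟩ := h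
  simp only at h1 h2 huL huR
  obtain ⟨Up, Gp, hp, hpe⟩ := exists_halfLineH2 (Lp.memLp u) (Lp.memLp g) (Lp.memLp (-w))
    h1.right h2.right
  obtain ⟨Um, Gm, hm, hme⟩ := exists_halfLineH2 (f := fun x => u (-x)) (g := fun x => -g (-x))
    (h := fun x => (-w : L2) (-x))
    (memLp_comp_neg u) (memLp_comp_neg g).neg (memLp_comp_neg (-w))
    (fun φ a b c => by
      rw [h1.left φ a b c]
      simp only [smul_neg, integral_neg, neg_neg])
    (fun φ a b c => by
      rw [← h2.left φ a b c]
      simp only [smul_neg, integral_neg])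
  have r1 := huR.eq hp.continuous.continuousAt (hpe.mono fun x hx h => (hx h).1)
  have r2 := hgR.eq hp.continuous_deriv.continuousAt (hpe.mono fun x hx h => (hx h).2)
  have l1 := huL.eq hm.continuous.continuousAt (hme.mono fun x hx h => (hx h).1)
  have l2 := hgL.eq (U := fun x => -Gm x) hm.continuous_deriv.neg.continuousAt
    (hme.mono fun x hx h => by rw [← (hx h).2, neg_neg])
  refine ⟨Um, Gm, Up, Gp, hp, hm, hpe.mono fun x hx h => (hx h).1,
    hme.mono fun x hx h => (hx h).1, ?_, ?_⟩
  · rw [← r1, ← l1, e1]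
  · rw [← l1, ← r2]
    linear_combination -e2 + l2

lemma integral_eq_add_neg {f : ℝ → ℂ} (hf : Integrable f) :
    ∫ x, f x = (∫ x in Set.Ioi (0 : ℝ), f x) + ∫ x in Set.Ioi (0 : ℝ), f (-x) := by
  rw [integral_comp_neg_Ioi, neg_zero, add_comm, intervalIntegral.integral_Iic_add_Ioi
    hf.integrableOn hf.integrableOn]

section Form

variable {τ v : ℝ} {u₁ w₁ u₂ w₂ : L2} {Um₁ Gm₁ Up₁ Gp₁ Um₂ Gm₂ Up₂ Gp₂ : ℝ → ℂ}

lemma Branches.inner_eq (u : L2) (h₁ : Branches τ v u₁ w₁ Um₁ Gm₁ Up₁ Gp₁) :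
    inner ℂ u₁ u = (∫ x in Set.Ioi (0 : ℝ), starRingEnd ℂ (Up₁ x) * u x) +
      ∫ x in Set.Ioi (0 : ℝ), starRingEnd ℂ (Um₁ x) * u (-x) := by
  have e : inner ℂ u₁ u = ∫ x, starRingEnd ℂ (u₁ x) * u x := by
    rw [L2.inner_def]
    simp [mul_comm]
  rw [e, integral_eq_add_neg (integrable_conj_mul (Lp.memLp u₁) (Lp.memLp u))]
  congr 1
  · refine integral_congr_ae ((ae_restrict_iff' measurableSet_Ioi).2 ?_)
    filter_upwards [h₁.ae_right] with x hx hx0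
    rw [hx hx0]
  · refine integral_congr_ae ((ae_restrict_iff' measurableSet_Ioi).2 ?_)
    filter_upwards [h₁.ae_left] with x hx hx0
    rw [hx hx0]

/-- The sesquilinear form of the Laplacian with the Fülöp–Tsutsui conditions. -/
lemma Branches.inner_second (h₁ : Branches τ v u₁ w₁ Um₁ Gm₁ Up₁ Gp₁)
    (h₂ : Branches τ v u₂ w₂ Um₂ Gm₂ Up₂ Gp₂) :
    inner ℂ u₁ w₂ = v * (starRingEnd ℂ (Um₁ 0) * Um₂ 0) -
      (∫ x in Set.Ioi (0 : ℝ), starRingEnd ℂ (Gp₁ x) * Gp₂ x) -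
      ∫ x in Set.Ioi (0 : ℝ), starRingEnd ℂ (Gm₁ x) * Gm₂ x := by
  rw [h₁.inner_eq, h₁.right.integral_conj_mul h₂.right, h₁.left.integral_conj_mul h₂.left,
    h₁.jump, map_mul, Complex.conj_ofReal]
  -- Since `Up₁ 0 = τ * Um₁ 0`, the two boundary terms add up to the conjugate of `-Um₁ 0` times
  -- `Gm₂ 0 + τ * Gp₂ 0`.
  linear_combination -(starRingEnd ℂ (Um₁ 0)) * h₂.jump_deriv

end Form

/-! ### Gluing functions on the half-lines -/

/-- The function equal to `R` on the positive half-line and to the reflection of `L` on the negative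
one. -/
noncomputable def glue (L R : ℝ → ℂ) (x : ℝ) : ℂ := if x < 0 then L (-x) else R x

lemma glue_of_pos {L R : ℝ → ℂ} {x : ℝ} (hx : x ∈ Set.Ioi (0 : ℝ)) : glue L R x = R x :=
  if_neg (not_lt.2 (le_of_lt hx))

lemma glue_neg_of_pos {L R : ℝ → ℂ} {x : ℝ} (hx : x ∈ Set.Ioi (0 : ℝ)) :
    glue L R (-x) = L x := by
  rw [glue, if_pos (neg_lt_zero.2 hx), neg_neg]

lemma memLp_glue {L R : ℝ → ℂ}
    (hL2 : MemLp L 2 (volume.restrict (Set.Ioi 0))) (hR2 : MemLp R 2 (volume.restrict (Set.Ioi 0))) :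
    MemLp (glue L R) 2 volume := by
  have hL3 : MemLp (fun x => L (-x)) 2 (volume.restrict (Set.Iio 0)) := by
    refine hL2.comp_measurePreserving ?_
    have := measurePreserving_neg.restrict_preimage (s := Set.Ioi (0 : ℝ)) measurableSet_Ioi
    have e : (fun x : ℝ => -x) ⁻¹' Set.Ioi 0 = Set.Iio 0 := by ext; simp
    rwa [e] at this
  have h1 : MemLp ((Set.Iio (0 : ℝ)).indicator fun x => L (-x)) 2 volume :=
    (memLp_indicator_iff_restrict measurableSet_Iio).2 hL3
  have h2 : MemLp ((Set.Ioi (0 : ℝ)).indicator R) 2 volume :=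
    (memLp_indicator_iff_restrict measurableSet_Ioi).2 hR2
  refine (h1.add h2).ae_eq ?_
  have hne : ∀ᵐ x : ℝ, x ≠ 0 := by simp [ae_iff]
  filter_upwards [hne] with x hx
  rcases lt_or_gt_of_ne hx with h | h
  · simp [glue, h, h.le]
  · simp [glue, h.le, h]

lemma glue_hasDerivAt {L R L' R' : ℝ → ℂ} (hL : ∀ x, HasDerivAt L (L' x) x)
    (hR : ∀ x, HasDerivAt R (R' x) x) {x : ℝ} (hx : x ≠ 0) :
    HasDerivAt (glue L R) (glue (fun y => -L' y) R' x) x := by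
  rcases lt_or_gt_of_ne hx with h | h
  · have h1 : HasDerivAt (fun y : ℝ => L (-y)) (-L' (-x)) x := by
      have := (hL (-x)).scomp x (hasDerivAt_neg x)
      simpa [Function.comp_def] using this
    have h2 : glue (fun y => -L' y) R' x = -L' (-x) := by simp [glue, h]
    rw [h2]
    refine h1.congr_of_eventuallyEq ?_
    filter_upwards [Iio_mem_nhds h] with y hy
    simp [glue, Set.mem_Iio.1 hy]
  · rw [glue_of_pos h]
    refine (hR x).congr_of_eventuallyEq ?_
    filter_upwards [Ioi_mem_nhds h] with y hy
    rw [glue_of_pos hy]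

/-- The test function vanishes near `0`, so its product with the glued function is differentiable
everywhere in spite of the jump, and the derivative of this integrable product has integral zero. -/
lemma integral_deriv_smul_glue {L R L' R' : ℝ → ℂ} (hL : ∀ x, HasDerivAt L (L' x) x)
    (hR : ∀ x, HasDerivAt R (R' x) x) (h : LocallyIntegrable (glue L R))
    (h' : LocallyIntegrable (glue (fun y => -L' y) R')) (φ : ℝ → ℝ)
    (hφ : ContDiff ℝ ((⊤ : ℕ∞) : WithTop ℕ∞) φ) (hc : HasCompactSupport φ)
    (hs : tsupport φ ⊆ {0}ᶜ) :
    ∫ x, deriv φ x • glue L R x = -∫ x, φ x • glue (fun y => -L' y) R' x := by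
  have i1 := h.integrable_smul_left_of_hasCompactSupport (hφ.continuous_deriv (by simp)) hc.deriv
  have i2 := h'.integrable_smul_left_of_hasCompactSupport hφ.continuous hc
  have i3 := h.integrable_smul_left_of_hasCompactSupport hφ.continuous hc
  have hd : ∀ x, HasDerivAt (fun x => φ x • glue L R x)
      (φ x • glue (fun y => -L' y) R' x + deriv φ x • glue L R x) x := by
    intro x
    have hφx := (hφ.differentiable (by simp) x).hasDerivAt
    by_cases hx : x = 0
    · have h0 : φ =ᶠ[𝓝 x] 0 := notMem_tsupport_iff_eventuallyEq.1 fun hcon =>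
        hs hcon (by rw [hx]; rfl)
      have e1 : φ x = 0 := h0.self_of_nhds
      have e2 : deriv φ x = 0 := by
        rw [h0.deriv_eq]; simp
      rw [e1, e2, zero_smul, zero_smul, add_zero]
      refine (hasDerivAt_const x (0 : ℂ)).congr_of_eventuallyEq ?_
      filter_upwards [h0] with y hy
      simp [hy]
    · exact hφx.smul (glue_hasDerivAt hL hR hx)
  have := integral_eq_zero_of_hasDerivAt_of_integrable hd (i2.add i1) i3
  rw [integral_add i2 i1] at this
  linear_combination this

/-- Functions of class `C²` on the half-lines, square integrable with their derivatives and matching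
at the origin, form a function in the domain of the Laplacian. -/
lemma exists_mem_domain_of_branches {τ v : ℝ} {Um Gm Hm Up Gp Hp : ℝ → ℂ}
    (hUm : ∀ x, HasDerivAt Um (Gm x) x) (hGm : ∀ x, HasDerivAt Gm (Hm x) x)
    (hUp : ∀ x, HasDerivAt Up (Gp x) x) (hGp : ∀ x, HasDerivAt Gp (Hp x) x)
    (lUm : MemLp Um 2 (volume.restrict (Set.Ioi 0)))
    (lGm : MemLp Gm 2 (volume.restrict (Set.Ioi 0)))
    (lHm : MemLp Hm 2 (volume.restrict (Set.Ioi 0)))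
    (lUp : MemLp Up 2 (volume.restrict (Set.Ioi 0)))
    (lGp : MemLp Gp 2 (volume.restrict (Set.Ioi 0)))
    (lHp : MemLp Hp 2 (volume.restrict (Set.Ioi 0)))
    (jump : Up 0 = τ * Um 0) (jump_deriv : Gm 0 + τ * Gp 0 = -(v * Um 0)) :
    ∃ u : (hamiltonian τ v).domain, (u : L2) =ᵐ[volume] glue Um Up ∧
      hamiltonian τ v u =ᵐ[volume] fun x => -glue Hm Hp x := by
  have cont : ∀ {A A' : ℝ → ℂ}, (∀ x, HasDerivAt A (A' x) x) → Continuous A :=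
    fun h => continuous_iff_continuousAt.2 fun x => (h x).continuousAt
  have cUm := cont hUm
  have cGm := cont hGm
  have cUp := cont hUp
  have cGp := cont hGp
  have mu := memLp_glue lUm lUp
  have mg := memLp_glue lGm.neg lGp
  have mh := memLp_glue lHm lHp
  obtain ⟨fu, eu⟩ : ∃ fu : L2, fu =ᵐ[volume] glue Um Up := ⟨mu.toLp, mu.coeFn_toLp⟩
  obtain ⟨fg, eg⟩ : ∃ fg : L2, fg =ᵐ[volume] glue (fun y => -Gm y) Gp :=
    ⟨mg.toLp, mg.coeFn_toLp⟩
  obtain ⟨fh, eh⟩ : ∃ fh : L2, fh =ᵐ[volume] glue Hm Hp := ⟨mh.toLp, mh.coeFn_toLp⟩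
  have w1 : IsWeakDeriv fu fg := by
    intro φ hφ hc hs
    have e1 : ∫ x, deriv φ x • fu x = ∫ x, deriv φ x • glue Um Up x := by
      refine integral_congr_ae ?_
      filter_upwards [eu] with x hx
      rw [hx]
    have e2 : ∫ x, φ x • fg x = ∫ x, φ x • glue (fun y => -Gm y) Gp x := by
      refine integral_congr_ae ?_
      filter_upwards [eg] with x hx
      rw [hx]
    rw [e1, e2]
    exact integral_deriv_smul_glue hUm hUp (locallyIntegrable_of_memLp_two mu)
      (locallyIntegrable_of_memLp_two mg) φ hφ hc hs
  have w2 : IsWeakDeriv fg fh := by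
    intro φ hφ hc hs
    have e1 : ∫ x, deriv φ x • fg x = ∫ x, deriv φ x • glue (fun y => -Gm y) Gp x := by
      refine integral_congr_ae ?_
      filter_upwards [eg] with x hx
      rw [hx]
    -- One minus sign comes from the left branch `-Gm` of the first derivative, the other from
    -- differentiating a reflected function.
    have e2 : ∫ x, φ x • fh x = ∫ x, φ x • glue (fun y => - -Hm y) Hp x := by
      refine integral_congr_ae ?_
      filter_upwards [eh] with x hx
      rw [hx]
      simp only [neg_neg]
    rw [e1, e2]
    refine integral_deriv_smul_glue (L' := fun y => -Hm y) (fun x => (hGm x).neg) hGp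
      (locallyIntegrable_of_memLp_two mg) ?_ φ hφ hc hs
    simp only [neg_neg]
    exact locallyIntegrable_of_memLp_two mh
  have bc : BoundaryCondition τ v fu fg := by
    refine ⟨Um 0, Up 0, -Gm 0, Gp 0, ?_, ?_, ?_, ?_, jump, ?_⟩
    · refine leftTrace_of_ae_eq cUm.continuousAt ?_
      filter_upwards [ae_neg eu] with x hx h0
      rw [hx, glue_neg_of_pos h0]
    · refine tendsto_of_ae_eq_right cUp.continuousAt ?_
      filter_upwards [eu] with x hx h0
      rw [hx, glue_of_pos h0]
    · refine leftTrace_of_ae_eq (U := fun x => -Gm x) cGm.neg.continuousAt ?_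
      filter_upwards [ae_neg eg] with x hx h0
      rw [hx, glue_neg_of_pos h0]
    · refine tendsto_of_ae_eq_right cGp.continuousAt ?_
      filter_upwards [eg] with x hx h0
      rw [hx, glue_of_pos h0]
    · linear_combination -jump_deriv
  refine ⟨⟨fu, (mem_hamiltonian_domain_iff τ v _).2 ⟨fg, fh, w1, w2, bc⟩⟩, eu, ?_⟩
  rw [hamiltonian_apply τ v _ w1 w2 bc]
  filter_upwards [Lp.coeFn_neg fh, eh] with x h1 h2
  rw [h1, Pi.neg_apply, h2]

/-! ### Schrödinger operators -/

section Schrodinger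

variable {τ v ω c : ℝ} {V : ℝ → ℝ} {hV : MemLp (fun x => (V x : ℂ)) ∞ volume}

lemma mulOperator_ae (u : L2) : mulOperator V hV u =ᵐ[volume] fun x => (V x : ℂ) * u x := by
  have h := (ContinuousLinearMap.mul ℂ ℂ).coeFn_holder (r := 2) hV.toLp u
  filter_upwards [h, hV.coeFn_toLp] with x h1 h2
  change (ContinuousLinearMap.mul ℂ ℂ).holder 2 hV.toLp u x = _
  rw [h1, h2]
  rfl

lemma schrodinger_ae (u : (schrodinger τ v ω c V hV).domain) :
    schrodinger τ v ω c V hV u =ᵐ[volume]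
      fun x => (hamiltonian τ v u) x + (ω - c * V x : ℂ) * (u : L2) x := by
  have e : schrodinger τ v ω c V hV u =
      hamiltonian τ v u + ((ω : ℂ) • (u : L2) - (c : ℂ) • mulOperator V hV u) := rfl
  rw [e]
  filter_upwards [Lp.coeFn_add (hamiltonian τ v u)
    ((ω : ℂ) • (u : L2) - (c : ℂ) • mulOperator V hV u),
    Lp.coeFn_sub ((ω : ℂ) • (u : L2)) ((c : ℂ) • mulOperator V hV u),
    Lp.coeFn_smul (ω : ℂ) (u : L2), Lp.coeFn_smul (c : ℂ) (mulOperator V hV u),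
    mulOperator_ae (hV := hV) (u : L2)] with x h1 h2 h3 h4 h5
  rw [h1, Pi.add_apply, h2, Pi.sub_apply, h3, h4, Pi.smul_apply, Pi.smul_apply, h5, smul_eq_mul,
    smul_eq_mul]
  ring

lemma exists_branches_hamiltonian (u : (hamiltonian τ v).domain) :
    ∃ Um Gm Up Gp, Branches τ v u (-(hamiltonian τ v u)) Um Gm Up Gp :=
  exists_branches
    ((hamiltonianGraph τ v).mem_graph_toLinearPMap (hamiltonianGraph_snd_eq_zero τ v) u)

/-- Solutions of the equation on the half-lines form an eigenfunction. -/
lemma exists_eigenfunction {Um Gm Hm Up Gp Hp : ℝ → ℂ} {z : ℂ}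
    (hUm : ∀ x, HasDerivAt Um (Gm x) x) (hGm : ∀ x, HasDerivAt Gm (Hm x) x)
    (hUp : ∀ x, HasDerivAt Up (Gp x) x) (hGp : ∀ x, HasDerivAt Gp (Hp x) x)
    (lUm : MemLp Um 2 (volume.restrict (Set.Ioi 0)))
    (lGm : MemLp Gm 2 (volume.restrict (Set.Ioi 0)))
    (lHm : MemLp Hm 2 (volume.restrict (Set.Ioi 0)))
    (lUp : MemLp Up 2 (volume.restrict (Set.Ioi 0)))
    (lGp : MemLp Gp 2 (volume.restrict (Set.Ioi 0)))
    (lHp : MemLp Hp 2 (volume.restrict (Set.Ioi 0)))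
    (jump : Up 0 = τ * Um 0) (jump_deriv : Gm 0 + τ * Gp 0 = -(v * Um 0))
    (eqm : ∀ x ∈ Set.Ioi (0 : ℝ), Hm x = (ω - c * V (-x) - z) * Um x)
    (eqp : ∀ x ∈ Set.Ioi (0 : ℝ), Hp x = (ω - c * V x - z) * Up x) :
    ∃ u : (schrodinger τ v ω c V hV).domain, (u : L2) =ᵐ[volume] glue Um Up ∧
      schrodinger τ v ω c V hV u = z • (u : L2) := by
  obtain ⟨u, hu, hw⟩ := exists_mem_domain_of_branches hUm hGm hUp hGp lUm lGm lHm lUp lGp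
    lHp jump jump_deriv
  refine ⟨u, hu, Lp.ext ?_⟩
  have hne : ∀ᵐ x : ℝ, x ≠ 0 := by simp [ae_iff]
  filter_upwards [schrodinger_ae (hV := hV) u, hu, hw, hne, Lp.coeFn_smul z (u : L2)]
    with x h1 h2 h3 h4 h5
  rw [h1, h5, Pi.smul_apply, h3, h2, smul_eq_mul]
  rcases lt_or_gt_of_ne h4 with h | h
  · have e1 : glue Hm Hp x = Hm (-x) := if_pos h
    have e2 : glue Um Up x = Um (-x) := if_pos h
    rw [e1, e2, eqm (-x) (neg_pos.2 h), neg_neg]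
    ring
  · rw [glue_of_pos h, glue_of_pos h, eqp x h]
    ring

variable {u₁ u₂ : (schrodinger τ v ω c V hV).domain}
  {Um₁ Gm₁ Up₁ Gp₁ Um₂ Gm₂ Up₂ Gp₂ : ℝ → ℂ}

/-- The sesquilinear form of a Schrödinger operator. -/
lemma inner_schrodinger {Vm Vp : ℝ → ℝ} (hVp : ∀ x ∈ Set.Ioi (0 : ℝ), V x = Vp x)
    (hVm : ∀ x ∈ Set.Ioi (0 : ℝ), V (-x) = Vm x)
    (h₁ : Branches τ v u₁ (-(hamiltonian τ v u₁)) Um₁ Gm₁ Up₁ Gp₁)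
    (h₂ : Branches τ v u₂ (-(hamiltonian τ v u₂)) Um₂ Gm₂ Up₂ Gp₂) :
    inner ℂ (u₁ : L2) (schrodinger τ v ω c V hV u₂) =
      (∫ x in Set.Ioi (0 : ℝ), starRingEnd ℂ (Gp₁ x) * Gp₂ x) +
      (∫ x in Set.Ioi (0 : ℝ), starRingEnd ℂ (Up₁ x) * ((ω - c * Vp x) * Up₂ x)) +
      ((∫ x in Set.Ioi (0 : ℝ), starRingEnd ℂ (Gm₁ x) * Gm₂ x) +
      ∫ x in Set.Ioi (0 : ℝ), starRingEnd ℂ (Um₁ x) * ((ω - c * Vm x) * Um₂ x)) -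
      v * (starRingEnd ℂ (Um₁ 0) * Um₂ 0) := by
  have e : schrodinger τ v ω c V hV u₂ = hamiltonian τ v u₂ +
      (schrodinger τ v ω c V hV u₂ - hamiltonian τ v u₂) := by abel
  have e' : (schrodinger τ v ω c V hV u₂ - hamiltonian τ v u₂ : L2) =ᵐ[volume]
      fun x => (ω - c * V x : ℂ) * (u₂ : L2) x := by
    filter_upwards [schrodinger_ae u₂,
      Lp.coeFn_sub (schrodinger τ v ω c V hV u₂) (hamiltonian τ v u₂)] with x h1 h2
    rw [h2, Pi.sub_apply, h1, add_sub_cancel_left]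
  have i1 := h₁.inner_second h₂
  rw [inner_neg_right] at i1
  rw [e, inner_add_right, h₁.inner_eq (schrodinger τ v ω c V hV u₂ - hamiltonian τ v u₂)]
  have i2 : (∫ x in Set.Ioi (0 : ℝ), starRingEnd ℂ (Up₁ x) *
      (schrodinger τ v ω c V hV u₂ - hamiltonian τ v u₂ : L2) x) =
      ∫ x in Set.Ioi (0 : ℝ), starRingEnd ℂ (Up₁ x) * ((ω - c * Vp x) * Up₂ x) := by
    refine integral_congr_ae ((ae_restrict_iff' measurableSet_Ioi).2 ?_)
    filter_upwards [e', h₂.ae_right] with x h1 h2 hx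
    rw [h1, h2 hx, hVp x hx]
  have i3 : (∫ x in Set.Ioi (0 : ℝ), starRingEnd ℂ (Um₁ x) *
      (schrodinger τ v ω c V hV u₂ - hamiltonian τ v u₂ : L2) (-x)) =
      ∫ x in Set.Ioi (0 : ℝ), starRingEnd ℂ (Um₁ x) * ((ω - c * Vm x) * Um₂ x) := by
    refine integral_congr_ae ((ae_restrict_iff' measurableSet_Ioi).2 ?_)
    filter_upwards [ae_neg e', h₂.ae_left] with x h1 h2 hx
    rw [h1, h2 hx, hVm x hx]
  rw [i2, i3]
  linear_combination -i1

end Schrodinger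

/-! ### Lower bounds from the Riccati equation -/

lemma normSq_hasDerivAt {U : ℝ → ℂ} {g : ℂ} {x : ℝ} (h : HasDerivAt U g x) :
    HasDerivAt (fun x => Complex.normSq (U x)) (2 * (starRingEnd ℂ (U x) * g).re) x := by
  have h1 : HasDerivAt (fun x => (U x).re) g.re x := by
    have := Complex.reCLM.hasFDerivAt.comp_hasDerivAt x h
    exact this
  have h2 : HasDerivAt (fun x => (U x).im) g.im x := by
    have := Complex.imCLM.hasFDerivAt.comp_hasDerivAt x h
    exact this
  have h3 := (h1.mul h1).add (h2.mul h2)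
  simp only [Complex.mul_re, Complex.conj_re, Complex.conj_im]
  convert! h3 using 1
  ring

/-- The quadratic form of `-d²/dx² + Q` on the half-line. -/
noncomputable def halfForm (Q : ℝ → ℝ) (U G : ℝ → ℂ) : ℝ :=
  ∫ x in Set.Ioi (0 : ℝ), (Complex.normSq (G x) + Q x * Complex.normSq (U x))

section Riccati

variable {U G H : ℝ → ℂ} {Q p : ℝ → ℝ}

/-- Completing the square: `|G|² + Q|U|²` exceeds the derivative of `p|U|²` by `|G - pU|²`, because
`p' = Q - p²`. -/
lemma riccati_le {a b : ℝ} (hab : a ≤ b) (hU : ∀ x, HasDerivAt U (G x) x) (hG : Continuous G)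
    (hQ : Continuous Q) (hp : ∀ x ∈ Set.Icc a b, HasDerivAt p (Q x - p x ^ 2) x) :
    p b * Complex.normSq (U b) - p a * Complex.normSq (U a) ≤
      ∫ x in a..b, (Complex.normSq (G x) + Q x * Complex.normSq (U x)) := by
  have cU : Continuous U := continuous_iff_continuousAt.2 fun x => (hU x).continuousAt
  have cp : ContinuousOn p (Set.Icc a b) := fun x hx => (hp x hx).continuousAt.continuousWithinAt
  have cf : Continuous fun x => Complex.normSq (G x) + Q x * Complex.normSq (U x) :=
    (Complex.continuous_normSq.comp hG).add (hQ.mul (Complex.continuous_normSq.comp cU))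
  have cd : ContinuousOn (fun x => (Q x - p x ^ 2) * Complex.normSq (U x) +
      p x * (2 * (starRingEnd ℂ (U x) * G x).re)) (Set.Icc a b) := by
    refine ((hQ.continuousOn.sub (cp.pow 2)).mul
      (Complex.continuous_normSq.comp cU).continuousOn).add (cp.mul ?_)
    exact (continuous_const.mul (Complex.continuous_re.comp
      ((Complex.continuous_conj.comp cU).mul hG))).continuousOn
  have hi : IntervalIntegrable (fun x => (Q x - p x ^ 2) * Complex.normSq (U x) +
      p x * (2 * (starRingEnd ℂ (U x) * G x).re)) volume a b := by
    rw [← Set.uIcc_of_le hab] at cd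
    exact cd.intervalIntegrable
  rw [← intervalIntegral.integral_eq_sub_of_hasDerivAt (f := fun x => p x * Complex.normSq (U x))
    (fun x hx => (hp x (by rwa [Set.uIcc_of_le hab] at hx)).mul (normSq_hasDerivAt (hU x))) hi]
  refine intervalIntegral.integral_mono_on hab hi (cf.intervalIntegrable _ _) fun x _ => ?_
  have := Complex.normSq_nonneg (G x - p x * U x)
  simp only [Complex.normSq_apply, Complex.sub_re, Complex.sub_im, Complex.mul_re, Complex.mul_im,
    Complex.ofReal_re, Complex.ofReal_im, Complex.conj_re, Complex.conj_im] at this ⊢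
  nlinarith [this]

lemma integrable_normSq {U : ℝ → ℂ} {μ : Measure ℝ} (hU : MemLp U 2 μ) :
    Integrable (fun x => Complex.normSq (U x)) μ := by
  have := (integrable_conj_mul hU hU).re
  refine this.congr (ae_of_all _ fun x => ?_)
  simp [Complex.normSq_apply]

lemma integrable_halfForm (h : HalfLineH2 U G H) (hQ : Continuous Q) {C : ℝ}
    (hC : ∀ x, |Q x| ≤ C) :
    IntegrableOn (fun x => Complex.normSq (G x) + Q x * Complex.normSq (U x)) (Set.Ioi 0) :=
  (integrable_normSq h.memLp_deriv).add
    ((integrable_normSq h.memLp_fun).bdd_mul hQ.aestronglyMeasurable (ae_of_all _ hC))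

/-- With `p` bounded and `|U|² → 0`, the boundary term at infinity disappears and only the one at
`a` is left. -/
lemma riccati_Ioi (h : HalfLineH2 U G H) (hQ : Continuous Q) {C : ℝ} (hC : ∀ x, |Q x| ≤ C)
    {a D : ℝ} (hp : ∀ x, a ≤ x → HasDerivAt p (Q x - p x ^ 2) x) (hD : ∀ x, a ≤ x → |p x| ≤ D) :
    -(p a * Complex.normSq (U a)) ≤ halfForm Q U G -
      ∫ x in (0 : ℝ)..a, (Complex.normSq (G x) + Q x * Complex.normSq (U x)) := by
  have cf : Continuous fun x => Complex.normSq (G x) + Q x * Complex.normSq (U x) :=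
    (Complex.continuous_normSq.comp h.continuous_deriv).add
      (hQ.mul (Complex.continuous_normSq.comp h.continuous))
  have l1 := (intervalIntegral_tendsto_integral_Ioi 0 (integrable_halfForm h hQ hC)
    tendsto_id).sub_const (∫ x in (0 : ℝ)..a, (Complex.normSq (G x) + Q x * Complex.normSq (U x)))
  have l2 : Tendsto (fun x => p x * Complex.normSq (U x)) atTop (𝓝 0) := by
    refine squeeze_zero_norm' (a := fun x => D * Complex.normSq (U x)) ?_ ?_
    · filter_upwards [Ici_mem_atTop a] with x hx
      rw [norm_mul, Real.norm_eq_abs, Real.norm_of_nonneg (Complex.normSq_nonneg _)]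
      exact mul_le_mul_of_nonneg_right (hD x hx) (Complex.normSq_nonneg _)
    · simpa using h.tendsto_normSq.const_mul D
  have l3 := l2.sub_const (p a * Complex.normSq (U a))
  rw [zero_sub] at l3
  refine le_of_tendsto_of_tendsto l3 l1 ?_
  filter_upwards [Ici_mem_atTop a] with x hx
  have := riccati_le hx h.hasDerivAt h.continuous_deriv hQ (fun y hy => hp y hy.1)
  have hsplit := intervalIntegral.integral_add_adjacent_intervals (μ := volume)
    (cf.intervalIntegrable 0 a) (cf.intervalIntegrable a x)
  simp only [id]
  linarith

/-- The lower bound when the solution of the Riccati equation has a pole at a zero of `U`. -/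
lemma riccati_singular (h : HalfLineH2 U G H) (hQ : Continuous Q) {C : ℝ} (hC : ∀ x, |Q x| ≤ C)
    {y : ℝ} (hy : 0 ≤ y) (hp : ∀ x, x ≠ y → HasDerivAt p (Q x - p x ^ 2) x)
    (hD : ∀ a, y < a → ∃ D, ∀ x, a ≤ x → |p x| ≤ D)
    (hlim : Tendsto (fun x => p x * Complex.normSq (U x)) (𝓝[≠] y) (𝓝 0)) (h0 : p y = 0) :
    -(p 0 * Complex.normSq (U 0)) ≤ halfForm Q U G := by
  have cf : Continuous fun x => Complex.normSq (G x) + Q x * Complex.normSq (U x) :=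
    (Complex.continuous_normSq.comp h.continuous_deriv).add
      (hQ.mul (Complex.continuous_normSq.comp h.continuous))
  have cI : Continuous fun b => ∫ x in (0 : ℝ)..b,
      (Complex.normSq (G x) + Q x * Complex.normSq (U x)) :=
    intervalIntegral.continuous_primitive (fun a b => cf.intervalIntegrable a b) 0
  -- The pole splits the half-line. To its right the bound is applied on `[a, ∞)` and `a` decreases
  -- to `y`; the boundary term at `a` tends to zero by `hlim`.
  have r1 : 0 ≤ halfForm Q U G -
      ∫ x in (0 : ℝ)..y, (Complex.normSq (G x) + Q x * Complex.normSq (U x)) := by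
    have l1 : Tendsto (fun x => -(p x * Complex.normSq (U x))) (𝓝[>] y) (𝓝 0) := by
      simpa using (hlim.mono_left (nhdsWithin_mono (s := Set.Ioi y) _
        fun x hx => ne_of_gt hx)).neg
    have l2 := (cI.tendsto y).mono_left (nhdsWithin_le_nhds (s := Set.Ioi y))
    refine le_of_tendsto_of_tendsto l1 (l2.const_sub (halfForm Q U G)) ?_
    filter_upwards [self_mem_nhdsWithin] with a ha
    obtain ⟨D, hD⟩ := hD a ha
    exact riccati_Ioi h hQ hC (fun x hx => hp x (ne_of_gt (lt_of_lt_of_le ha hx))) hD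
  rcases hy.eq_or_lt with rfl | hy
  -- If the pole is at the origin, `p 0` stands for the junk value `0` supplied by `h0`, so the left
  -- side is zero.
  · rw [intervalIntegral.integral_same, sub_zero] at r1
    rw [h0]
    simpa using r1
  · have r2 : 0 - p 0 * Complex.normSq (U 0) ≤
        ∫ x in (0 : ℝ)..y, (Complex.normSq (G x) + Q x * Complex.normSq (U x)) := by
      have l1 := (hlim.mono_left (nhdsWithin_mono (s := Set.Iio y) _
        fun x hx => ne_of_lt hx)).sub_const (p 0 * Complex.normSq (U 0))
      have l2 := (cI.tendsto y).mono_left (nhdsWithin_le_nhds (s := Set.Iio y))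
      refine le_of_tendsto_of_tendsto l1 l2 ?_
      filter_upwards [Ioo_mem_nhdsLT hy] with b hb
      exact riccati_le hb.1.le h.hasDerivAt h.continuous_deriv hQ
        (fun x hx => hp x (ne_of_lt (lt_of_le_of_lt hx.2 hb.2)))
    linarith

end Riccati

/-! ### The soliton -/

lemma hasDerivAt_tanh (x : ℝ) : HasDerivAt Real.tanh (1 - Real.tanh x ^ 2) x := by
  have h := (Real.hasDerivAt_sinh x).div (Real.hasDerivAt_cosh x) (Real.cosh_pos x).ne'
  have e : Real.tanh = fun x => Real.sinh x / Real.cosh x :=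
    funext fun x => Real.tanh_eq_sinh_div_cosh x
  have hc := (Real.cosh_pos x).ne'
  rw [e]
  convert! h using 1
  field_simp

/-- `tanh (μ √ω (x + s))`. -/
noncomputable def tanhShift (μ ω s x : ℝ) : ℝ := Real.tanh (μ * √ω * (x + s))

/-- The potential `φ_ω(x + s)^{2μ}`. -/
noncomputable def well (μ ω s x : ℝ) : ℝ := ω * (μ + 1) * (1 - tanhShift μ ω s x ^ 2)

section Soliton

variable {μ ω : ℝ}

lemma tanhShift_hasDerivAt (μ ω s x : ℝ) :
    HasDerivAt (tanhShift μ ω s) (μ * √ω * (1 - tanhShift μ ω s x ^ 2)) x := by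
  have h : HasDerivAt (fun x : ℝ => μ * √ω * (x + s)) (μ * √ω * 1) x :=
    ((hasDerivAt_id x).add_const s).const_mul _
  have := (hasDerivAt_tanh (μ * √ω * (x + s))).comp x h
  convert! this using 1
  rw [mul_one, mul_comm]
  rfl

lemma tanhShift_sq_lt (μ ω s x : ℝ) : tanhShift μ ω s x ^ 2 < 1 := Real.tanh_sq_lt_one _

lemma abs_tanhShift_lt (μ ω s x : ℝ) : |tanhShift μ ω s x| < 1 := Real.abs_tanh_lt_one _

lemma continuous_tanhShift (μ ω s : ℝ) : Continuous (tanhShift μ ω s) :=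
  continuous_iff_continuousAt.2 fun x => (tanhShift_hasDerivAt μ ω s x).continuousAt

lemma continuous_well (μ ω s : ℝ) : Continuous (well μ ω s) :=
  continuous_const.mul (continuous_const.sub ((continuous_tanhShift μ ω s).pow 2))

lemma well_nonneg (hμ : 0 < μ) (hω : 0 < ω) (s x : ℝ) : 0 ≤ well μ ω s x :=
  mul_nonneg (by positivity) (by linarith [tanhShift_sq_lt μ ω s x])

lemma well_le (hμ : 0 < μ) (hω : 0 < ω) (s x : ℝ) : well μ ω s x ≤ ω * (μ + 1) :=
  mul_le_of_le_one_right (by positivity) (by linarith [sq_nonneg (tanhShift μ ω s x)])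

lemma abs_sub_mul_well_le (hμ : 0 < μ) (hω : 0 < ω) (c s x : ℝ) :
    |ω - c * well μ ω s x| ≤ ω + |c| * (ω * (μ + 1)) := by
  refine (abs_sub _ _).trans ?_
  rw [abs_of_pos hω, abs_mul, abs_of_nonneg (well_nonneg hμ hω s x)]
  gcongr
  exact well_le hμ hω s x

lemma soliton_pos (hμ : 0 < μ) (hω : 0 < ω) (x : ℝ) : 0 < soliton μ ω x :=
  mul_pos (Real.rpow_pos_of_pos (by positivity) _) (Real.rpow_pos_of_pos (Real.cosh_pos _) _)

lemma one_sub_tanh_sq (x : ℝ) : 1 - Real.tanh x ^ 2 = (Real.cosh x ^ 2)⁻¹ := by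
  have hc := (Real.cosh_pos x).ne'
  rw [Real.tanh_eq_sinh_div_cosh]
  field_simp
  linarith [Real.cosh_sq x]

/-- The power `2μ` removes the fractional exponents and leaves `cosh⁻² = 1 - tanh²`. After this the
potential is a polynomial in `tanhShift`. -/
lemma soliton_rpow (hμ : 0 < μ) (hω : 0 < ω) (s x : ℝ) :
    soliton μ ω (x + s) ^ (2 * μ) = well μ ω s x := by
  have hc := Real.cosh_pos (μ * √ω * (x + s))
  rw [soliton, Real.mul_rpow (by positivity) (by positivity), ← Real.rpow_mul (by positivity),
    ← Real.rpow_mul hc.le, well, tanhShift, one_sub_tanh_sq]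
  have e1 : 1 / (2 * μ) * (2 * μ) = 1 := by field_simp
  have e2 : -(1 / μ) * (2 * μ) = -(2 : ℕ) := by push_cast; field_simp
  rw [e1, e2, Real.rpow_one, Real.rpow_neg hc.le, Real.rpow_natCast]

lemma soliton_hasDerivAt (hμ : 0 < μ) (s x : ℝ) :
    HasDerivAt (fun x => soliton μ ω (x + s))
      (-√ω * tanhShift μ ω s x * soliton μ ω (x + s)) x := by
  have h : HasDerivAt (fun x : ℝ => μ * √ω * (x + s)) (μ * √ω * 1) x :=
    ((hasDerivAt_id x).add_const s).const_mul _
  have hc := Real.cosh_pos (μ * √ω * (x + s))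
  have h1 := (((Real.hasDerivAt_cosh _).comp x h).rpow_const (p := -(1 / μ))
    (Or.inl hc.ne')).const_mul ((ω * (μ + 1)) ^ (1 / (2 * μ)))
  convert! h1 using 1
  simp only [Function.comp]
  rw [Real.rpow_sub_one hc.ne', tanhShift, Real.tanh_eq_sinh_div_cosh, soliton]
  field_simp

end Soliton

/-! ### Lower bounds for the half-line forms of the two linearized operators. -/

section HalfForms

variable {μ ω : ℝ} {U G H : ℝ → ℂ}

/-- The form of `-d²/dx² + ω - φ_ω(x + s)^{2μ}` on the half-line. -/
lemma halfForm_one_ge (hμ : 0 < μ) (hω : 0 < ω) (s : ℝ) (h : HalfLineH2 U G H) :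
    √ω * tanhShift μ ω s 0 * Complex.normSq (U 0) ≤
      halfForm (fun x => ω - 1 * well μ ω s x) U G := by
  have hs : √ω ^ 2 = ω := Real.sq_sqrt hω.le
  -- This `p` is the logarithmic derivative of `φ_ω(x + s)`, which solves `ψ'' = (ω - φ_ω^{2μ})ψ`.
  have := riccati_Ioi (p := fun x => -√ω * tanhShift μ ω s x)
    (Q := fun x => ω - 1 * well μ ω s x) (a := 0) (D := √ω) h
    (continuous_const.sub (continuous_const.mul (continuous_well μ ω s)))
    (abs_sub_mul_well_le hμ hω 1 s) (fun x _ => by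
      convert! (tanhShift_hasDerivAt μ ω s x).const_mul (-√ω) using 1
      rw [well]
      linear_combination (-tanhShift μ ω s x ^ 2 + μ * (1 - tanhShift μ ω s x ^ 2)) * hs)
    (fun x _ => by
      rw [abs_mul, abs_neg, abs_of_nonneg (Real.sqrt_nonneg ω)]
      exact mul_le_of_le_one_right (Real.sqrt_nonneg ω) (abs_tanhShift_lt μ ω s x).le)
  rw [intervalIntegral.integral_same, sub_zero] at this
  linarith

/-- The logarithmic derivative of `φ_ω'(x + s)`. -/
noncomputable def logDerivSolitonDeriv (μ ω s x : ℝ) : ℝ :=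
  -√ω * ((μ + 1) * tanhShift μ ω s x - μ / tanhShift μ ω s x)

/-- Differentiating the soliton equation shows that `φ_ω'` solves `ψ'' = (ω - (2μ+1)φ_ω^{2μ})ψ`;
away from its zero this is the Riccati equation of its logarithmic derivative. -/
lemma logDerivSolitonDeriv_hasDerivAt (hω : 0 < ω) (s : ℝ) {x : ℝ}
    (hx : tanhShift μ ω s x ≠ 0) :
    HasDerivAt (logDerivSolitonDeriv μ ω s) (ω - (2 * μ + 1) * well μ ω s x -
      logDerivSolitonDeriv μ ω s x ^ 2) x := by
  have hs : √ω ^ 2 = ω := Real.sq_sqrt hω.le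
  have hT := tanhShift_hasDerivAt μ ω s x
  convert! ((hT.const_mul (μ + 1)).sub ((hasDerivAt_const x μ).div hT hx)).const_mul (-√ω) using 1
  rw [logDerivSolitonDeriv, well]
  set T := tanhShift μ ω s x
  set r := √ω
  rw [← hs]
  field_simp
  ring

lemma tanh_pos {x : ℝ} (hx : 0 < x) : 0 < Real.tanh x := by
  rw [Real.tanh_eq_sinh_div_cosh]
  exact div_pos (Real.sinh_pos_iff.2 hx) (Real.cosh_pos x)

lemma tanhShift_pos (hμ : 0 < μ) (hω : 0 < ω) {s x : ℝ} (h : 0 < x + s) :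
    0 < tanhShift μ ω s x := tanh_pos (by positivity)

lemma tanhShift_ne_zero (hμ : 0 < μ) (hω : 0 < ω) {s x : ℝ} (h : x ≠ -s) :
    tanhShift μ ω s x ≠ 0 := by
  intro h0
  have : Real.tanh (μ * √ω * (x + s)) = Real.tanh 0 := by rw [Real.tanh_zero]; exact h0
  have h1 := Real.tanh_injective this
  have h2 : μ * √ω ≠ 0 := by positivity
  exact h (by linarith [(mul_eq_zero.1 h1).resolve_left h2])

lemma tanhShift_mono (hμ : 0 < μ) (hω : 0 < ω) (s : ℝ) : Monotone (tanhShift μ ω s) := by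
  refine monotone_of_deriv_nonneg
    (fun x => (tanhShift_hasDerivAt μ ω s x).differentiableAt) fun x => ?_
  rw [(tanhShift_hasDerivAt μ ω s x).deriv]
  have := tanhShift_sq_lt μ ω s x
  exact mul_nonneg (by positivity) (by linarith)

lemma exists_logDerivSolitonDeriv_le (hμ : 0 < μ) (hω : 0 < ω) {s a : ℝ} (h : 0 < a + s) :
    ∃ D, ∀ x, a ≤ x → |logDerivSolitonDeriv μ ω s x| ≤ D := by
  refine ⟨√ω * ((μ + 1) * 1 + μ / tanhShift μ ω s a), fun x hx => ?_⟩
  have ha := tanhShift_pos hμ hω h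
  have hm := tanhShift_mono hμ hω s hx
  rw [logDerivSolitonDeriv, abs_mul, abs_neg, abs_of_nonneg (Real.sqrt_nonneg ω)]
  refine mul_le_mul_of_nonneg_left ((abs_sub _ _).trans ?_) (Real.sqrt_nonneg ω)
  rw [abs_mul, abs_div, abs_of_pos (by positivity : 0 < μ + 1), abs_of_pos hμ,
    abs_of_pos (ha.trans_le hm)]
  have := tanhShift_sq_lt μ ω s x
  gcongr
  nlinarith

/-- The pole is simple while `|U|²` and its derivative vanish there. The singular part `|U|² / T` is
a quotient of slopes, tending to `0 / (μ√ω)`. -/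
lemma tendsto_logDerivSolitonDeriv_mul (hμ : 0 < μ) (hω : 0 < ω) {s : ℝ}
    (h : HalfLineH2 U G H) (hU : U (-s) = 0) :
    Tendsto (fun x => logDerivSolitonDeriv μ ω s x * Complex.normSq (U x)) (𝓝[≠] (-s)) (𝓝 0) := by
  have hT := tanhShift_hasDerivAt μ ω s (-s)
  have hN := normSq_hasDerivAt (h.hasDerivAt (-s))
  have T0 : tanhShift μ ω s (-s) = 0 := by simp [tanhShift]
  rw [T0] at hT
  rw [hU] at hN
  simp only [map_zero, zero_mul, Complex.zero_re, mul_zero] at hN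
  have hk : μ * √ω * (1 - 0 ^ 2) ≠ 0 := by
    have : 0 < μ * √ω := by positivity
    simpa using this.ne'
  have l1 := (hasDerivAt_iff_tendsto_slope.1 hN).div (hasDerivAt_iff_tendsto_slope.1 hT) hk
  rw [zero_div] at l1
  have l2 : Tendsto (fun x => Complex.normSq (U x)) (𝓝[≠] (-s)) (𝓝 0) := by
    have := hN.continuousAt.tendsto
    rw [hU, map_zero] at this
    exact this.mono_left nhdsWithin_le_nhds
  have l3 : Tendsto (tanhShift μ ω s) (𝓝[≠] (-s)) (𝓝 0) := by
    have := hT.continuousAt.tendsto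
    rw [T0] at this
    exact this.mono_left nhdsWithin_le_nhds
  have l4 := (((l3.mul l2).const_mul (μ + 1)).sub (l1.const_mul μ)).const_mul (-√ω)
  simp only [mul_zero, sub_zero] at l4
  refine l4.congr' ?_
  filter_upwards [self_mem_nhdsWithin] with x hx
  have hx' : x - -s ≠ 0 := sub_ne_zero.2 hx
  have hT0 := tanhShift_ne_zero hμ hω hx
  simp only [Pi.div_apply, slope_def_field, hU, T0, map_zero, sub_zero, logDerivSolitonDeriv]
  field_simp

/-- The form of `-d²/dx² + ω - (2μ+1) φ_ω(x + s)^{2μ}` on the half-line, when `φ_ω'(x + s)` has no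
zero there. -/
lemma halfForm_two_ge_of_pos (hμ : 0 < μ) (hω : 0 < ω) {s : ℝ} (hs : 0 < s)
    (h : HalfLineH2 U G H) :
    -(logDerivSolitonDeriv μ ω s 0 * Complex.normSq (U 0)) ≤
      halfForm (fun x => ω - (2 * μ + 1) * well μ ω s x) U G := by
  obtain ⟨D, hD⟩ := exists_logDerivSolitonDeriv_le (a := 0) hμ hω (by simpa using hs)
  have := riccati_Ioi h
    (continuous_const.sub (continuous_const.mul (continuous_well μ ω s)))
    (abs_sub_mul_well_le hμ hω (2 * μ + 1) s) (fun x hx => logDerivSolitonDeriv_hasDerivAt hω s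
      (tanhShift_pos hμ hω (by linarith)).ne') hD
  rwa [intervalIntegral.integral_same, sub_zero] at this

/-- The same bound when `φ_ω'(x + s)` vanishes at a zero of `U`. -/
lemma halfForm_two_ge_of_eq_zero (hμ : 0 < μ) (hω : 0 < ω) {s : ℝ} (hs : s ≤ 0)
    (h : HalfLineH2 U G H) (hU : U (-s) = 0) :
    -(logDerivSolitonDeriv μ ω s 0 * Complex.normSq (U 0)) ≤
      halfForm (fun x => ω - (2 * μ + 1) * well μ ω s x) U G := by
  refine riccati_singular h
    (continuous_const.sub (continuous_const.mul (continuous_well μ ω s)))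
    (abs_sub_mul_well_le hμ hω (2 * μ + 1) s) (y := -s) (by linarith)
    (fun x hx => logDerivSolitonDeriv_hasDerivAt hω s (tanhShift_ne_zero hμ hω hx))
    (fun a ha => exists_logDerivSolitonDeriv_le hμ hω (by linarith))
    (tendsto_logDerivSolitonDeriv_mul hμ hω h hU) ?_
  -- At the pole `T = 0`, and division by zero makes the value of `logDerivSolitonDeriv` zero, as
  -- `riccati_singular` requires.
  simp [logDerivSolitonDeriv, tanhShift]

end HalfForms

/-! ### The parameters of the stationary state -/

/-- The algebraic relations satisfied by `T̃_±`. -/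
structure TRelations (τ v ω s R Tm Tp : ℝ) : Prop where
  s_pos : 0 < s
  R_pos : 0 < R
  Tm_sq : Tm ^ 2 < 1
  Tp_sq : Tp ^ 2 < 1
  jump : 1 - Tp ^ 2 = s * (1 - Tm ^ 2)
  jump_deriv : τ ^ 2 * Tp - Tm = v / √ω
  root : Tp - s * τ ^ 2 * Tm = R

/-- With `t = τ²`, `w = v/√ω` and `D = st² - 1`, the numbers `T̃_±` solve the linear system `t T₊ -
T₋ = w`, `T₊ - st T₋ = R`, and the formula for `R²` is the condition that they also satisfy the
quadratic relation `jump`. The bound `w < t + 1` is what puts them in `(-1, 1)`. -/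
lemma tRelations_of_root {τ v ω s R : ℝ} (hs : 0 < s)
    (hsD : (1 < τ ^ 2 ∧ 1 < s) ∨ (τ ^ 2 < 1 ∧ s < 1)) (hτ : τ ≠ 0) (hv : 0 < v) (hω : 0 < ω)
    (hw : v / √ω < τ ^ 2 + 1)
    (hR0 : 0 ≤ R) (hR : R ^ 2 = s * (v / √ω) ^ 2 + (s * (τ ^ 2) ^ 2 - 1) * (s - 1)) :
    TRelations τ v ω s R (1 / (s * (τ ^ 2) ^ 2 - 1) * (v / √ω - τ ^ 2 * R))
      (1 / (s * (τ ^ 2) ^ 2 - 1) * (s * τ ^ 2 * (v / √ω) - R)) := by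
  have hw0 : 0 < v / √ω := by positivity
  set w := v / √ω with hwdef
  have ht : 0 < τ ^ 2 := by positivity
  set t := τ ^ 2 with htdef
  set D := s * t ^ 2 - 1 with hD
  -- `D` and `s - 1` have the same sign, both following `τ² - 1`; hence `R² > 0` and no denominator
  -- vanishes.
  have hDs : 0 < D * (s - 1) ∧ D ≠ 0 := by
    rcases hsD with ⟨h1, h2⟩ | ⟨h1, h2⟩
    · have : 0 < D := by
        have h3 := one_lt_mul_of_lt_of_le h2 (one_lt_pow₀ h1 two_ne_zero).le
        linarith
      exact ⟨mul_pos this (by linarith), this.ne'⟩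
    · have : D < 0 := by
        have h3 := mul_lt_one_of_nonneg_of_lt_one_left hs.le h2 (pow_lt_one₀ ht.le h1 two_ne_zero).le
        linarith
      exact ⟨mul_pos_of_neg_of_neg this (by linarith), this.ne⟩
  have hD0 := hDs.2
  have hRpos : 0 < R := by
    rcases hR0.eq_or_lt with h | h
    · rw [← h] at hR
      nlinarith [mul_pos hs (pow_pos hw0 2), hDs.1]
    · exact h
  have htR : 0 < t * R := mul_pos ht hRpos
  have id1 : (w + D) ^ 2 - (t * R) ^ 2 = D * (t ^ 2 - (w - 1) ^ 2) := by
    rw [mul_pow, hR, hD]; ring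
  have id2 : (t * R) ^ 2 - (w - D) ^ 2 = D * ((w + 1) ^ 2 - t ^ 2) := by
    rw [mul_pow, hR, hD]; ring
  have f1 : w < t + 1 → 1 < t + w → 0 < t ^ 2 - (w - 1) ^ 2 := fun h1 h2 => by
    have := mul_pos (sub_pos.2 h1) (sub_pos.2 h2)
    linarith
  have f2 : t < w + 1 → 0 < (w + 1) ^ 2 - t ^ 2 := fun h1 => by
    have := mul_pos (sub_pos.2 h1) (by linarith : 0 < w + 1 + t)
    linarith
  -- This is `|T₋| < 1`. Each side is compared after squaring, where the gaps factor by `id1` and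
  -- `id2`; besides `w < t + 1`, the factors need inequalities that hold outright or in the only
  -- case where the comparison is not trivial.
  have key : |w - t * R| < |D| := by
    rcases hsD with ⟨h1, h2⟩ | ⟨h1, h2⟩
    · have hst : 1 < s * t := one_lt_mul_of_lt_of_le h2 h1.le
      have hDp : t - 1 < D := by
        have := mul_lt_mul_of_pos_right hst ht
        linarith
      have hDp0 : 0 < D := by linarith
      rw [abs_of_pos hDp0, abs_lt]
      have a1 : t * R < w + D := by
        refine lt_of_pow_lt_pow_left₀ 2 (by linarith) ?_
        have := mul_pos hDp0 (f1 hw (by linarith))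
        linarith
      have a2 : w - D < t * R := by
        rcases le_or_gt (w - D) 0 with h | h
        · linarith
        · refine lt_of_pow_lt_pow_left₀ 2 htR.le ?_
          have := mul_pos hDp0 (f2 (by linarith))
          linarith
      constructor <;> linarith
    · have hst : s * t < 1 := mul_lt_one_of_nonneg_of_lt_one_left hs.le h2 h1.le
      have hDn : D < t - 1 := by
        have := mul_lt_mul_of_pos_right hst ht
        linarith
      have hDn0 : D < 0 := by linarith
      rw [abs_of_neg hDn0, abs_lt]
      have a1 : t * R < w - D := by
        refine lt_of_pow_lt_pow_left₀ 2 (by linarith) ?_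
        have := mul_pos (neg_pos.2 hDn0) (f2 (by linarith))
        linarith
      have a2 : w + D < t * R := by
        rcases le_or_gt (w + D) 0 with h | h
        · linarith
        · refine lt_of_pow_lt_pow_left₀ 2 htR.le ?_
          have := mul_pos (neg_pos.2 hDn0) (f1 hw (by linarith))
          linarith
      constructor <;> linarith
  have hTm : (1 / D * (w - t * R)) ^ 2 < 1 := by
    rw [mul_pow, div_pow, one_pow, one_div, inv_mul_lt_iff₀ (by positivity), mul_one]
    exact sq_lt_sq.2 key
  have hj : 1 - (1 / D * (s * t * w - R)) ^ 2 = s * (1 - (1 / D * (w - t * R)) ^ 2) := by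
    field_simp
    linear_combination (D) * hR + (R ^ 2 - s * w ^ 2) * hD
  refine ⟨hs, hRpos, hTm, ?_, hj, ?_, ?_⟩
  -- `|T₊| < 1` follows from `|T₋| < 1` through `1 - T₊² = s(1 - T₋²)`.
  · have : 0 < s * (1 - (1 / D * (w - t * R)) ^ 2) := mul_pos hs (by linarith)
    linarith
  · change t * (1 / D * (s * t * w - R)) - 1 / D * (w - t * R) = w
    clear_value w t D
    field_simp
    rw [hD]; ring
  · change 1 / D * (s * t * w - R) - s * t * (1 / D * (w - t * R)) = R
    clear_value w t D
    field_simp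
    rw [hD]; ring

lemma tRelations {μ τ v ω : ℝ} (hμ : 0 < μ) (hτ0 : τ ≠ 0) (hτ1 : τ ≠ 1) (hτ2 : τ ≠ -1)
    (hv : 0 < v) (hω : v ^ 2 / (τ ^ 2 + 1) ^ 2 < ω) :
    TRelations τ v ω (|τ| ^ (2 * μ)) (rootTerm μ τ v ω) (TMinus μ τ v ω) (TPlus μ τ v ω) := by
  have hω0 : 0 < ω := lt_of_le_of_lt (by positivity) hω
  have ha : 0 < |τ| := abs_pos.2 hτ0
  have hs : 0 < |τ| ^ (2 * μ) := Real.rpow_pos_of_pos ha _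
  have e4 : |τ| ^ (2 * μ + 4) = |τ| ^ (2 * μ) * (τ ^ 2) ^ 2 := by
    rw [Real.rpow_add ha, ← sq_abs τ, ← pow_mul]
    congr 1
    exact_mod_cast Real.rpow_natCast |τ| 4
  have e2 : |τ| ^ (2 * μ + 2) = |τ| ^ (2 * μ) * τ ^ 2 := by
    rw [Real.rpow_add ha, ← sq_abs τ]
    congr 1
    exact_mod_cast Real.rpow_natCast |τ| 2
  -- The assumed lower bound for `ω`, after taking square roots.
  have hw : v / √ω < τ ^ 2 + 1 := by
    rw [div_lt_iff₀ (Real.sqrt_pos.2 hω0)]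
    rw [div_lt_iff₀ (by positivity)] at hω
    refine lt_of_pow_lt_pow_left₀ 2 (by positivity) ?_
    rw [mul_pow, Real.sq_sqrt hω0.le]
    linarith
  have h1 : |τ| ≠ 1 := by
    intro h
    rcases (abs_eq zero_le_one).1 h with h | h
    · exact hτ1 h
    · exact hτ2 h
  have hsD : (1 < τ ^ 2 ∧ 1 < |τ| ^ (2 * μ)) ∨ (τ ^ 2 < 1 ∧ |τ| ^ (2 * μ) < 1) := by
    rw [← sq_abs τ]
    rcases lt_or_gt_of_ne h1 with h | h
    · exact Or.inr ⟨pow_lt_one₀ ha.le h two_ne_zero,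
        Real.rpow_lt_one ha.le h (by positivity)⟩
    · exact Or.inl ⟨one_lt_pow₀ h two_ne_zero, Real.one_lt_rpow h (by positivity)⟩
  have hpos : 0 ≤ v ^ 2 / ω * |τ| ^ (2 * μ) +
      (|τ| ^ (2 * μ) * (τ ^ 2) ^ 2 - 1) * (|τ| ^ (2 * μ) - 1) := by
    have : 0 ≤ (|τ| ^ (2 * μ) * (τ ^ 2) ^ 2 - 1) * (|τ| ^ (2 * μ) - 1) := by
      rcases hsD with ⟨h1, h2⟩ | ⟨h1, h2⟩
      · exact mul_nonneg (by nlinarith) (by linarith)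
      · refine mul_nonneg_of_nonpos_of_nonpos ?_ (by linarith)
        have : (τ ^ 2) ^ 2 ≤ 1 := pow_le_one₀ (by positivity) h1.le
        nlinarith
    positivity
  have := tRelations_of_root hs hsD hτ0 hv hω0 hw (Real.sqrt_nonneg _) (R := rootTerm μ τ v ω) (by
    rw [rootTerm, e4, Real.sq_sqrt hpos, div_pow, Real.sq_sqrt hω0.le]
    ring)
  rw [TMinus, TPlus, e4, e2]
  exact this

/-! ### Solutions of the equation on the half-line -/

/-- `U'' = q U` on `[0, ∞)` with `U' = G`, and `U`, `G` are square integrable. -/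
structure HalfLineSol (q : ℝ → ℝ) (U G : ℝ → ℂ) : Prop where
  continuousOn_fun : ContinuousOn U (Set.Ici 0)
  continuousOn_deriv : ContinuousOn G (Set.Ici 0)
  hasDeriv_fun : ∀ x, 0 ≤ x → HasDerivWithinAt U (G x) (Set.Ici x) x
  hasDeriv_deriv : ∀ x, 0 ≤ x → HasDerivWithinAt G (q x * U x) (Set.Ici x) x
  memLp_fun : MemLp U 2 (volume.restrict (Set.Ioi 0))
  memLp_deriv : MemLp G 2 (volume.restrict (Set.Ioi 0))

namespace HalfLineSol

variable {q : ℝ → ℝ} {U G U₁ G₁ U₂ G₂ : ℝ → ℂ}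

lemma linearCombination (h₁ : HalfLineSol q U₁ G₁) (h₂ : HalfLineSol q U₂ G₂) (α β : ℂ) :
    HalfLineSol q (fun x => α * U₁ x + β * U₂ x) (fun x => α * G₁ x + β * G₂ x) where
  continuousOn_fun := (h₁.continuousOn_fun.const_mul α).add (h₂.continuousOn_fun.const_mul β)
  continuousOn_deriv := (h₁.continuousOn_deriv.const_mul α).add (h₂.continuousOn_deriv.const_mul β)
  hasDeriv_fun x hx := ((h₁.hasDeriv_fun x hx).const_mul α).add
    ((h₂.hasDeriv_fun x hx).const_mul β)
  hasDeriv_deriv x hx := by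
    convert! ((h₁.hasDeriv_deriv x hx).const_mul α).add
      ((h₂.hasDeriv_deriv x hx).const_mul β) using 1
    ring
  memLp_fun := (h₁.memLp_fun.const_mul α).add (h₂.memLp_fun.const_mul β)
  memLp_deriv := (h₁.memLp_deriv.const_mul α).add (h₂.memLp_deriv.const_mul β)

/-- The Wronskian of two square integrable solutions vanishes. -/
lemma wronskian_eq_zero (h₁ : HalfLineSol q U₁ G₁) (h₂ : HalfLineSol q U₂ G₂) :
    U₁ 0 * G₂ 0 - G₁ 0 * U₂ 0 = 0 := by
  have hc : ContinuousOn (fun x => U₁ x * G₂ x - G₁ x * U₂ x) (Set.Ici 0) :=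
    (h₁.continuousOn_fun.mul h₂.continuousOn_deriv).sub
      (h₁.continuousOn_deriv.mul h₂.continuousOn_fun)
  have hd : ∀ x, 0 ≤ x → HasDerivWithinAt (fun x => U₁ x * G₂ x - G₁ x * U₂ x) 0 (Set.Ici x) x := by
    intro x hx
    convert! ((h₁.hasDeriv_fun x hx).mul (h₂.hasDeriv_deriv x hx)).sub
      ((h₁.hasDeriv_deriv x hx).mul (h₂.hasDeriv_fun x hx)) using 1
    ring
  have hconst : ∀ x, 0 ≤ x → U₁ x * G₂ x - G₁ x * U₂ x = U₁ 0 * G₂ 0 - G₁ 0 * U₂ 0 := by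
    intro x hx
    exact constant_of_has_deriv_right_zero (hc.mono Set.Icc_subset_Ici_self)
      (fun y hy => hd y hy.1) x ⟨hx, le_rfl⟩
  have hi : Integrable (fun x => U₁ x * G₂ x - G₁ x * U₂ x) (volume.restrict (Set.Ioi 0)) :=
    (h₁.memLp_fun.integrable_mul h₂.memLp_deriv).sub (h₁.memLp_deriv.integrable_mul h₂.memLp_fun)
  -- The Wronskian is constant, and a product of square integrable functions is integrable; a
  -- constant integrable on a set of infinite measure is zero.
  have hi2 : Integrable (fun _ : ℝ => U₁ 0 * G₂ 0 - G₁ 0 * U₂ 0)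
      (volume.restrict (Set.Ioi (0 : ℝ))) := by
    refine hi.congr ((ae_restrict_iff' measurableSet_Ioi).2 (ae_of_all _ fun x hx => ?_))
    exact hconst x (le_of_lt hx)
  rw [integrable_const_iff] at hi2
  rcases hi2 with h | h
  · exact h
  · exfalso
    have := h.measure_univ_lt_top
    rw [Measure.restrict_apply_univ, Real.volume_Ioi] at this
    exact lt_irrefl _ this

/-- A solution with vanishing initial data vanishes. -/
lemma eq_zero (h : HalfLineSol q U G) {C : ℝ} (hC : ∀ x, |q x| ≤ C) (hU : U 0 = 0)
    (hG : G 0 = 0) {x : ℝ} (hx : 0 ≤ x) : U x = 0 ∧ G x = 0 := by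
  have hC0 : 0 ≤ C := (abs_nonneg _).trans (hC 0)
  -- The equation as the first order system `(U, G)' = (G, qU)`, Lipschitz in the maximum norm, to
  -- which Grönwall uniqueness applies.
  have hlip : ∀ t ∈ Set.Ico 0 x, LipschitzOnWith (Real.toNNReal (max 1 C))
      (fun p : ℂ × ℂ => (p.2, (q t : ℂ) * p.1)) Set.univ := by
    intro t _
    refine LipschitzOnWith.of_dist_le_mul fun p _ p' _ => ?_
    rw [Real.coe_toNNReal _ (le_max_of_le_right hC0), dist_eq_norm, dist_eq_norm,
      Prod.norm_def, Prod.norm_def]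
    simp only [Prod.fst_sub, Prod.snd_sub, ← mul_sub, norm_mul, Complex.norm_real,
      Real.norm_eq_abs]
    refine max_le ?_ ?_
    · calc ‖p.2 - p'.2‖ ≤ max ‖p.1 - p'.1‖ ‖p.2 - p'.2‖ := le_max_right _ _
        _ = 1 * max ‖p.1 - p'.1‖ ‖p.2 - p'.2‖ := (one_mul _).symm
        _ ≤ _ := by gcongr; exact le_max_left _ _
    · have h1 : |q t| ≤ max 1 C := (hC t).trans (le_max_right _ _)
      have h2 : ‖p.1 - p'.1‖ ≤ max ‖p.1 - p'.1‖ ‖p.2 - p'.2‖ := le_max_left _ _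
      gcongr
  have := ODE_solution_unique_of_mem_Icc_right hlip (f := fun t => (U t, G t))
    (g := fun _ => (0, 0)) (a := 0) (b := x)
    ((h.continuousOn_fun.mono Set.Icc_subset_Ici_self).prodMk
      (h.continuousOn_deriv.mono Set.Icc_subset_Ici_self))
    (fun t ht => (h.hasDeriv_fun t ht.1).prodMk (h.hasDeriv_deriv t ht.1))
    (fun _ _ => Set.mem_univ _) continuousOn_const
    (fun t _ => by
      simp only [mul_zero]
      exact hasDerivWithinAt_const t (Set.Ici t) ((0 : ℂ), (0 : ℂ)))
    (fun _ _ => Set.mem_univ _) (by simp [hU, hG]) (Set.right_mem_Icc.2 hx)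
  exact Prod.mk.inj this

end HalfLineSol

/-- On the half-line `G` is an indefinite integral of the continuous function `qU`, so the equation
holds pointwise. At the origin only the right derivative is controlled, since `H = qU` is known only
for positive arguments. -/
lemma HalfLineH2.toSol {U G H : ℝ → ℂ} {q : ℝ → ℝ} (h : HalfLineH2 U G H) (hq : Continuous q)
    (hH : ∀ᵐ x, x ∈ Set.Ioi (0 : ℝ) → H x = q x * U x) : HalfLineSol q U G where
  continuousOn_fun := h.continuous.continuousOn
  continuousOn_deriv := h.continuous_deriv.continuousOn
  hasDeriv_fun x _ := (h.hasDerivAt x).hasDerivWithinAt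
  hasDeriv_deriv x hx := by
    have cf : Continuous fun x => (q x : ℂ) * U x :=
      (Complex.continuous_ofReal.comp hq).mul h.continuous
    have e : ∀ y, 0 ≤ y → G y = G 0 + ∫ t in (0 : ℝ)..y, (q t : ℂ) * U t := by
      intro y hy
      rw [h.eq_integral y]
      congr 1
      refine intervalIntegral.integral_congr_ae ?_
      filter_upwards [hH] with t ht hty
      rw [Set.uIoc_of_le hy] at hty
      exact ht hty.1
    have hd : HasDerivAt (fun y => G 0 + ∫ t in (0 : ℝ)..y, (q t : ℂ) * U t)
        ((q x : ℂ) * U x) x :=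
      (intervalIntegral.integral_hasDerivAt_right (cf.intervalIntegrable _ _)
        (cf.stronglyMeasurableAtFilter _ _) cf.continuousAt).const_add _
    exact hd.hasDerivWithinAt.congr (fun y hy => e y (hx.trans hy)) (e x hx)
  memLp_fun := h.memLp_fun
  memLp_deriv := h.memLp_deriv

/-! ### Eigenfunctions of Schrödinger operators -/

section Eigen

variable {τ v ω c : ℝ} {V Vm Vp : ℝ → ℝ} {hV : MemLp (fun x => (V x : ℂ)) ∞ volume}

lemma Branches.congr {u w w' : L2} {Um Gm Up Gp : ℝ → ℂ} (h : Branches τ v u w Um Gm Up Gp)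
    (hw : w = w') : Branches τ v u w' Um Gm Up Gp := hw ▸ h

lemma HalfLineH2.congr {U G H H' : ℝ → ℂ} (h : HalfLineH2 U G H) (hH : H =ᵐ[volume] H') :
    HalfLineH2 U G H' where
  hasDerivAt := h.hasDerivAt
  eq_integral x := by
    rw [h.eq_integral x]
    congr 1
    exact intervalIntegral.integral_congr_ae (hH.mono fun t ht _ => ht)
  memLp_fun := h.memLp_fun
  memLp_deriv := h.memLp_deriv
  memLp_second := h.memLp_second.ae_eq hH

lemma Branches.linearCombination {u₁ w₁ u₂ w₂ : L2} {Um₁ Gm₁ Up₁ Gp₁ Um₂ Gm₂ Up₂ Gp₂ : ℝ → ℂ}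
    (h₁ : Branches τ v u₁ w₁ Um₁ Gm₁ Up₁ Gp₁) (h₂ : Branches τ v u₂ w₂ Um₂ Gm₂ Up₂ Gp₂)
    (α β : ℂ) :
    Branches τ v (α • u₁ + β • u₂) (α • w₁ + β • w₂) (fun x => α * Um₁ x + β * Um₂ x)
      (fun x => α * Gm₁ x + β * Gm₂ x) (fun x => α * Up₁ x + β * Up₂ x)
      (fun x => α * Gp₁ x + β * Gp₂ x) := by
  have comb : ∀ a b : L2, (α • a + β • b : L2) =ᵐ[volume] fun x => α * a x + β * b x := by
    intro a b
    filter_upwards [Lp.coeFn_add (α • a) (β • b), Lp.coeFn_smul α a, Lp.coeFn_smul β b]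
      with x h1 h2 h3
    rw [h1, Pi.add_apply, h2, h3]
    rfl
  refine ⟨(h₁.right.linearCombination h₂.right α β).congr (comb w₁ w₂).symm,
    (h₁.left.linearCombination h₂.left α β).congr (ae_neg (comb w₁ w₂).symm), ?_, ?_, ?_, ?_⟩
  · filter_upwards [h₁.ae_right, h₂.ae_right, comb u₁ u₂] with x a b c hx
    rw [c, a hx, b hx]
  · filter_upwards [h₁.ae_left, h₂.ae_left, ae_neg (comb u₁ u₂)] with x a b c hx
    rw [c, a hx, b hx]
  · rw [h₁.jump, h₂.jump]; ring
  · linear_combination α * h₁.jump_deriv + β * h₂.jump_deriv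

lemma ae_eq_zero_of_branches {u w : L2} {Um Gm Up Gp : ℝ → ℂ}
    (h : Branches τ v u w Um Gm Up Gp) (hm : ∀ x, 0 ≤ x → Um x = 0)
    (hp : ∀ x, 0 ≤ x → Up x = 0) : u = 0 := by
  refine (Lp.eq_zero_iff_ae_eq_zero (f := u)).mpr ?_
  have hne : ∀ᵐ x : ℝ, x ≠ 0 := by simp [ae_iff]
  filter_upwards [h.ae_right, ae_neg h.ae_left, hne] with x h1 h2 hx
  rcases lt_or_gt_of_ne hx with hx | hx
  · have := h2 (neg_pos.2 hx)
    rw [neg_neg] at this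
    rw [this, hm _ (neg_pos.2 hx).le]
    rfl
  · rw [h1 hx, hp x hx.le]
    rfl

/-- The branches of an eigenfunction solve the equation on the half-lines. -/
lemma eigenfunction_sol (hVp : ∀ x ∈ Set.Ioi (0 : ℝ), V x = Vp x)
    (hVm : ∀ x ∈ Set.Ioi (0 : ℝ), V (-x) = Vm x) (cVp : Continuous Vp) (cVm : Continuous Vm)
    {u : (schrodinger τ v ω c V hV).domain} {z : ℝ}
    (hu : schrodinger τ v ω c V hV u = (z : ℂ) • (u : L2)) {Um Gm Up Gp : ℝ → ℂ}
    (h : Branches τ v u (-(hamiltonian τ v u)) Um Gm Up Gp) :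
    HalfLineSol (fun x => ω - c * Vm x - z) Um Gm ∧ HalfLineSol (fun x => ω - c * Vp x - z) Up Gp := by
  have e : (-(hamiltonian τ v u) : L2) =ᵐ[volume] fun x => (ω - c * V x - z : ℂ) * (u : L2) x := by
    have h0 := schrodinger_ae (hV := hV) u
    rw [hu] at h0
    filter_upwards [h0, Lp.coeFn_smul (z : ℂ) (u : L2), Lp.coeFn_neg (hamiltonian τ v u)]
      with x h1 h2 h3
    rw [h3, Pi.neg_apply]
    rw [h2, Pi.smul_apply, smul_eq_mul] at h1
    linear_combination h1
  constructor
  · refine h.left.toSol (by fun_prop) ?_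
    filter_upwards [ae_neg e, h.ae_left] with x h1 h2 hx
    rw [h1, h2 hx, hVm x hx]
    push_cast
    ring
  · refine h.right.toSol (by fun_prop) ?_
    filter_upwards [e, h.ae_right] with x h1 h2 hx
    rw [h1, h2 hx, hVp x hx]
    push_cast
    ring

/-- Because `τ ≠ 0`, the conditions at the origin determine the right Cauchy data from the left
ones, so zero left data propagate to the whole line. -/
lemma eq_zero_of_sol {u w : L2} {Um Gm Up Gp : ℝ → ℂ} {qm qp : ℝ → ℝ} (hτ : τ ≠ 0)
    (h : Branches τ v u w Um Gm Up Gp) (hm : HalfLineSol qm Um Gm) (hp : HalfLineSol qp Up Gp)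
    {Cm Cp : ℝ} (hCm : ∀ x, |qm x| ≤ Cm) (hCp : ∀ x, |qp x| ≤ Cp)
    (h0 : Um 0 = 0) (h1 : Gm 0 = 0) : u = 0 := by
  have e1 : Up 0 = 0 := by rw [h.jump, h0, mul_zero]
  have e2 : Gp 0 = 0 := by
    have := h.jump_deriv
    rw [h0, h1, mul_zero, neg_zero, zero_add] at this
    exact (mul_eq_zero.1 this).resolve_left (by exact_mod_cast hτ)
  exact ae_eq_zero_of_branches h (fun x hx => (hm.eq_zero hCm h0 h1 hx).1)
    (fun x hx => (hp.eq_zero hCp e1 e2 hx).1)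

/-- Eigenvalues are simple. -/
lemma exists_smul_of_eigenfunction (hτ : τ ≠ 0) (hVp : ∀ x ∈ Set.Ioi (0 : ℝ), V x = Vp x)
    (hVm : ∀ x ∈ Set.Ioi (0 : ℝ), V (-x) = Vm x) (cVp : Continuous Vp) (cVm : Continuous Vm)
    {Cm Cp : ℝ} (hCm : ∀ x, |Vm x| ≤ Cm) (hCp : ∀ x, |Vp x| ≤ Cp) {z : ℝ}
    {u₁ u₂ : (schrodinger τ v ω c V hV).domain}
    (hu₁ : schrodinger τ v ω c V hV u₁ = (z : ℂ) • (u₁ : L2))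
    (hu₂ : schrodinger τ v ω c V hV u₂ = (z : ℂ) • (u₂ : L2)) (hne : (u₁ : L2) ≠ 0) :
    ∃ k : ℂ, k • (u₁ : L2) = u₂ := by
  have bd : ∀ {W : ℝ → ℝ} {C : ℝ}, (∀ x, |W x| ≤ C) →
      ∀ x, |ω - c * W x - z| ≤ |ω| + |c| * C + |z| := by
    intro W C hW x
    refine (abs_sub _ _).trans (add_le_add_left ((abs_sub _ _).trans ?_) _)
    rw [abs_mul]
    gcongr
    exact hW x
  obtain ⟨Um₁, Gm₁, Up₁, Gp₁, b₁⟩ := exists_branches_hamiltonian u₁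
  obtain ⟨Um₂, Gm₂, Up₂, Gp₂, b₂⟩ := exists_branches_hamiltonian u₂
  obtain ⟨m₁, p₁⟩ := eigenfunction_sol hVp hVm cVp cVm hu₁ b₁
  obtain ⟨m₂, p₂⟩ := eigenfunction_sol hVp hVm cVp cVm hu₂ b₂
  -- The Wronskian on the left half-line alone suffices: it makes the left data proportional, and
  -- subtracting a multiple leaves zero left data.
  have hw := m₁.wronskian_eq_zero m₂
  have fin : ∀ k : ℂ, k * Um₁ 0 - Um₂ 0 = 0 → k * Gm₁ 0 - Gm₂ 0 = 0 → k • (u₁ : L2) = u₂ := by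
    intro k h1 h2
    have := eq_zero_of_sol hτ (b₁.linearCombination b₂ k (-1))
      (m₁.linearCombination m₂ k (-1)) (p₁.linearCombination p₂ k (-1)) (bd hCm) (bd hCp)
      (by linear_combination h1) (by linear_combination h2)
    rw [neg_one_smul, ← sub_eq_add_neg, sub_eq_zero] at this
    exact this
  by_cases hU : Um₁ 0 = 0
  · by_cases hG : Gm₁ 0 = 0
    · exact absurd (eq_zero_of_sol hτ b₁ m₁ p₁ (bd hCm) (bd hCp) hU hG) hne
    · have hU2 : Um₂ 0 = 0 := by
        rw [hU, zero_mul, zero_sub, neg_eq_zero] at hw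
        exact (mul_eq_zero.1 hw).resolve_left hG
      exact ⟨_, fin (Gm₂ 0 / Gm₁ 0) (by rw [hU, hU2]; ring) (by field_simp; ring)⟩
  · refine ⟨_, fin (Um₂ 0 / Um₁ 0) (by field_simp; ring) ?_⟩
    field_simp
    linear_combination -hw

end Eigen

/-! ### Eigenspaces -/

lemma linearPMap_linearCombination (L : L2 →ₗ.[ℂ] L2) (α β : ℂ) (u₁ u₂ : L.domain) :
    L (α • u₁ + β • u₂) = α • L u₁ + β • L u₂ := by
  rw [L.map_add, L.map_smul, L.map_smul]

section Eigenspaces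

variable {L : L2 →ₗ.[ℂ] L2} {z : ℂ} {w : L2}

lemma mem_eigenspace_iff : w ∈ eigenspace L z ↔ ∃ u : L.domain, L u = z • (u : L2) ∧ (u : L2) = w := by
  constructor
  · rintro ⟨u, hu, rfl⟩
    exact ⟨u, sub_eq_zero.1 (LinearMap.mem_ker.1 hu), rfl⟩
  · rintro ⟨u, hu, rfl⟩
    exact ⟨u, LinearMap.mem_ker.2 (sub_eq_zero.2 hu), rfl⟩

lemma mem_kernel_iff : w ∈ kernel L ↔ ∃ u : L.domain, L u = 0 ∧ (u : L2) = w := by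
  constructor
  · rintro ⟨u, hu, rfl⟩
    exact ⟨u, LinearMap.mem_ker.1 hu, rfl⟩
  · rintro ⟨u, hu, rfl⟩
    exact ⟨u, LinearMap.mem_ker.2 hu, rfl⟩

end Eigenspaces

/-! ### The potential on the half-lines -/

section Potential

variable {μ τ v ω : ℝ}

lemma soliton_neg (μ ω x : ℝ) : soliton μ ω (-x) = soliton μ ω x := by
  rw [soliton, soliton, mul_neg, Real.cosh_neg]

lemma potential_right (hμ : 0 < μ) (hω : 0 < ω) (hτ : τ ≠ 0) :
    ∀ x ∈ Set.Ioi (0 : ℝ), potential μ τ v ω x = well μ ω (xPlus μ τ v ω) x := by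
  intro x hx
  have h1 : |Real.sign τ| = 1 := by
    rcases lt_or_gt_of_ne hτ with h | h
    · simp [Real.sign_of_neg h]
    · simp [Real.sign_of_pos h]
  rw [potential, state, if_neg (not_lt.2 (le_of_lt hx)), abs_mul, h1, one_mul,
    abs_of_pos (soliton_pos hμ hω _), soliton_rpow hμ hω]

lemma potential_left (hμ : 0 < μ) (hω : 0 < ω) :
    ∀ x ∈ Set.Ioi (0 : ℝ), potential μ τ v ω (-x) = well μ ω (-xMinus μ τ v ω) x := by
  intro x hx
  rw [potential, state, if_pos (neg_lt_zero.2 hx), abs_of_pos (soliton_pos hμ hω _),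
    ← soliton_rpow hμ hω, ← soliton_neg]
  congr 2
  ring

lemma abs_well_le (hμ : 0 < μ) (hω : 0 < ω) (s x : ℝ) : |well μ ω s x| ≤ ω * (μ + 1) := by
  rw [abs_of_nonneg (well_nonneg hμ hω s x)]
  exact well_le hμ hω s x

/-- The relations between the two branches, for `S = tanh (μ √ω s)`. -/
structure ShiftRelations (μ τ v ω sm sp : ℝ) : Prop where
  hμ : 0 < μ
  hω : 0 < ω
  hτ : τ ≠ 0
  hv : 0 < v
  deriv_eq : √ω * (τ ^ 2 * tanhShift μ ω sp 0 + tanhShift μ ω sm 0) = v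
  det_neg : ((μ + 1) * tanhShift μ ω sm 0 ^ 2 - μ) * tanhShift μ ω sp 0 +
    τ ^ 2 * ((μ + 1) * tanhShift μ ω sp 0 ^ 2 - μ) * tanhShift μ ω sm 0 -
    (τ ^ 2 * tanhShift μ ω sp 0 + tanhShift μ ω sm 0) *
      (tanhShift μ ω sm 0 * tanhShift μ ω sp 0) < 0
  jump : soliton μ ω (0 + sp) = |τ| * soliton μ ω (0 + sm)

lemma tanhShift_artanh (hμ : 0 < μ) (hω : 0 < ω) {T : ℝ} (hT : T ^ 2 < 1) :
    tanhShift μ ω (Real.artanh T / (μ * √ω)) 0 = T := by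
  have hk : μ * √ω ≠ 0 := by positivity
  rw [tanhShift, zero_add, mul_div_cancel₀ _ hk, Real.tanh_artanh]
  exact abs_lt.1 ((sq_lt_one_iff_abs_lt_one T).1 hT)

lemma tanhShift_neg_zero (μ ω s : ℝ) : tanhShift μ ω (-s) 0 = -tanhShift μ ω s 0 := by
  rw [tanhShift, tanhShift, ← Real.tanh_neg]
  congr 1
  ring

/-- The shift of the left branch is `-x̃_-` because the soliton is even and that branch is
reflected; hence `Sm = -T̃_-` and `Sp = T̃_+`. -/
lemma shiftRelations (hμ : 0 < μ) (hτ0 : τ ≠ 0) (hτ1 : τ ≠ 1) (hτ2 : τ ≠ -1)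
    (hv : 0 < v) (hω : v ^ 2 / (τ ^ 2 + 1) ^ 2 < ω) :
    ShiftRelations μ τ v ω (-xMinus μ τ v ω) (xPlus μ τ v ω) := by
  have hω0 : 0 < ω := lt_of_le_of_lt (by positivity) hω
  have r := tRelations hμ hτ0 hτ1 hτ2 hv hω
  have ep : tanhShift μ ω (xPlus μ τ v ω) 0 = TPlus μ τ v ω := tanhShift_artanh hμ hω0 r.Tp_sq
  have em : tanhShift μ ω (xMinus μ τ v ω) 0 = TMinus μ τ v ω := tanhShift_artanh hμ hω0 r.Tm_sq
  refine ⟨hμ, hω0, hτ0, hv, ?_, ?_, ?_⟩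
  · rw [tanhShift_neg_zero, ep, em, ← sub_eq_add_neg, r.jump_deriv]
    have : √ω ≠ 0 := (Real.sqrt_pos.2 hω0).ne'
    field_simp
  · rw [tanhShift_neg_zero, ep, em]
    have h1 := r.jump
    have h2 := r.root
    have h3 : 0 < μ * (1 - TMinus μ τ v ω ^ 2) * rootTerm μ τ v ω :=
      mul_pos (mul_pos hμ (by linarith [r.Tm_sq])) r.R_pos
    rw [← h2] at h3
    -- The terms free of `μ` cancel and leave `-μ((1 - Sm²)Sp + τ²(1 - Sp²)Sm)`; the relation
    -- between `1 - Sp²` and `1 - Sm²` extracts a common factor, and the other factor is the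
    -- positive root `R`.
    have : ((μ + 1) * (-TMinus μ τ v ω) ^ 2 - μ) * TPlus μ τ v ω +
        τ ^ 2 * ((μ + 1) * TPlus μ τ v ω ^ 2 - μ) * -TMinus μ τ v ω -
        (τ ^ 2 * TPlus μ τ v ω + -TMinus μ τ v ω) * (-TMinus μ τ v ω * TPlus μ τ v ω) =
        -(μ * (1 - TMinus μ τ v ω ^ 2) *
          (TPlus μ τ v ω - |τ| ^ (2 * μ) * τ ^ 2 * TMinus μ τ v ω)) := by
      linear_combination μ * τ ^ 2 * TMinus μ τ v ω * h1
    linarith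
  · have h1 := r.jump
    have e0 : soliton μ ω (0 + -xMinus μ τ v ω) = soliton μ ω (0 + xMinus μ τ v ω) := by
      rw [← soliton_neg]; congr 1; ring
    rw [e0]
    have p1 := soliton_pos hμ hω0 (0 + xPlus μ τ v ω)
    have p2 := soliton_pos hμ hω0 (0 + xMinus μ τ v ω)
    -- Raising both positive sides to the power `2μ` turns the matching of the solitons into `1 -
    -- T₊² = |τ|^{2μ}(1 - T₋²)`.
    refine Real.rpow_left_injOn (x := 2 * μ) (by positivity) p1.le
      (mul_nonneg (abs_nonneg τ) p2.le) ?_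
    simp only
    rw [Real.mul_rpow (abs_nonneg τ) p2.le, soliton_rpow hμ hω0, soliton_rpow hμ hω0, well, well,
      ep, em, h1]
    ring

end Potential

/-! ### Lower bounds for the forms of the linearized operators -/

section Forms

variable {τ v ω c : ℝ} {V Vm Vp : ℝ → ℝ} {hV : MemLp (fun x => (V x : ℂ)) ∞ volume}

lemma integral_conj_add_eq_halfForm {U G H : ℝ → ℂ} {Q : ℝ → ℝ} (h : HalfLineH2 U G H)
    (hQ : Continuous Q) {C : ℝ} (hC : ∀ x, |Q x| ≤ C) :
    (∫ x in Set.Ioi (0 : ℝ), starRingEnd ℂ (G x) * G x) +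
      (∫ x in Set.Ioi (0 : ℝ), starRingEnd ℂ (U x) * (Q x * U x)) = (halfForm Q U G : ℝ) := by
  have e1 : ∀ x, starRingEnd ℂ (G x) * G x = (Complex.normSq (G x) : ℝ) := fun x => by
    rw [mul_comm, Complex.mul_conj]
  have e2 : ∀ x, starRingEnd ℂ (U x) * (Q x * U x) = (Q x * Complex.normSq (U x) : ℝ) := fun x => by
    rw [Complex.ofReal_mul, ← Complex.mul_conj]
    ring
  simp_rw [e1, e2]
  rw [integral_complex_ofReal, integral_complex_ofReal, halfForm,
    integral_add (integrable_normSq h.memLp_deriv)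
      ((integrable_normSq h.memLp_fun).bdd_mul hQ.aestronglyMeasurable (ae_of_all _ hC)),
    Complex.ofReal_add]

lemma inner_self_schrodinger (hVp : ∀ x ∈ Set.Ioi (0 : ℝ), V x = Vp x)
    (hVm : ∀ x ∈ Set.Ioi (0 : ℝ), V (-x) = Vm x) (cVp : Continuous Vp) (cVm : Continuous Vm)
    {Cm Cp : ℝ} (hCm : ∀ x, |ω - c * Vm x| ≤ Cm) (hCp : ∀ x, |ω - c * Vp x| ≤ Cp)
    {u : (schrodinger τ v ω c V hV).domain} {Um Gm Up Gp : ℝ → ℂ}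
    (h : Branches τ v u (-(hamiltonian τ v u)) Um Gm Up Gp) :
    inner ℂ (u : L2) (schrodinger τ v ω c V hV u) =
      ((halfForm (fun x => ω - c * Vp x) Up Gp + halfForm (fun x => ω - c * Vm x) Um Gm -
        v * Complex.normSq (Um 0) : ℝ) : ℂ) := by
  rw [inner_schrodinger hVp hVm h h]
  have e1 := integral_conj_add_eq_halfForm h.right (Q := fun x => ω - c * Vp x) (by fun_prop) hCp
  have e2 := integral_conj_add_eq_halfForm h.left (Q := fun x => ω - c * Vm x) (by fun_prop) hCm
  push_cast at e1 e2 ⊢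
  rw [e1, e2, mul_comm (starRingEnd ℂ (Um 0)), Complex.mul_conj]

/-- Symmetry of the operator: all coefficients of the sesquilinear form are real. It is needed for
the orthogonality of eigenvectors. -/
lemma inner_schrodinger_conj (hVp : ∀ x ∈ Set.Ioi (0 : ℝ), V x = Vp x)
    (hVm : ∀ x ∈ Set.Ioi (0 : ℝ), V (-x) = Vm x) (u₁ u₂ : (schrodinger τ v ω c V hV).domain) :
    starRingEnd ℂ (inner ℂ (u₁ : L2) (schrodinger τ v ω c V hV u₂)) =
      inner ℂ (u₂ : L2) (schrodinger τ v ω c V hV u₁) := by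
  obtain ⟨Um₁, Gm₁, Up₁, Gp₁, b₁⟩ := exists_branches_hamiltonian u₁
  obtain ⟨Um₂, Gm₂, Up₂, Gp₂, b₂⟩ := exists_branches_hamiltonian u₂
  rw [inner_schrodinger hVp hVm b₁ b₂, inner_schrodinger hVp hVm b₂ b₁]
  simp only [map_add, map_sub, map_mul, ← integral_conj, Complex.conj_conj, Complex.conj_ofReal]
  congr 1
  · congr 1
    · congr 1
      · exact integral_congr_ae (ae_of_all _ fun x => by ring)
      · exact integral_congr_ae (ae_of_all _ fun x => by ring)
    · congr 1
      · exact integral_congr_ae (ae_of_all _ fun x => by ring)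
      · exact integral_congr_ae (ae_of_all _ fun x => by ring)
  · ring

/-- Two negative eigenvalues of a Schrödinger operator coincide, if its form is nonnegative on the
kernel of a linear functional. -/
lemma eigenvalue_unique (hVp : ∀ x ∈ Set.Ioi (0 : ℝ), V x = Vp x)
    (hVm : ∀ x ∈ Set.Ioi (0 : ℝ), V (-x) = Vm x) (cVp : Continuous Vp) (cVm : Continuous Vm)
    {Cm Cp : ℝ} (hCm : ∀ x, |ω - c * Vm x| ≤ Cm) (hCp : ∀ x, |ω - c * Vp x| ≤ Cp)
    (ℓ : (ℝ → ℂ) × (ℝ → ℂ) →ₗ[ℂ] ℂ)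
    (hℓ : ∀ Um Gm Hm Up Gp Hp : ℝ → ℂ, HalfLineH2 Um Gm Hm → HalfLineH2 Up Gp Hp →
      Up 0 = τ * Um 0 → ℓ (Um, Up) = 0 →
      0 ≤ halfForm (fun x => ω - c * Vp x) Up Gp + halfForm (fun x => ω - c * Vm x) Um Gm -
        v * Complex.normSq (Um 0))
    {l₁ l₂ : ℝ} (h₁ : l₁ < 0) (h₂ : l₂ < 0)
    (e₁ : IsEigenvalue (schrodinger τ v ω c V hV) l₁)
    (e₂ : IsEigenvalue (schrodinger τ v ω c V hV) l₂) : l₁ = l₂ := by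
  by_contra hne
  obtain ⟨u₁, hu₁, eq₁⟩ := e₁
  obtain ⟨u₂, hu₂, eq₂⟩ := e₂
  have n₁ : 0 < ‖(u₁ : L2)‖ := norm_pos_iff.2 fun h => hu₁ (Subtype.ext h)
  have n₂ : 0 < ‖(u₂ : L2)‖ := norm_pos_iff.2 fun h => hu₂ (Subtype.ext h)
  obtain ⟨Um₁, Gm₁, Up₁, Gp₁, b₁⟩ := exists_branches_hamiltonian u₁
  obtain ⟨Um₂, Gm₂, Up₂, Gp₂, b₂⟩ := exists_branches_hamiltonian u₂
  have orth : inner ℂ (u₁ : L2) (u₂ : L2) = 0 := by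
    have h := inner_schrodinger_conj hVp hVm u₁ u₂
    rw [eq₁, eq₂, inner_smul_right, inner_smul_right, map_mul, inner_conj_symm,
      Complex.conj_ofReal] at h
    have h' : ((l₂ - l₁ : ℝ) : ℂ) * inner ℂ (u₂ : L2) (u₁ : L2) = 0 := by
      push_cast; linear_combination h
    have h3 := (mul_eq_zero.1 h').resolve_left (by
      rw [Complex.ofReal_eq_zero]
      exact sub_ne_zero.2 fun h => hne h.symm)
    rw [← inner_conj_symm, h3, map_zero]
  have orth' : inner ℂ (u₂ : L2) (u₁ : L2) = 0 := by
    rw [← inner_conj_symm, orth, map_zero]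
  -- A single linear functional has a nontrivial zero on the plane spanned by the two eigenvectors.
  obtain ⟨α, β, hαβ, hzero⟩ : ∃ α β : ℂ, (α ≠ 0 ∨ β ≠ 0) ∧
      α * ℓ (Um₁, Up₁) + β * ℓ (Um₂, Up₂) = 0 := by
    by_cases h : ℓ (Um₁, Up₁) = 0
    · exact ⟨1, 0, Or.inl one_ne_zero, by rw [h]; ring⟩
    · exact ⟨ℓ (Um₂, Up₂), -ℓ (Um₁, Up₁), Or.inr (neg_ne_zero.2 h), by ring⟩
  set u : (schrodinger τ v ω c V hV).domain := α • u₁ + β • u₂ with hu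
  have hb : Branches τ v (u : L2) (-(hamiltonian τ v u)) (fun x => α * Um₁ x + β * Um₂ x)
      (fun x => α * Gm₁ x + β * Gm₂ x) (fun x => α * Up₁ x + β * Up₂ x)
      (fun x => α * Gp₁ x + β * Gp₂ x) := by
    refine (b₁.linearCombination b₂ α β).congr ?_
    have : hamiltonian τ v u = α • hamiltonian τ v u₁ + β • hamiltonian τ v u₂ :=
      linearPMap_linearCombination (hamiltonian τ v) α β u₁ u₂
    rw [this, neg_add, smul_neg, smul_neg]
  have hpos := hℓ _ _ _ _ _ _ hb.left hb.right hb.jump (by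
    have : ((fun x => α * Um₁ x + β * Um₂ x, fun x => α * Up₁ x + β * Up₂ x) :
        (ℝ → ℂ) × (ℝ → ℂ)) = α • (Um₁, Up₁) + β • (Um₂, Up₂) := rfl
    rw [this, map_add, map_smul, map_smul, smul_eq_mul, smul_eq_mul, hzero])
  have hi := inner_self_schrodinger hVp hVm cVp cVm hCm hCp hb
  have hL : schrodinger τ v ω c V hV u = (α * l₁) • (u₁ : L2) + (β * l₂) • (u₂ : L2) := by
    rw [hu, linearPMap_linearCombination, eq₁, eq₂, smul_smul, smul_smul]
  have hcoe : (u : L2) = α • (u₁ : L2) + β • (u₂ : L2) := rfl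
  rw [hL, hcoe] at hi
  simp only [inner_add_left, inner_add_right, inner_smul_left, inner_smul_right, orth, orth',
    mul_zero, add_zero, zero_add, inner_self_eq_norm_sq_to_K] at hi
  -- By orthogonality the form at `α u₁ + β u₂` is diagonal, and it is strictly negative, contrary
  -- to `hpos`.
  have hi' : ((Complex.normSq α * l₁ * ‖(u₁ : L2)‖ ^ 2 +
      Complex.normSq β * l₂ * ‖(u₂ : L2)‖ ^ 2 : ℝ) : ℂ) =
      ((halfForm (fun x => ω - c * Vp x) (fun x => α * Up₁ x + β * Up₂ x)
        (fun x => α * Gp₁ x + β * Gp₂ x) + halfForm (fun x => ω - c * Vm x)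
        (fun x => α * Um₁ x + β * Um₂ x) (fun x => α * Gm₁ x + β * Gm₂ x) -
        v * Complex.normSq (α * Um₁ 0 + β * Um₂ 0) : ℝ) : ℂ) := by
    rw [← hi]
    push_cast
    rw [← Complex.mul_conj, ← Complex.mul_conj]
    simp only [Complex.coe_algebraMap]
    ring
  have hi2 := Complex.ofReal_injective hi'
  rw [← hi2] at hpos
  have t1 : 0 ≤ Complex.normSq α * -l₁ * ‖(u₁ : L2)‖ ^ 2 :=
    mul_nonneg (mul_nonneg (Complex.normSq_nonneg _) (by linarith)) (by positivity)
  have t2 : 0 ≤ Complex.normSq β * -l₂ * ‖(u₂ : L2)‖ ^ 2 :=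
    mul_nonneg (mul_nonneg (Complex.normSq_nonneg _) (by linarith)) (by positivity)
  rcases hαβ with h | h
  · have : 0 < Complex.normSq α * -l₁ * ‖(u₁ : L2)‖ ^ 2 :=
      mul_pos (mul_pos (Complex.normSq_pos.2 h) (by linarith)) (by positivity)
    linarith
  · have : 0 < Complex.normSq β * -l₂ * ‖(u₂ : L2)‖ ^ 2 :=
      mul_pos (mul_pos (Complex.normSq_pos.2 h) (by linarith)) (by positivity)
    linarith

end Forms

/-! ### Nonnegativity of the forms for the soliton wells. -/

section Concrete

variable {μ τ v ω sm sp : ℝ}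

lemma tanhShift_zero_neg {s : ℝ} (hμ : 0 < μ) (hω : 0 < ω) (hs : s < 0) : tanhShift μ ω s 0 < 0 := by
  have := tanhShift_pos (x := 0) (s := -s) hμ hω (by linarith)
  rw [tanhShift_neg_zero] at this
  linarith

lemma pos_of_tanhShift_pos {s : ℝ} (hμ : 0 < μ) (hω : 0 < ω) (h : 0 < tanhShift μ ω s 0) :
    0 < s := by
  by_contra hs
  rcases (not_lt.1 hs).eq_or_lt with rfl | hs
  · simp [tanhShift] at h
  · exact absurd (tanhShift_zero_neg hμ hω hs) (not_lt.2 h.le)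

lemma logDerivSolitonDeriv_zero {s : ℝ} (h : tanhShift μ ω s 0 ≠ 0) :
    -logDerivSolitonDeriv μ ω s 0 =
      √ω * (((μ + 1) * tanhShift μ ω s 0 ^ 2 - μ) / tanhShift μ ω s 0) := by
  rw [logDerivSolitonDeriv]
  field_simp

variable {Um Gm Hm Up Gp Hp : ℝ → ℂ}

lemma normSq_jump (h : Up 0 = τ * Um 0) :
    Complex.normSq (Up 0) = τ ^ 2 * Complex.normSq (Um 0) := by
  rw [h, Complex.normSq_mul, Complex.normSq_ofReal]
  ring

/-- The form of `L₂` is nonnegative. -/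
lemma ShiftRelations.form_one_nonneg (r : ShiftRelations μ τ v ω sm sp)
    (hm : HalfLineH2 Um Gm Hm) (hp : HalfLineH2 Up Gp Hp) (jump : Up 0 = τ * Um 0) :
    0 ≤ halfForm (fun x => ω - 1 * well μ ω sp x) Up Gp +
      halfForm (fun x => ω - 1 * well μ ω sm x) Um Gm - v * Complex.normSq (Um 0) := by
  have h1 := halfForm_one_ge r.hμ r.hω sm hm
  have h2 := halfForm_one_ge r.hμ r.hω sp hp
  rw [normSq_jump jump] at h2
  -- The boundary terms add up to `√ω(τ²Sp + Sm)|Um 0|²`, which is exactly `v|Um 0|²`.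
  have e := congrArg (fun a => a * Complex.normSq (Um 0)) r.deriv_eq
  linarith

/-- For `s ≥ 0` the zero `-s` of `φ_ω'(x + s)` is not in the open half-line, and the Dirichlet
condition removes the boundary term. -/
lemma halfForm_two_nonneg_of_dirichlet {s : ℝ} (hμ : 0 < μ) (hω : 0 < ω) (hs : 0 ≤ s)
    (h : HalfLineH2 Um Gm Hm) (h0 : Um 0 = 0) :
    0 ≤ halfForm (fun x => ω - (2 * μ + 1) * well μ ω s x) Um Gm := by
  have key : -(logDerivSolitonDeriv μ ω s 0 * Complex.normSq (Um 0)) ≤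
      halfForm (fun x => ω - (2 * μ + 1) * well μ ω s x) Um Gm := by
    rcases hs.eq_or_lt with rfl | hs
    · exact halfForm_two_ge_of_eq_zero hμ hω le_rfl h (by simpa using h0)
    · exact halfForm_two_ge_of_pos hμ hω hs h
  rw [h0, map_zero, mul_zero, neg_zero] at key
  exact key

/-- After adding the two bounds, the coefficient of `|Um 0|²` is `√ω` times the determinant of
`det_neg` divided by `Sm Sp`: a quotient of two negative numbers. -/
lemma ShiftRelations.form_two_nonneg_of_bounds (r : ShiftRelations μ τ v ω sm sp)
    (hneg : tanhShift μ ω sm 0 * tanhShift μ ω sp 0 < 0) (jump : Up 0 = τ * Um 0) {A B : ℝ}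
    (h1 : -(logDerivSolitonDeriv μ ω sm 0 * Complex.normSq (Um 0)) ≤ A)
    (h2 : -(logDerivSolitonDeriv μ ω sp 0 * Complex.normSq (Up 0)) ≤ B) :
    0 ≤ B + A - v * Complex.normSq (Um 0) := by
  have nm : tanhShift μ ω sm 0 ≠ 0 := fun h => by rw [h, zero_mul] at hneg; exact lt_irrefl _ hneg
  have np : tanhShift μ ω sp 0 ≠ 0 := fun h => by rw [h, mul_zero] at hneg; exact lt_irrefl _ hneg
  rw [normSq_jump jump] at h2
  rw [← neg_mul, logDerivSolitonDeriv_zero nm] at h1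
  rw [← neg_mul, logDerivSolitonDeriv_zero np] at h2
  have hd := (div_pos_of_neg_of_neg r.det_neg hneg).le
  have hN := mul_nonneg (mul_nonneg (Real.sqrt_nonneg ω) hd) (Complex.normSq_nonneg (Um 0))
  have e : √ω * ((((μ + 1) * tanhShift μ ω sm 0 ^ 2 - μ) * tanhShift μ ω sp 0 +
      τ ^ 2 * ((μ + 1) * tanhShift μ ω sp 0 ^ 2 - μ) * tanhShift μ ω sm 0 -
      (τ ^ 2 * tanhShift μ ω sp 0 + tanhShift μ ω sm 0) *
        (tanhShift μ ω sm 0 * tanhShift μ ω sp 0)) /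
      (tanhShift μ ω sm 0 * tanhShift μ ω sp 0)) * Complex.normSq (Um 0) =
      √ω * (((μ + 1) * tanhShift μ ω sm 0 ^ 2 - μ) / tanhShift μ ω sm 0) *
        Complex.normSq (Um 0) +
      √ω * (((μ + 1) * tanhShift μ ω sp 0 ^ 2 - μ) / tanhShift μ ω sp 0) *
        (τ ^ 2 * Complex.normSq (Um 0)) - v * Complex.normSq (Um 0) := by
    rw [← r.deriv_eq]
    field_simp
  linarith

/-- Evaluation of the left branch. -/
def evalLeft (y : ℝ) : (ℝ → ℂ) × (ℝ → ℂ) →ₗ[ℂ] ℂ :=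
  (LinearMap.proj y).comp (LinearMap.fst ℂ (ℝ → ℂ) (ℝ → ℂ))

/-- Evaluation of the right branch. -/
def evalRight (y : ℝ) : (ℝ → ℂ) × (ℝ → ℂ) →ₗ[ℂ] ℂ :=
  (LinearMap.proj y).comp (LinearMap.snd ℂ (ℝ → ℂ) (ℝ → ℂ))

/-- The form of `L₁` is nonnegative on the kernel of a linear functional. -/
lemma ShiftRelations.exists_functional (r : ShiftRelations μ τ v ω sm sp) :
    ∃ ℓ : (ℝ → ℂ) × (ℝ → ℂ) →ₗ[ℂ] ℂ, ∀ Um Gm Hm Up Gp Hp : ℝ → ℂ,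
      HalfLineH2 Um Gm Hm → HalfLineH2 Up Gp Hp → Up 0 = τ * Um 0 → ℓ (Um, Up) = 0 →
      0 ≤ halfForm (fun x => ω - (2 * μ + 1) * well μ ω sp x) Up Gp +
        halfForm (fun x => ω - (2 * μ + 1) * well μ ω sm x) Um Gm -
        v * Complex.normSq (Um 0) := by
  have hμ := r.hμ
  have hω := r.hω
  have hsum : 0 < τ ^ 2 * tanhShift μ ω sp 0 + tanhShift μ ω sm 0 := by
    have h1 : 0 < √ω * (τ ^ 2 * tanhShift μ ω sp 0 + tanhShift μ ω sm 0) := by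
      rw [r.deriv_eq]; exact r.hv
    exact pos_of_mul_pos_right h1 (Real.sqrt_nonneg ω)
  have ht : 0 < τ ^ 2 := by have := r.hτ; positivity
  -- Since `τ²Sp + Sm > 0`, at most one shift is negative. If one is, the functional evaluates that
  -- branch at the zero of `φ_ω'`; otherwise it is the value at the origin.
  rcases lt_or_ge sm 0 with hm | hm
  · have sm_neg := tanhShift_zero_neg hμ hω hm
    have sp_pos : 0 < tanhShift μ ω sp 0 :=
      pos_of_mul_pos_right (by linarith : 0 < τ ^ 2 * tanhShift μ ω sp 0) ht.le
    refine ⟨evalLeft (-sm), fun Um Gm Hm Up Gp Hp h1 h2 jump h0 => ?_⟩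
    exact r.form_two_nonneg_of_bounds (mul_neg_of_neg_of_pos sm_neg sp_pos) jump
      (halfForm_two_ge_of_eq_zero hμ hω hm.le h1 h0)
      (halfForm_two_ge_of_pos hμ hω (pos_of_tanhShift_pos hμ hω sp_pos) h2)
  · rcases lt_or_ge sp 0 with hp | hp
    · have sp_neg := tanhShift_zero_neg hμ hω hp
      have sm_pos : 0 < tanhShift μ ω sm 0 := by
        have := mul_neg_of_pos_of_neg ht sp_neg
        linarith
      refine ⟨evalRight (-sp), fun Um Gm Hm Up Gp Hp h1 h2 jump h0 => ?_⟩
      exact r.form_two_nonneg_of_bounds (mul_neg_of_pos_of_neg sm_pos sp_neg) jump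
        (halfForm_two_ge_of_pos hμ hω (pos_of_tanhShift_pos hμ hω sm_pos) h1)
        (halfForm_two_ge_of_eq_zero hμ hω hp.le h2 h0)
    · refine ⟨evalLeft 0, fun Um Gm Hm Up Gp Hp h1 h2 jump h0 => ?_⟩
      have h0' : Um 0 = 0 := h0
      have h0p : Up 0 = 0 := by rw [jump, h0', mul_zero]
      have a1 := halfForm_two_nonneg_of_dirichlet hμ hω hm h1 h0'
      have a2 := halfForm_two_nonneg_of_dirichlet hμ hω hp h2 h0p
      rw [h0', map_zero, mul_zero, sub_zero]
      exact add_nonneg a2 a1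

end Concrete

/-! ### Solutions given by the soliton -/

section SolitonSolutions

variable {μ ω : ℝ}

lemma memLp_mul_soliton (hμ : 0 < μ) (hω : 0 < ω) (s : ℝ) {b : ℝ → ℝ} (hb : Continuous b) {C : ℝ}
    (hC : ∀ x, |b x| ≤ C) :
    MemLp (fun x => ((b x * soliton μ ω (x + s) : ℝ) : ℂ)) 2 (volume.restrict (Set.Ioi 0)) := by
  have h : MemLp (fun x => soliton μ ω (x + s)) 2 volume :=
    (memLp_soliton hμ hω).comp_measurePreserving (measurePreserving_add_right volume s)
  have c : Continuous fun x => b x * soliton μ ω (x + s) :=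
    hb.mul ((continuous_soliton μ ω).comp (continuous_id.add continuous_const))
  refine MemLp.restrict _ (MemLp.ofReal (h.of_le_mul (c := C) c.aestronglyMeasurable
    (ae_of_all _ fun x => ?_)))
  exact (norm_mul (b x) (soliton μ ω (x + s))).trans_le
    (mul_le_mul_of_nonneg_right (hC x) (norm_nonneg _))

lemma solitonDeriv_hasDerivAt (hμ : 0 < μ) (hω : 0 < ω) (s x : ℝ) :
    HasDerivAt (fun x => -√ω * tanhShift μ ω s x * soliton μ ω (x + s))
      (ω * ((μ + 1) * tanhShift μ ω s x ^ 2 - μ) * soliton μ ω (x + s)) x := by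
  have hs : √ω ^ 2 = ω := Real.sq_sqrt hω.le
  convert! ((tanhShift_hasDerivAt μ ω s x).const_mul (-√ω)).mul (soliton_hasDerivAt hμ s x) using 1
  linear_combination (-(μ + 1) * tanhShift μ ω s x ^ 2 + μ) * soliton μ ω (x + s) * hs

lemma solitonSecond_hasDerivAt (hμ : 0 < μ) (s x : ℝ) :
    HasDerivAt (fun x => ω * ((μ + 1) * tanhShift μ ω s x ^ 2 - μ) * soliton μ ω (x + s))
      ((ω - (2 * μ + 1) * well μ ω s x) *
        (-√ω * tanhShift μ ω s x * soliton μ ω (x + s))) x := by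
  convert! (((((tanhShift_hasDerivAt μ ω s x).pow 2).const_mul (μ + 1)).sub_const μ).const_mul
    ω).mul (soliton_hasDerivAt hμ s x) using 1
  rw [well, Pi.pow_apply]
  push_cast
  ring

lemma abs_neg_sqrt_mul_tanhShift_le (μ ω s x : ℝ) : |-√ω * tanhShift μ ω s x| ≤ √ω := by
  rw [abs_mul, abs_neg, abs_of_nonneg (Real.sqrt_nonneg ω)]
  exact mul_le_of_le_one_right (Real.sqrt_nonneg ω) (abs_tanhShift_lt μ ω s x).le

lemma abs_second_le (hμ : 0 < μ) (hω : 0 < ω) (s x : ℝ) :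
    |ω * ((μ + 1) * tanhShift μ ω s x ^ 2 - μ)| ≤ ω * ((μ + 1) * 1 + μ) := by
  rw [abs_mul, abs_of_pos hω]
  refine mul_le_mul_of_nonneg_left ((abs_sub _ _).trans ?_) hω.le
  rw [abs_mul, abs_of_pos hμ, abs_of_pos (by linarith : 0 < μ + 1), abs_of_nonneg (sq_nonneg _)]
  have := (tanhShift_sq_lt μ ω s x).le
  gcongr

/-- `φ_ω'(x + s)` solves the equation `L₁ a = 0`. -/
lemma solitonDeriv_sol (hμ : 0 < μ) (hω : 0 < ω) (s : ℝ) :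
    HalfLineSol (fun x => ω - (2 * μ + 1) * well μ ω s x - 0)
      (fun x => ((-√ω * tanhShift μ ω s x * soliton μ ω (x + s) : ℝ) : ℂ))
      (fun x => ((ω * ((μ + 1) * tanhShift μ ω s x ^ 2 - μ) * soliton μ ω (x + s) : ℝ) : ℂ)) where
  continuousOn_fun := fun x _ =>
    (solitonDeriv_hasDerivAt hμ hω s x).ofReal_comp.continuousAt.continuousWithinAt
  continuousOn_deriv := fun x _ =>
    (solitonSecond_hasDerivAt (ω := ω) hμ s x).ofReal_comp.continuousAt.continuousWithinAt
  hasDeriv_fun x _ := (solitonDeriv_hasDerivAt hμ hω s x).ofReal_comp.hasDerivWithinAt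
  hasDeriv_deriv x _ := by
    have := (solitonSecond_hasDerivAt (ω := ω) hμ s x).ofReal_comp.hasDerivWithinAt (s := Set.Ici x)
    rw [Complex.ofReal_mul] at this
    rw [sub_zero]
    exact this
  memLp_fun := memLp_mul_soliton hμ hω s (continuous_const.mul (continuous_tanhShift μ ω s))
    (abs_neg_sqrt_mul_tanhShift_le μ ω s)
  memLp_deriv := memLp_mul_soliton hμ hω s (continuous_const.mul ((continuous_const.mul
    ((continuous_tanhShift μ ω s).pow 2)).sub continuous_const)) (abs_second_le hμ hω s)

/-- The boundary values of a solution of `L₁ a = 0` on the half-line. -/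
lemma HalfLineSol.boundary_relation (hμ : 0 < μ) (hω : 0 < ω) {s : ℝ} {U G : ℝ → ℂ}
    (h : HalfLineSol (fun x => ω - (2 * μ + 1) * well μ ω s x - 0) U G) :
    U 0 * (√ω * ((μ + 1) * tanhShift μ ω s 0 ^ 2 - μ) : ℝ) + G 0 * tanhShift μ ω s 0 = 0 := by
  -- The Wronskian with `φ_ω'(x + s)`, from which the common factor `√ω φ_ω(s)` is then divided out.
  have hw := h.wronskian_eq_zero (solitonDeriv_sol hμ hω s)
  have hφ : ((√ω * soliton μ ω (0 + s) : ℝ) : ℂ) ≠ 0 := by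
    rw [Ne, Complex.ofReal_eq_zero]
    exact (mul_pos (Real.sqrt_pos.2 hω) (soliton_pos hμ hω _)).ne'
  refine (mul_eq_zero.1 (?_ : ((√ω * soliton μ ω (0 + s) : ℝ) : ℂ) * _ = 0)).resolve_left hφ
  rw [← hw]
  have hs : ((√ω : ℝ) : ℂ) ^ 2 = ω := by
    rw [← Complex.ofReal_pow, Real.sq_sqrt hω.le]
  push_cast
  linear_combination U 0 * ((μ + 1) * (tanhShift μ ω s 0 : ℂ) ^ 2 - μ) *
    (soliton μ ω (0 + s) : ℂ) * hs

end SolitonSolutions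

/-! ### The kernels -/

section Kernels

variable {μ τ v ω : ℝ}

/-- On each half-line the data at `0` are those of a multiple of `φ_ω'`; the conditions at the
origin then form a linear system whose determinant is nonzero by `det_neg`. -/
lemma kernel_linearized₁ {hμ : 0 < μ}
    (r : ShiftRelations μ τ v ω (-xMinus μ τ v ω) (xPlus μ τ v ω)) :
    kernel (linearized₁ hμ τ v ω) = ⊥ := by
  have hω := r.hω
  rw [eq_bot_iff]
  intro w hw
  obtain ⟨u, hu, rfl⟩ := mem_kernel_iff.1 hw
  rw [Submodule.mem_bot]
  have hu' : schrodinger τ v ω (2 * μ + 1) (potential μ τ v ω) (memLp_potential hμ τ v ω) u =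
      ((0 : ℝ) : ℂ) • (u : L2) := by
    rw [Complex.ofReal_zero, zero_smul]; exact hu
  obtain ⟨Um, Gm, Up, Gp, b⟩ := exists_branches_hamiltonian u
  obtain ⟨hm, hp⟩ := eigenfunction_sol (potential_right hμ hω r.hτ) (potential_left hμ hω)
    (continuous_well _ _ _) (continuous_well _ _ _) hu' b
  have rm := hm.boundary_relation hμ hω
  have rp := hp.boundary_relation hμ hω
  have j1 := b.jump
  have j2 := b.jump_deriv
  have hd := r.det_neg
  have hv : ((√ω * (τ ^ 2 * tanhShift μ ω (xPlus μ τ v ω) 0 +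
    tanhShift μ ω (-xMinus μ τ v ω) 0) : ℝ) : ℂ) = v := by rw [r.deriv_eq]
  set Sm := tanhShift μ ω (-xMinus μ τ v ω) 0
  set Sp := tanhShift μ ω (xPlus μ τ v ω) 0
  have hsq : √ω ≠ 0 := (Real.sqrt_pos.2 hω).ne'
  push_cast at rm rp hv
  have hU : Um 0 = 0 := by
    have hne : ((√ω * (((μ + 1) * Sm ^ 2 - μ) * Sp + τ ^ 2 * ((μ + 1) * Sp ^ 2 - μ) * Sm -
        (τ ^ 2 * Sp + Sm) * (Sm * Sp)) : ℝ) : ℂ) ≠ 0 := by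
      rw [Ne, Complex.ofReal_eq_zero]
      exact mul_ne_zero hsq hd.ne
    refine (mul_eq_zero.1 (?_ : Um 0 * _ = 0)).resolve_right hne
    rw [j1] at rp
    push_cast
    linear_combination (Sp : ℂ) * rm + τ * Sm * rp - (Sm * Sp : ℂ) * j2 - Um 0 * Sm * Sp * hv
  have hG : Gm 0 = 0 := by
    rw [hU, zero_mul, zero_add] at rm
    rw [j1, hU, mul_zero, zero_mul, zero_add] at rp
    -- Either `Sm` or `Sp` is nonzero, because `√ω(τ²Sp + Sm) = v > 0`; the nonzero one kills the
    -- derivative on its side, and the jump condition transfers this to the left.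
    rcases mul_eq_zero.1 rm with h | h
    · exact h
    · rcases mul_eq_zero.1 rp with h' | h'
      · rw [hU, h', mul_zero, mul_zero, neg_zero, add_zero] at j2
        exact j2
      · rw [Complex.ofReal_eq_zero] at h h'
        have := r.deriv_eq
        change √ω * (τ ^ 2 * Sp + Sm) = v at this
        rw [h, h', mul_zero, add_zero, mul_zero] at this
        exact absurd this r.hv.ne
  have bd : ∀ s x, |ω - (2 * μ + 1) * well μ ω s x - 0| ≤ ω + |2 * μ + 1| * (ω * (μ + 1)) := by
    intro s x
    rw [sub_zero]
    exact abs_sub_mul_well_le hμ hω _ _ _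
  exact eq_zero_of_sol r.hτ b hm hp (bd _) (bd _) hU hG

lemma linearized₂_nonneg {hμ : 0 < μ}
    (r : ShiftRelations μ τ v ω (-xMinus μ τ v ω) (xPlus μ τ v ω))
    (u : (linearized₂ hμ τ v ω).domain) :
    0 ≤ (inner ℂ (u : L2) (linearized₂ hμ τ v ω u)).re ∧
      (inner ℂ (u : L2) (linearized₂ hμ τ v ω u)).im = 0 := by
  have hω := r.hω
  obtain ⟨Um, Gm, Up, Gp, b⟩ := exists_branches_hamiltonian u
  have h := inner_self_schrodinger (c := 1) (hV := memLp_potential hμ τ v ω)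
    (potential_right hμ hω r.hτ) (potential_left hμ hω)
    (continuous_well _ _ _) (continuous_well _ _ _) (abs_sub_mul_well_le hμ hω 1 _)
    (abs_sub_mul_well_le hμ hω 1 _) b
  have h' : inner ℂ (u : L2) (linearized₂ hμ τ v ω u) = _ := h
  rw [h', Complex.ofReal_re, Complex.ofReal_im]
  exact ⟨r.form_one_nonneg b.left b.right b.jump, rfl⟩

lemma soliton_second_hasDerivAt (hμ : 0 < μ) (hω : 0 < ω) (s x : ℝ) :
    HasDerivAt (fun x => -√ω * tanhShift μ ω s x * soliton μ ω (x + s))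
      ((ω - 1 * well μ ω s x) * soliton μ ω (x + s)) x := by
  convert! solitonDeriv_hasDerivAt hμ hω s x using 1
  rw [well]
  ring

/-- The stationary state is in the domain: `jump` gives the first condition at the origin, where
`sign τ * |τ| = τ` accounts for the sign on the right, and `deriv_eq` gives the second. On each side
it solves the soliton equation. -/
lemma exists_state_eigenfunction {hμ : 0 < μ} (hω0 : 0 < ω)
    (r : ShiftRelations μ τ v ω (-xMinus μ τ v ω) (xPlus μ τ v ω)) :
    ∃ u : (linearized₂ hμ τ v ω).domain, (u : L2) = stateL2 hμ hω0 τ v ∧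
      linearized₂ hμ τ v ω u = 0 := by
  set sm := -xMinus μ τ v ω with hsm
  set sp := xPlus μ τ v ω with hsp
  have dU : ∀ s x, HasDerivAt (fun x => ((soliton μ ω (x + s) : ℝ) : ℂ))
      ((-√ω * tanhShift μ ω s x * soliton μ ω (x + s) : ℝ) : ℂ) x := fun s x =>
    (soliton_hasDerivAt hμ s x).ofReal_comp
  have dG : ∀ s x, HasDerivAt (fun x => ((-√ω * tanhShift μ ω s x * soliton μ ω (x + s) : ℝ) : ℂ))
      (((ω - 1 * well μ ω s x) * soliton μ ω (x + s) : ℝ) : ℂ) x := fun s x =>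
    (soliton_second_hasDerivAt hμ hω0 s x).ofReal_comp
  have lU : ∀ s, MemLp (fun x => ((soliton μ ω (x + s) : ℝ) : ℂ)) 2
      (volume.restrict (Set.Ioi 0)) := fun s => by
    have := memLp_mul_soliton hμ hω0 s (b := fun _ => 1) continuous_const (C := 1) (by simp)
    simpa using this
  have lG : ∀ s, MemLp (fun x => ((-√ω * tanhShift μ ω s x * soliton μ ω (x + s) : ℝ) : ℂ)) 2
      (volume.restrict (Set.Ioi 0)) := fun s =>
    memLp_mul_soliton hμ hω0 s (continuous_const.mul (continuous_tanhShift μ ω s))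
      (abs_neg_sqrt_mul_tanhShift_le μ ω s)
  have lH : ∀ s, MemLp (fun x => (((ω - 1 * well μ ω s x) * soliton μ ω (x + s) : ℝ) : ℂ)) 2
      (volume.restrict (Set.Ioi 0)) := fun s =>
    memLp_mul_soliton hμ hω0 s
      (continuous_const.sub (continuous_const.mul (continuous_well μ ω s)))
      (abs_sub_mul_well_le hμ hω0 1 s)
  have hsign : Real.sign τ * |τ| = τ := by
    rcases lt_or_gt_of_ne r.hτ with h | h
    · rw [Real.sign_of_neg h, abs_of_neg h]; ring
    · rw [Real.sign_of_pos h, abs_of_pos h]; ring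
  have hsign2 : τ * Real.sign τ = |τ| := by
    rcases lt_or_gt_of_ne r.hτ with h | h
    · rw [Real.sign_of_neg h, abs_of_neg h]; ring
    · rw [Real.sign_of_pos h, abs_of_pos h]; ring
  have bc1 : Real.sign τ * soliton μ ω (0 + sp) = τ * soliton μ ω (0 + sm) := by
    rw [r.jump, ← mul_assoc, hsign]
  have bc2 : -√ω * tanhShift μ ω sm 0 * soliton μ ω (0 + sm) +
      τ * (Real.sign τ * (-√ω * tanhShift μ ω sp 0 * soliton μ ω (0 + sp))) =
      -(v * soliton μ ω (0 + sm)) := by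
    rw [r.jump, ← r.deriv_eq]
    linear_combination (-√ω * tanhShift μ ω sp 0 * |τ| * soliton μ ω (0 + sm)) * hsign2 -
      (√ω * tanhShift μ ω sp 0 * soliton μ ω (0 + sm)) * sq_abs τ
  obtain ⟨u, hu, hz⟩ := exists_eigenfunction (τ := τ) (v := v) (ω := ω) (c := 1) (z := 0)
    (V := potential μ τ v ω) (hV := memLp_potential hμ τ v ω)
    (dU sm) (dG sm) (fun x => (dU sp x).const_mul ((Real.sign τ : ℝ) : ℂ))
    (fun x => (dG sp x).const_mul ((Real.sign τ : ℝ) : ℂ))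
    (lU sm) (lG sm) (lH sm) ((lU sp).const_mul _) ((lG sp).const_mul _) ((lH sp).const_mul _)
    (by exact_mod_cast bc1) (by exact_mod_cast bc2)
    (fun x hx => by rw [potential_left hμ hω0 x hx]; push_cast; ring)
    (fun x hx => by rw [potential_right hμ hω0 r.hτ x hx]; push_cast; ring)
  refine ⟨u, Lp.ext ?_, by rw [zero_smul] at hz; exact hz⟩
  have hst : (stateL2 hμ hω0 τ v : ℝ → ℂ) =ᵐ[volume] fun x => ((state μ τ v ω x : ℝ) : ℂ) :=
    (memLp_state hμ hω0 τ v).coeFn_toLp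
  filter_upwards [hu, hst] with x h1 h2
  rw [h1, h2, state, glue]
  split_ifs with h
  · congr 1
    rw [← soliton_neg]
    congr 1
    rw [hsm]
    ring
  · push_cast
    rfl

lemma stateL2_ne_zero {hμ : 0 < μ} (hω0 : 0 < ω) : stateL2 hμ hω0 τ v ≠ 0 := by
  intro h
  have h1 : (stateL2 hμ hω0 τ v : ℝ → ℂ) =ᵐ[volume] fun x => ((state μ τ v ω x : ℝ) : ℂ) :=
    (memLp_state hμ hω0 τ v).coeFn_toLp
  have h2 := (Lp.eq_zero_iff_ae_eq_zero (f := stateL2 hμ hω0 τ v)).1 h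
  have h3 : ∀ᵐ x : ℝ, x ∉ Set.Iio (0 : ℝ) := by
    filter_upwards [h1, h2] with x a b hx
    rw [a, Pi.zero_apply, Complex.ofReal_eq_zero, state, if_pos (Set.mem_Iio.1 hx)] at b
    exact (soliton_pos hμ hω0 _).ne' b
  have h4 := measure_eq_zero_iff_ae_notMem.2 h3
  rw [Real.volume_Iio] at h4
  exact ENNReal.top_ne_zero h4

lemma kernel_linearized₂ {hμ : 0 < μ} (hω0 : 0 < ω)
    (r : ShiftRelations μ τ v ω (-xMinus μ τ v ω) (xPlus μ τ v ω)) :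
    kernel (linearized₂ hμ τ v ω) = Submodule.span ℂ {stateL2 hμ hω0 τ v} := by
  obtain ⟨u₀, hu₀, hL₀⟩ := exists_state_eigenfunction (hμ := hμ) hω0 r
  ext w
  rw [mem_kernel_iff, Submodule.mem_span_singleton]
  constructor
  · rintro ⟨u, hu, rfl⟩
    have := exists_smul_of_eigenfunction (c := 1) (z := 0) (hV := memLp_potential hμ τ v ω) r.hτ
      (potential_right hμ hω0 r.hτ) (potential_left hμ hω0)
      (continuous_well _ _ _) (continuous_well _ _ _) (abs_well_le hμ hω0 _)
      (abs_well_le hμ hω0 _) (u₁ := u₀) (u₂ := u)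
      (by rw [Complex.ofReal_zero, zero_smul]; exact hL₀)
      (by rw [Complex.ofReal_zero, zero_smul]; exact hu)
      (by rw [hu₀]; exact stateL2_ne_zero hω0)
    rw [hu₀] at this
    exact this
  · rintro ⟨k, rfl⟩
    refine ⟨k • u₀, ?_, ?_⟩
    · rw [LinearPMap.map_smul, hL₀, smul_zero]
    · rw [← hu₀]; rfl

end Kernels

/-! ### Tail integrals -/

lemma integral_Ioi_eq_sub {f : ℝ → ℝ} (hf : Continuous f) (hi : ∀ a, IntegrableOn f (Set.Ioi a))
    (a x : ℝ) : ∫ y in Set.Ioi x, f y = (∫ y in Set.Ioi a, f y) - ∫ y in a..x, f y := by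
  rw [← intervalIntegral.integral_interval_add_Ioi' (hf.intervalIntegrable a x) (hi x)]
  ring

lemma hasDerivAt_integral_Ioi {f : ℝ → ℝ} (hf : Continuous f)
    (hi : ∀ a, IntegrableOn f (Set.Ioi a)) (x : ℝ) :
    HasDerivAt (fun x => ∫ y in Set.Ioi x, f y) (-f x) x := by
  have e : (fun x => ∫ y in Set.Ioi x, f y) =
      fun x => (∫ y in Set.Ioi 0, f y) - ∫ y in (0 : ℝ)..x, f y :=
    funext fun x => integral_Ioi_eq_sub hf hi 0 x
  rw [e]
  exact (intervalIntegral.integral_hasDerivAt_right (hf.intervalIntegrable _ _)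
    (hf.stronglyMeasurableAtFilter _ _) hf.continuousAt).const_sub _

lemma tendsto_integral_Ioi {f : ℝ → ℝ} (hf : Continuous f)
    (hi : ∀ a, IntegrableOn f (Set.Ioi a)) :
    Tendsto (fun x => ∫ y in Set.Ioi x, f y) atTop (𝓝 0) := by
  have e : (fun x => ∫ y in Set.Ioi x, f y) =
      fun x => (∫ y in Set.Ioi 0, f y) - ∫ y in (0 : ℝ)..x, f y :=
    funext fun x => integral_Ioi_eq_sub hf hi 0 x
  rw [e]
  have := (intervalIntegral_tendsto_integral_Ioi 0 (hi 0) tendsto_id).const_sub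
    (∫ y in Set.Ioi 0, f y)
  rwa [sub_self] at this

/-! ### Decaying solutions -/

/-- The kernel `(1 - e^{-2 κ t}) / (2 κ)` for `t ≥ 0`, extended by zero, with `κ` replaced by
`max κ κ₀`. -/
noncomputable def volterraKernel (κ₀ κ t : ℝ) : ℝ :=
  (1 - Real.exp (-(2 * max κ κ₀ * max t 0))) / (2 * max κ κ₀)

section Volterra

variable {κ₀ : ℝ}

lemma continuous_volterraKernel (h₀ : 0 < κ₀) :
    Continuous fun p : ℝ × ℝ => volterraKernel κ₀ p.1 p.2 := by
  unfold volterraKernel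
  refine Continuous.div (by fun_prop) (by fun_prop) fun p => ?_
  have : 0 < max p.1 κ₀ := lt_max_of_lt_right h₀
  positivity

lemma volterraKernel_nonneg (h₀ : 0 < κ₀) (κ t : ℝ) : 0 ≤ volterraKernel κ₀ κ t := by
  have : 0 < max κ κ₀ := lt_max_of_lt_right h₀
  refine div_nonneg (sub_nonneg.2 (Real.exp_le_one_iff.2 ?_)) (by positivity)
  have : 0 ≤ max t 0 := le_max_right _ _
  rw [neg_nonpos]
  positivity

lemma volterraKernel_le (h₀ : 0 < κ₀) (κ t : ℝ) : volterraKernel κ₀ κ t ≤ 1 / (2 * max κ κ₀) := by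
  have : 0 < max κ κ₀ := lt_max_of_lt_right h₀
  unfold volterraKernel
  gcongr
  linarith [Real.exp_pos (-(2 * max κ κ₀ * max t 0))]

lemma volterraKernel_le' (h₀ : 0 < κ₀) (κ t : ℝ) : volterraKernel κ₀ κ t ≤ 1 / (2 * κ₀) := by
  refine (volterraKernel_le h₀ κ t).trans ?_
  have := le_max_right κ κ₀
  gcongr

lemma volterraKernel_of_nonpos {κ t : ℝ} (ht : t ≤ 0) : volterraKernel κ₀ κ t = 0 := by
  simp [volterraKernel, max_eq_right ht]

variable {W : ℝ → ℝ}

/-- The exponential weight turning the Volterra operator into a contraction. -/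
noncomputable def volterraWeight (κ₀ : ℝ) (W : ℝ → ℝ) (x : ℝ) : ℝ :=
  Real.exp (1 / κ₀ * ∫ y in Set.Ioi x, W y)

lemma volterraWeight_hasDerivAt (cW : Continuous W) (iW : Integrable W) (x : ℝ) :
    HasDerivAt (volterraWeight κ₀ W) (-(1 / κ₀ * (W x * volterraWeight κ₀ W x))) x := by
  convert! ((hasDerivAt_integral_Ioi cW (fun _ => iW.integrableOn) x).const_mul (1 / κ₀)).exp
    using 1
  rw [volterraWeight]
  ring

lemma continuous_volterraWeight (cW : Continuous W) (iW : Integrable W) :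
    Continuous (volterraWeight κ₀ W) :=
  continuous_iff_continuousAt.2 fun x => (volterraWeight_hasDerivAt cW iW x).continuousAt

lemma volterraWeight_pos (x : ℝ) : 0 < volterraWeight κ₀ W x := Real.exp_pos _

lemma one_le_volterraWeight (h₀ : 0 < κ₀) (W0 : ∀ x, 0 ≤ W x) (x : ℝ) :
    1 ≤ volterraWeight κ₀ W x :=
  Real.one_le_exp (mul_nonneg (by positivity) (integral_nonneg W0))

lemma volterraWeight_le (h₀ : 0 < κ₀) (W0 : ∀ x, 0 ≤ W x) (iW : Integrable W) (x : ℝ) :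
    volterraWeight κ₀ W x ≤ Real.exp (1 / κ₀ * ∫ y, W y) := by
  refine Real.exp_le_exp.2 (mul_le_mul_of_nonneg_left ?_ (by positivity))
  exact setIntegral_le_integral iW (ae_of_all _ W0)

lemma integrable_mul_volterraWeight (h₀ : 0 < κ₀) (cW : Continuous W) (W0 : ∀ x, 0 ≤ W x)
    (iW : Integrable W) : Integrable fun x => W x * volterraWeight κ₀ W x := by
  refine iW.mul_bdd (c := Real.exp (1 / κ₀ * ∫ y, W y))
    (continuous_volterraWeight cW iW).aestronglyMeasurable
    (ae_of_all _ fun x => ?_)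
  rw [Real.norm_of_nonneg (volterraWeight_pos x).le]
  exact volterraWeight_le h₀ W0 iW x

/-- The weight `E` satisfies `E' = -W E / κ₀` and tends to `1` at infinity, so `W E` has an explicit
primitive. With the kernel bound `1 / (2κ₀)` this produces the factor `1 / 2`. -/
lemma integral_mul_volterraWeight (h₀ : 0 < κ₀) (cW : Continuous W) (W0 : ∀ x, 0 ≤ W x)
    (iW : Integrable W) (x : ℝ) :
    ∫ y in Set.Ioi x, W y * volterraWeight κ₀ W y = κ₀ * (volterraWeight κ₀ W x - 1) := by
  have ht : Tendsto (volterraWeight κ₀ W) atTop (𝓝 1) := by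
    have h1 := (tendsto_integral_Ioi cW (fun _ => iW.integrableOn)).const_mul (1 / κ₀)
    rw [mul_zero] at h1
    have h2 := (Real.continuous_exp.tendsto 0).comp h1
    rw [Real.exp_zero] at h2
    exact h2
  have := integral_Ioi_of_hasDerivAt_of_tendsto' (a := x)
    (fun y _ => volterraWeight_hasDerivAt (κ₀ := κ₀) cW iW y)
    (((integrable_mul_volterraWeight h₀ cW W0 iW).const_mul (1 / κ₀)).neg.integrableOn) ht
  rw [integral_neg, integral_const_mul] at this
  field_simp at this
  linarith

/-- The Volterra operator. -/
noncomputable def volterra (κ₀ : ℝ) (W : ℝ → ℝ) (k : ℝ × ℝ → ℝ) (p : ℝ × ℝ) : ℝ :=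
  ∫ y, volterraKernel κ₀ p.1 (y - p.2) * (W y * k (p.1, y))

lemma abs_volterra_integrand_le (h₀ : 0 < κ₀) (W0 : ∀ x, 0 ≤ W x) {k : ℝ × ℝ → ℝ} {C : ℝ}
    (hk : ∀ p, |k p| ≤ C) (p : ℝ × ℝ) (y : ℝ) :
    |volterraKernel κ₀ p.1 (y - p.2) * (W y * k (p.1, y))| ≤ 1 / (2 * κ₀) * (W y * C) := by
  rw [abs_mul, abs_mul, abs_of_nonneg (volterraKernel_nonneg h₀ _ _), abs_of_nonneg (W0 y)]
  have := W0 y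
  have := hk (p.1, y)
  have := volterraKernel_le' h₀ p.1 (y - p.2)
  gcongr

lemma continuous_volterra (h₀ : 0 < κ₀) (cW : Continuous W) (W0 : ∀ x, 0 ≤ W x)
    (iW : Integrable W) {k : ℝ × ℝ → ℝ} (ck : Continuous k) {C : ℝ} (hk : ∀ p, |k p| ≤ C) :
    Continuous (volterra κ₀ W k) := by
  have cK := continuous_volterraKernel h₀
  refine continuous_of_dominated (bound := fun y => 1 / (2 * κ₀) * (W y * C)) (fun p => ?_)
    (fun p => ae_of_all _ fun y => abs_volterra_integrand_le h₀ W0 hk p y)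
    ((iW.mul_const C).const_mul _) (ae_of_all _ fun y => ?_)
  · refine Continuous.aestronglyMeasurable ?_
    exact (cK.comp (continuous_const.prodMk (continuous_id.sub continuous_const))).mul
      (cW.mul (ck.comp (continuous_const.prodMk continuous_id)))
  · exact (cK.comp (continuous_fst.prodMk (continuous_const.sub continuous_snd))).mul
      (continuous_const.mul (ck.comp (continuous_fst.prodMk continuous_const)))

lemma integrable_volterra_integrand (h₀ : 0 < κ₀) (cW : Continuous W) (W0 : ∀ x, 0 ≤ W x)
    (iW : Integrable W) {k : ℝ × ℝ → ℝ} (ck : Continuous k) {C : ℝ} (hk : ∀ p, |k p| ≤ C)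
    (p : ℝ × ℝ) : Integrable fun y => volterraKernel κ₀ p.1 (y - p.2) * (W y * k (p.1, y)) := by
  have cK := continuous_volterraKernel h₀
  refine ((iW.mul_const C).const_mul (1 / (2 * κ₀))).mono' (Continuous.aestronglyMeasurable ?_)
    (ae_of_all _ fun y => abs_volterra_integrand_le h₀ W0 hk p y)
  exact (cK.comp (continuous_const.prodMk (continuous_id.sub continuous_const))).mul
      (cW.mul (ck.comp (continuous_const.prodMk continuous_id)))

/-- The Volterra operator is bounded by `1 / 2` in the weighted norm. -/
lemma abs_volterra_le (h₀ : 0 < κ₀) (cW : Continuous W) (W0 : ∀ x, 0 ≤ W x)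
    (iW : Integrable W) {k : ℝ × ℝ → ℝ} {C : ℝ} (hC : 0 ≤ C)
    (hk : ∀ p : ℝ × ℝ, |k p| ≤ C * volterraWeight κ₀ W p.2) (p : ℝ × ℝ) :
    |volterra κ₀ W k p| ≤ 1 / 2 * C * volterraWeight κ₀ W p.2 := by
  have hi := integrable_mul_volterraWeight h₀ cW W0 iW
  have h1 : |volterra κ₀ W k p| ≤ ∫ y, (Set.Ioi p.2).indicator
      (fun y => 1 / (2 * κ₀) * C * (W y * volterraWeight κ₀ W y)) y := by
    change ‖∫ y, volterraKernel κ₀ p.1 (y - p.2) * (W y * k (p.1, y))‖ ≤ _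
    refine norm_integral_le_of_norm_le
      ((hi.const_mul (1 / (2 * κ₀) * C)).indicator measurableSet_Ioi) (ae_of_all _ fun y => ?_)
    by_cases hy : y ∈ Set.Ioi p.2
    · rw [Set.indicator_of_mem hy, Real.norm_eq_abs, abs_mul, abs_mul,
        abs_of_nonneg (volterraKernel_nonneg h₀ _ _), abs_of_nonneg (W0 y)]
      calc volterraKernel κ₀ p.1 (y - p.2) * (W y * |k (p.1, y)|)
          ≤ 1 / (2 * κ₀) * (W y * (C * volterraWeight κ₀ W y)) := by
            have := W0 y
            have := hk (p.1, y)
            have := volterraKernel_le' h₀ p.1 (y - p.2)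
            gcongr
        _ = _ := by ring
    · rw [Set.indicator_of_notMem hy, volterraKernel_of_nonpos (sub_nonpos.2 (not_lt.1 hy)),
        zero_mul, norm_zero]
  rw [integral_indicator measurableSet_Ioi, integral_const_mul,
    integral_mul_volterraWeight h₀ cW W0 iW] at h1
  refine h1.trans ?_
  have e : 1 / (2 * κ₀) * C * (κ₀ * (volterraWeight κ₀ W p.2 - 1)) =
      1 / 2 * C * volterraWeight κ₀ W p.2 - 1 / 2 * C := by
    field_simp
  rw [e]
  linarith

lemma volterra_sub (h₀ : 0 < κ₀) (cW : Continuous W) (W0 : ∀ x, 0 ≤ W x)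
    (iW : Integrable W) {k k' : ℝ × ℝ → ℝ} (ck : Continuous k) (ck' : Continuous k') {C C' : ℝ}
    (hk : ∀ p, |k p| ≤ C) (hk' : ∀ p, |k' p| ≤ C') (p : ℝ × ℝ) :
    volterra κ₀ W k p - volterra κ₀ W k' p = volterra κ₀ W (fun p => k p - k' p) p := by
  rw [volterra, volterra, volterra, ← integral_sub
    (integrable_volterra_integrand h₀ cW W0 iW ck hk p)
    (integrable_volterra_integrand h₀ cW W0 iW ck' hk' p)]
  congr 1
  ext y
  ring

/-- The integral equation `h = 1 - A h` has a bounded continuous solution. -/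
lemma exists_volterra_solution (h₀ : 0 < κ₀) (cW : Continuous W) (W0 : ∀ x, 0 ≤ W x)
    (iW : Integrable W) : ∃ h : ℝ × ℝ → ℝ, Continuous h ∧ (∃ B, ∀ p, |h p| ≤ B) ∧
      ∀ p, h p = 1 - volterra κ₀ W h p := by
  set E := volterraWeight κ₀ W with hE
  have cE : Continuous E := continuous_volterraWeight cW iW
  have E1 : ∀ x, 1 ≤ E x := one_le_volterraWeight h₀ W0
  have E0 : ∀ x, 0 < E x := volterraWeight_pos
  set M := Real.exp (1 / κ₀ * ∫ y, W y) with hM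
  have EM : ∀ x, E x ≤ M := volterraWeight_le h₀ W0 iW
  have cEk : ∀ k : BoundedContinuousFunction (ℝ × ℝ) ℝ, Continuous fun p : ℝ × ℝ => E p.2 * k p :=
    fun k => (cE.comp continuous_snd).mul k.continuous
  have bEk : ∀ k : BoundedContinuousFunction (ℝ × ℝ) ℝ, ∀ p : ℝ × ℝ, |E p.2 * k p| ≤ M * ‖k‖ := by
    intro k p
    rw [abs_mul, abs_of_pos (E0 _)]
    have h1 := EM p.2
    have h2 : |k p| ≤ ‖k‖ := k.norm_coe_le_norm p
    have := E0 p.2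
    gcongr
  have bEk' : ∀ k : BoundedContinuousFunction (ℝ × ℝ) ℝ, ∀ p : ℝ × ℝ,
      |E p.2 * k p| ≤ ‖k‖ * E p.2 := by
    intro k p
    rw [abs_mul, abs_of_pos (E0 _), mul_comm]
    have h2 : |k p| ≤ ‖k‖ := k.norm_coe_le_norm p
    have := E0 p.2
    gcongr
  -- The unknown is `k = h / E`, so that the weighted norm becomes the supremum norm. Functions of
  -- `(κ, x)` jointly are used so that the fixed point is continuous in `κ`.
  let F : BoundedContinuousFunction (ℝ × ℝ) ℝ → BoundedContinuousFunction (ℝ × ℝ) ℝ := fun k =>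
    BoundedContinuousFunction.ofNormedAddCommGroup
      (fun p => (E p.2)⁻¹ * (1 - volterra κ₀ W (fun p => E p.2 * k p) p))
      (((cE.comp continuous_snd).inv₀ fun p => (E0 p.2).ne').mul
        (continuous_const.sub (continuous_volterra h₀ cW W0 iW (cEk k) (bEk k))))
      (1 + 1 / 2 * ‖k‖) (fun p => by
        have h1 := abs_volterra_le h₀ cW W0 iW (norm_nonneg k) (bEk' k) p
        rw [Real.norm_eq_abs, abs_mul, abs_inv, abs_of_pos (E0 _), inv_mul_le_iff₀ (E0 _)]
        refine (abs_sub _ _).trans ?_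
        rw [abs_one, mul_add, mul_one]
        have := E1 p.2
        change _ ≤ 1 / 2 * ‖k‖ * E p.2 at h1
        linarith)
  have hF : ContractingWith (1 / 2) F := by
    refine ⟨by norm_num, LipschitzWith.of_dist_le_mul fun k k' => ?_⟩
    rw [BoundedContinuousFunction.dist_le (by positivity)]
    intro p
    have e : F k p - F k' p =
        -((E p.2)⁻¹ * volterra κ₀ W (fun p => E p.2 * (k - k') p) p) := by
      have := volterra_sub h₀ cW W0 iW (cEk k) (cEk k') (bEk k) (bEk k') p
      have e2 : (fun p : ℝ × ℝ => E p.2 * (k - k') p) =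
          fun p => E p.2 * k p - E p.2 * k' p := by
        ext p
        rw [BoundedContinuousFunction.coe_sub, Pi.sub_apply]
        ring
      rw [e2, ← this]
      change (E p.2)⁻¹ * (1 - _) - (E p.2)⁻¹ * (1 - _) = _
      ring
    rw [dist_eq_norm, dist_eq_norm, e, norm_neg, Real.norm_eq_abs, abs_mul, abs_inv,
      abs_of_pos (E0 _), inv_mul_le_iff₀ (E0 _)]
    refine (abs_volterra_le h₀ cW W0 iW (norm_nonneg (k - k')) (bEk' (k - k')) p).trans_eq ?_
    push_cast
    ring
  set k := hF.fixedPoint F with hk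
  have hfix : F k = k := hF.fixedPoint_isFixedPt
  refine ⟨fun p => E p.2 * k p, cEk k, ⟨_, bEk k⟩, fun p => ?_⟩
  have := congrArg (fun f : BoundedContinuousFunction (ℝ × ℝ) ℝ => f p) hfix
  have h2 : (E p.2)⁻¹ * (1 - volterra κ₀ W (fun p => E p.2 * k p) p) = k p := this
  have h3 := (E0 p.2).ne'
  rw [inv_mul_eq_iff_eq_mul₀ h3] at h2
  exact h2.symm

end Volterra

/-- Decaying solutions `e^{-κ x} h κ x` of `-ψ'' - W ψ = -κ² ψ` for an integrable potential
`W ≥ 0`, depending continuously on `κ`; `p κ` is the derivative of `h κ`. -/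
structure JostFamily (κ₀ : ℝ) (W : ℝ → ℝ) (h p : ℝ → ℝ → ℝ) (B : ℝ) : Prop where
  hasDeriv_fun : ∀ κ, κ₀ ≤ κ → ∀ x, HasDerivAt (h κ) (p κ x) x
  hasDeriv_deriv : ∀ κ, κ₀ ≤ κ → ∀ x, HasDerivAt (p κ) (2 * κ * p κ x - W x * h κ x) x
  abs_fun_le : ∀ κ x, |h κ x| ≤ B
  abs_deriv_le : ∀ κ, κ₀ ≤ κ → ∀ x, |p κ x| ≤ B
  abs_sub_one_le : ∀ κ, κ₀ ≤ κ → ∀ x, |h κ x - 1| ≤ B / κ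
  tendsto_one : ∀ κ, κ₀ ≤ κ → Tendsto (h κ) atTop (𝓝 1)
  continuous_fun : Continuous fun κ => h κ 0
  continuous_deriv : Continuous fun κ => p κ 0

/-- For `ψ = e^{-κx}h` the equation reads `h'' = 2κh' - Wh`. With `h → 1` at infinity it becomes the
Volterra equation, and the term `p(x) = ∫_x^∞ e^{-2κ(y-x)} W h dy` in it is the derivative of `h`.
The factor `1/κ` in the kernel gives the behaviour for large `κ`. -/
lemma exists_jostFamily {κ₀ : ℝ} {W : ℝ → ℝ} (h₀ : 0 < κ₀) (cW : Continuous W)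
    (W0 : ∀ x, 0 ≤ W x) (iW : Integrable W) : ∃ h p B, JostFamily κ₀ W h p B := by
  obtain ⟨h, ch, ⟨B, hB⟩, hfix⟩ := exists_volterra_solution h₀ cW W0 iW
  have B0 : 0 ≤ B := (abs_nonneg _).trans (hB 0)
  have I0 : 0 ≤ ∫ y, W y := integral_nonneg W0
  have chk : ∀ κ, Continuous fun y => h (κ, y) := fun κ =>
    ch.comp (continuous_const.prodMk continuous_id)
  -- Truncation at `κ₀` keeps the formulas meaningful and continuous for all real `κ`; it has no
  -- effect for `κ ≥ κ₀`.
  let m : ℝ → ℝ := fun κ => max κ κ₀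
  have m0 : ∀ κ, 0 < m κ := fun κ => lt_max_of_lt_right h₀
  have mκ : ∀ κ, κ₀ ≤ κ → m κ = κ := fun κ hκ => max_eq_left hκ
  let f : ℝ → ℝ → ℝ := fun κ y => W y * h (κ, y)
  let g : ℝ → ℝ → ℝ := fun κ y => Real.exp (-(2 * m κ * y)) * f κ y
  have cf : ∀ κ, Continuous (f κ) := fun κ => cW.mul (chk κ)
  have cg : ∀ κ, Continuous (g κ) := fun κ => Continuous.mul (by fun_prop) (cf κ)
  have bf : ∀ κ y, |f κ y| ≤ W y * B := fun κ y => by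
    rw [abs_mul, abs_of_nonneg (W0 y)]
    exact mul_le_mul_of_nonneg_left (hB _) (W0 y)
  have jf : ∀ κ, Integrable (f κ) := fun κ =>
    (iW.mul_const B).mono' (cf κ).aestronglyMeasurable (ae_of_all _ (bf κ))
  have bg : ∀ κ x y, x < y → |Real.exp (2 * m κ * x) * g κ y| ≤ W y * B := fun κ x y hy => by
    rw [← mul_assoc, ← Real.exp_add, abs_mul, abs_of_pos (Real.exp_pos _)]
    refine (mul_le_of_le_one_left (abs_nonneg _) ?_).trans (bf κ y)
    rw [Real.exp_le_one_iff]
    nlinarith [m0 κ]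
  have jg : ∀ κ x, IntegrableOn (fun y => Real.exp (2 * m κ * x) * g κ y) (Set.Ioi x) :=
    fun κ x => ((iW.mul_const B).integrableOn).mono'
      (continuous_const.mul (cg κ)).aestronglyMeasurable
      ((ae_restrict_iff' measurableSet_Ioi).2 (ae_of_all _ fun y hy => bg κ x y hy))
  have ig : ∀ κ x, IntegrableOn (g κ) (Set.Ioi x) := fun κ x => by
    refine ((jg κ x).const_mul (Real.exp (2 * m κ * x))⁻¹).congr (ae_of_all _ fun y => ?_)
    exact inv_mul_cancel_left₀ (Real.exp_pos _).ne' _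
  let p : ℝ → ℝ → ℝ := fun κ x => Real.exp (2 * m κ * x) * ∫ y in Set.Ioi x, g κ y
  have dp : ∀ κ x, HasDerivAt (p κ) (2 * m κ * p κ x - f κ x) x := fun κ x => by
    have h1 : HasDerivAt (fun x => Real.exp (2 * m κ * x)) (Real.exp (2 * m κ * x) * (2 * m κ)) x := by
      simpa using ((hasDerivAt_id x).const_mul (2 * m κ)).exp
    convert! h1.mul (hasDerivAt_integral_Ioi (cg κ) (ig κ) x) using 1
    have h2 : Real.exp (2 * m κ * x) * g κ x = f κ x := by
      simp only [g]
      rw [← mul_assoc, ← Real.exp_add]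
      simp
    rw [mul_neg, h2]
    simp only [p]
    ring
  have hp : ∀ κ x, |p κ x| ≤ B * ∫ y in Set.Ioi x, W y := fun κ x => by
    simp only [p]
    rw [← integral_const_mul, ← integral_const_mul]
    change ‖∫ y in Set.Ioi x, Real.exp (2 * m κ * x) * g κ y‖ ≤ _
    refine norm_integral_le_of_norm_le (iW.const_mul B).integrableOn
      ((ae_restrict_iff' measurableSet_Ioi).2 (ae_of_all _ fun y hy => ?_))
    rw [mul_comm B]
    exact bg κ x y hy
  have hp' : ∀ κ x, |p κ x| ≤ B * ∫ y, W y := fun κ x => (hp κ x).trans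
    (mul_le_mul_of_nonneg_left (setIntegral_le_integral iW (ae_of_all _ W0)) B0)
  have hh : ∀ κ x, h (κ, x) = 1 - 1 / (2 * m κ) * ((∫ y in Set.Ioi x, f κ y) - p κ x) :=
    fun κ x => by
    have e : volterra κ₀ W h (κ, x) =
        ∫ y in Set.Ioi x, 1 / (2 * m κ) * (f κ y - Real.exp (2 * m κ * x) * g κ y) := by
      rw [← integral_indicator measurableSet_Ioi, volterra]
      congr 1
      ext y
      by_cases hy : y ∈ Set.Ioi x
      · have hy' : max (y - x) 0 = y - x := max_eq_left (sub_nonneg.2 (le_of_lt hy))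
        have e1 : Real.exp (-(2 * m κ * (y - x))) =
            Real.exp (2 * m κ * x) * Real.exp (-(2 * m κ * y)) := by
          rw [← Real.exp_add]
          congr 1
          ring
        rw [Set.indicator_of_mem hy, volterraKernel, hy']
        simp only [g, f]
        rw [e1]
        ring
      · rw [Set.indicator_of_notMem hy, volterraKernel_of_nonpos (sub_nonpos.2 (not_lt.1 hy)),
          zero_mul]
    rw [hfix, e, integral_const_mul, integral_sub (jf κ).integrableOn (jg κ x),
      integral_const_mul]
  have dh : ∀ κ x, HasDerivAt (fun x => h (κ, x)) (p κ x) x := fun κ x => by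
    have e : (fun x => h (κ, x)) =
        fun x => 1 - 1 / (2 * m κ) * ((∫ y in Set.Ioi x, f κ y) - p κ x) := funext (hh κ)
    rw [e]
    convert! (((hasDerivAt_integral_Ioi (cf κ) (fun _ => (jf κ).integrableOn) x).sub
      (dp κ x)).const_mul (1 / (2 * m κ))).const_sub 1 using 1
    have := (m0 κ).ne'
    field_simp
    ring
  have hf' : ∀ κ x, |∫ y in Set.Ioi x, f κ y| ≤ B * ∫ y in Set.Ioi x, W y := fun κ x => by
    rw [← integral_const_mul]
    change ‖∫ y in Set.Ioi x, f κ y‖ ≤ _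
    refine norm_integral_le_of_norm_le (iW.const_mul B).integrableOn (ae_of_all _ fun y => ?_)
    rw [mul_comm B]
    exact bf κ y
  have key : ∀ κ x, |h (κ, x) - 1| ≤ 1 / m κ * (B * ∫ y in Set.Ioi x, W y) := fun κ x => by
    have e : h (κ, x) - 1 = -(1 / (2 * m κ) * ((∫ y in Set.Ioi x, f κ y) - p κ x)) := by
      rw [hh]; ring
    have := m0 κ
    rw [e, abs_neg, abs_mul, abs_of_pos (by positivity)]
    have h1 := (abs_sub (∫ y in Set.Ioi x, f κ y) (p κ x)).trans (add_le_add (hf' κ x) (hp κ x))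
    refine (mul_le_mul_of_nonneg_left h1 (by positivity)).trans_eq ?_
    field_simp
    ring
  have tW : Tendsto (fun x => ∫ y in Set.Ioi x, W y) atTop (𝓝 0) :=
    tendsto_integral_Ioi cW fun _ => iW.integrableOn
  refine ⟨fun κ x => h (κ, x), p, B + B * ∫ y, W y, ?_⟩
  have BI : 0 ≤ B * ∫ y, W y := mul_nonneg B0 I0
  refine ⟨fun κ _ x => dh κ x, fun κ hκ x => ?_, fun κ x => (hB _).trans (by linarith),
    fun κ _ x => (hp' κ x).trans (by linarith), fun κ hκ x => ?_, fun κ _ => ?_,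
    ch.comp (continuous_id.prodMk continuous_const), ?_⟩
  · have := dp κ x
    rwa [mκ κ hκ] at this
  · have h1 := key κ x
    rw [mκ κ hκ] at h1
    have : 0 < κ := h₀.trans_le hκ
    rw [div_eq_mul_one_div, mul_comm]
    refine h1.trans (mul_le_mul_of_nonneg_left ?_ (by positivity))
    have := mul_le_mul_of_nonneg_left
      (setIntegral_le_integral (s := Set.Ioi x) iW (ae_of_all _ W0)) B0
    linarith
  · rw [tendsto_iff_norm_sub_tendsto_zero]
    have := (tW.const_mul B).const_mul (1 / m κ)
    rw [mul_zero, mul_zero] at this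
    exact squeeze_zero (fun _ => norm_nonneg _) (fun x => key κ x) this
  · have e : (fun κ => p κ 0) = fun κ => ∫ y in Set.Ioi 0, g κ y := by
      ext κ
      simp [p]
    rw [e]
    refine continuous_of_dominated (bound := fun y => W y * B)
      (fun κ => (cg κ).aestronglyMeasurable)
      (fun κ => (ae_restrict_iff' measurableSet_Ioi).2 (ae_of_all _ fun y hy => ?_))
      (iW.mul_const B).integrableOn (ae_of_all _ fun y => ?_)
    · have := bg κ 0 y hy
      simpa using this
    · refine Continuous.mul (by fun_prop) (continuous_const.mul ?_)
      exact ch.comp (continuous_id.prodMk continuous_const)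

lemma memLp_exp_mul {κ : ℝ} (hκ : 0 < κ) {b : ℝ → ℝ} (hb : Continuous b) {C : ℝ}
    (hC : ∀ x, |b x| ≤ C) :
    MemLp (fun x => ((Real.exp (-(κ * x)) * b x : ℝ) : ℂ)) 2 (volume.restrict (Set.Ioi 0)) := by
  have ce : Continuous fun x : ℝ => Real.exp (-(κ * x)) := by fun_prop
  have h : MemLp (fun x : ℝ => Real.exp (-(κ * x))) 2 (volume.restrict (Set.Ioi 0)) := by
    rw [memLp_two_iff_integrable_sq ce.aestronglyMeasurable]
    refine (integrableOn_exp_mul_Ioi (a := -(2 * κ)) (by linarith) 0).congr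
      (ae_of_all _ fun x => ?_)
    simp only
    rw [← Real.exp_nat_mul]
    congr 1
    push_cast
    ring
  refine MemLp.ofReal (h.of_le_mul (c := C) (ce.mul hb).aestronglyMeasurable
    (ae_of_all _ fun x => ?_))
  exact (norm_mul (Real.exp (-(κ * x))) (b x)).trans_le ((mul_comm _ _).trans_le
    (mul_le_mul_of_nonneg_right (hC x) (norm_nonneg _)))

namespace JostFamily

variable {κ₀ B C κ : ℝ} {W : ℝ → ℝ} {h p : ℝ → ℝ → ℝ}

lemma psi_hasDerivAt (J : JostFamily κ₀ W h p B) (hκ : κ₀ ≤ κ) (x : ℝ) :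
    HasDerivAt (fun x => ((Real.exp (-(κ * x)) * h κ x : ℝ) : ℂ))
      ((Real.exp (-(κ * x)) * (p κ x - κ * h κ x) : ℝ) : ℂ) x := by
  have h1 : HasDerivAt (fun x => Real.exp (-(κ * x))) (Real.exp (-(κ * x)) * -(κ * 1)) x :=
    (((hasDerivAt_id x).const_mul κ).neg).exp
  convert! (h1.mul (J.hasDeriv_fun κ hκ x)).ofReal_comp using 2
  ring

lemma dpsi_hasDerivAt (J : JostFamily κ₀ W h p B) (hκ : κ₀ ≤ κ) (x : ℝ) :
    HasDerivAt (fun x => ((Real.exp (-(κ * x)) * (p κ x - κ * h κ x) : ℝ) : ℂ))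
      ((Real.exp (-(κ * x)) * ((κ ^ 2 - W x) * h κ x) : ℝ) : ℂ) x := by
  have h1 : HasDerivAt (fun x => Real.exp (-(κ * x))) (Real.exp (-(κ * x)) * -(κ * 1)) x :=
    (((hasDerivAt_id x).const_mul κ).neg).exp
  convert! (h1.mul ((J.hasDeriv_deriv κ hκ x).sub
    ((J.hasDeriv_fun κ hκ x).const_mul κ))).ofReal_comp using 2
  rw [Pi.sub_apply]
  ring

lemma continuous_fun_right (J : JostFamily κ₀ W h p B) (hκ : κ₀ ≤ κ) : Continuous (h κ) :=
  continuous_iff_continuousAt.2 fun x => (J.hasDeriv_fun κ hκ x).continuousAt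

lemma continuous_deriv_right (J : JostFamily κ₀ W h p B) (hκ : κ₀ ≤ κ) : Continuous (p κ) :=
  continuous_iff_continuousAt.2 fun x => (J.hasDeriv_deriv κ hκ x).continuousAt

lemma psi_memLp (J : JostFamily κ₀ W h p B) (h₀ : 0 < κ₀) (hκ : κ₀ ≤ κ) :
    MemLp (fun x => ((Real.exp (-(κ * x)) * h κ x : ℝ) : ℂ)) 2 (volume.restrict (Set.Ioi 0)) :=
  memLp_exp_mul (h₀.trans_le hκ) (J.continuous_fun_right hκ) (J.abs_fun_le κ)

lemma dpsi_memLp (J : JostFamily κ₀ W h p B) (h₀ : 0 < κ₀) (hκ : κ₀ ≤ κ) :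
    MemLp (fun x => ((Real.exp (-(κ * x)) * (p κ x - κ * h κ x) : ℝ) : ℂ)) 2
      (volume.restrict (Set.Ioi 0)) := by
  have hκ' := h₀.trans_le hκ
  refine memLp_exp_mul (C := B + κ * B) hκ' ((J.continuous_deriv_right hκ).sub
    ((J.continuous_fun_right hκ).const_mul κ)) fun x => ?_
  refine (abs_sub _ _).trans (add_le_add (J.abs_deriv_le κ hκ x) ?_)
  rw [abs_mul, abs_of_pos hκ']
  exact mul_le_mul_of_nonneg_left (J.abs_fun_le κ x) hκ'.le

lemma ddpsi_memLp (J : JostFamily κ₀ W h p B) (h₀ : 0 < κ₀) (hκ : κ₀ ≤ κ) (cW : Continuous W)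
    (hC : ∀ x, |W x| ≤ C) :
    MemLp (fun x => ((Real.exp (-(κ * x)) * ((κ ^ 2 - W x) * h κ x) : ℝ) : ℂ)) 2
      (volume.restrict (Set.Ioi 0)) := by
  refine memLp_exp_mul (C := (κ ^ 2 + C) * B) (h₀.trans_le hκ)
    ((continuous_const.sub cW).mul (J.continuous_fun_right hκ)) fun x => ?_
  rw [abs_mul]
  have h1 : |κ ^ 2 - W x| ≤ κ ^ 2 + C :=
    (abs_sub _ _).trans (add_le_add (abs_of_nonneg (sq_nonneg κ)).le (hC x))
  have := J.abs_fun_le κ x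
  have := (abs_nonneg _).trans h1
  gcongr

lemma sol (J : JostFamily κ₀ W h p B) (h₀ : 0 < κ₀) (hκ : κ₀ ≤ κ) :
    HalfLineSol (fun x => κ ^ 2 - W x) (fun x => ((Real.exp (-(κ * x)) * h κ x : ℝ) : ℂ))
      (fun x => ((Real.exp (-(κ * x)) * (p κ x - κ * h κ x) : ℝ) : ℂ)) where
  continuousOn_fun x _ := (J.psi_hasDerivAt hκ x).continuousAt.continuousWithinAt
  continuousOn_deriv x _ := (J.dpsi_hasDerivAt hκ x).continuousAt.continuousWithinAt
  hasDeriv_fun x _ := (J.psi_hasDerivAt hκ x).hasDerivWithinAt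
  hasDeriv_deriv x _ := by
    convert! (J.dpsi_hasDerivAt hκ x).hasDerivWithinAt using 1
    push_cast
    ring
  memLp_fun := J.psi_memLp h₀ hκ
  memLp_deriv := J.dpsi_memLp h₀ hκ

lemma eventually_pos (J : JostFamily κ₀ W h p B) (hκ : κ₀ ≤ κ) :
    ∀ᶠ x in atTop, 0 < Real.exp (-(κ * x)) * h κ x := by
  filter_upwards [(J.tendsto_one κ hκ).eventually_const_lt zero_lt_one] with x hx
  exact mul_pos (Real.exp_pos _) hx

lemma tendsto_fun_zero (J : JostFamily κ₀ W h p B) : Tendsto (fun κ => h κ 0) atTop (𝓝 1) := by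
  rw [tendsto_iff_norm_sub_tendsto_zero]
  refine squeeze_zero' (Eventually.of_forall fun _ => norm_nonneg _) ?_
    (tendsto_const_nhds.div_atTop tendsto_id : Tendsto (fun κ => B / κ) atTop (𝓝 0))
  filter_upwards [eventually_ge_atTop κ₀] with κ hκ using J.abs_sub_one_le κ hκ 0

lemma tendsto_deriv_div (J : JostFamily κ₀ W h p B) :
    Tendsto (fun κ => p κ 0 / κ) atTop (𝓝 0) := by
  rw [tendsto_zero_iff_norm_tendsto_zero]
  refine squeeze_zero' (Eventually.of_forall fun _ => norm_nonneg _) ?_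
    (tendsto_const_nhds.div_atTop tendsto_id : Tendsto (fun κ => B / κ) atTop (𝓝 0))
  filter_upwards [eventually_ge_atTop κ₀, eventually_gt_atTop 0] with κ hκ h0
  rw [Real.norm_eq_abs, abs_div, abs_of_pos h0]
  exact div_le_div_of_nonneg_right (J.abs_deriv_le κ hκ 0) h0.le

end JostFamily

/-! ### The Jost families of the linearized operator -/

lemma integrable_well {μ ω : ℝ} (hμ : 0 < μ) (hω : 0 < ω) (s : ℝ) : Integrable (well μ ω s) := by
  have hk : 0 < μ * √ω := by positivity
  have h1 : Integrable (fun x : ℝ => Real.exp (-(2 * (μ * √ω) * |x + s|))) :=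
    (integrable_exp_neg_abs (by positivity)).comp_add_right s
  refine (h1.const_mul (ω * (μ + 1) * 4)).mono' (continuous_well μ ω s).aestronglyMeasurable
    (ae_of_all _ fun x => ?_)
  rw [Real.norm_eq_abs, abs_of_nonneg (well_nonneg hμ hω s x), well, tanhShift, one_sub_tanh_sq,
    mul_assoc (ω * (μ + 1))]
  have hω' : 0 ≤ ω * (μ + 1) := by positivity
  refine mul_le_mul_of_nonneg_left ?_ hω'
  have hc : Real.exp (μ * √ω * |x + s|) / 2 ≤ Real.cosh (μ * √ω * (x + s)) := by
    rw [← Real.cosh_abs, abs_mul, abs_of_pos hk, Real.cosh_eq]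
    have := Real.exp_pos (-(μ * √ω * |x + s|))
    linarith
  have h2 : Real.exp (-(2 * (μ * √ω) * |x + s|)) = (Real.exp (μ * √ω * |x + s|) ^ 2)⁻¹ := by
    rw [← Real.exp_nat_mul, ← Real.exp_neg]
    congr 1
    push_cast
    ring
  rw [h2]
  refine (inv_anti₀ (by positivity) (pow_le_pow_left₀ (by positivity) hc 2)).trans_eq ?_
  rw [div_pow, inv_div, div_eq_mul_inv]
  norm_num

lemma exists_jostFamily_well {μ ω : ℝ} (hμ : 0 < μ) (hω : 0 < ω) (s : ℝ) :
    ∃ h p B, JostFamily √ω (fun x => (2 * μ + 1) * well μ ω s x) h p B :=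
  exists_jostFamily (Real.sqrt_pos.2 hω) ((continuous_well μ ω s).const_mul _)
    (fun x => mul_nonneg (by positivity) (well_nonneg hμ hω s x))
    ((integrable_well hμ hω s).const_mul _)

/-- At `κ = √ω` the decaying solution is a negative multiple of `φ_ω'(x + s)`. -/
lemma JostFamily.initial_data {μ ω s B : ℝ} (hμ : 0 < μ) (hω : 0 < ω) {h p : ℝ → ℝ → ℝ}
    (J : JostFamily √ω (fun x => (2 * μ + 1) * well μ ω s x) h p B) :
    ∃ C, 0 < C ∧ h √ω 0 = C * tanhShift μ ω s 0 ∧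
      p √ω 0 - √ω * h √ω 0 = -(C * (√ω * ((μ + 1) * tanhShift μ ω s 0 ^ 2 - μ))) := by
  have hk := Real.sqrt_pos.2 hω
  set T := tanhShift μ ω s 0 with hT
  set A := √ω * ((μ + 1) * T ^ 2 - μ) with hA
  have eq : (fun x => √ω ^ 2 - (2 * μ + 1) * well μ ω s x) =
      fun x => ω - (2 * μ + 1) * well μ ω s x - 0 := by
    ext x
    rw [Real.sq_sqrt hω.le, sub_zero]
  have hs := J.sol hk le_rfl
  rw [eq] at hs
  have hb := hs.boundary_relation hμ hω
  have e0 : Real.exp (-(√ω * 0)) = 1 := by simp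
  simp only [e0, one_mul] at hb
  have hb' : h √ω 0 * A + (p √ω 0 - √ω * h √ω 0) * T = 0 := by exact_mod_cast hb
  set g := p √ω 0 - √ω * h √ω 0 with hg
  -- The relation `hb'` makes `(h, g)` orthogonal to `(A, T)`, which is nonzero, so `(h, g)` is a
  -- multiple of `(T, -A)`; `C` below is the coefficient of this projection.
  have hD : 0 < T ^ 2 + A ^ 2 := by
    by_cases h0 : T = 0
    · have : A ≠ 0 := by
        rw [hA, h0]
        have : √ω * ((μ + 1) * 0 ^ 2 - μ) = -(√ω * μ) := by ring
        rw [this]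
        exact neg_ne_zero.2 (by positivity)
      positivity
    · positivity
  have hC1 : h √ω 0 = (h √ω 0 * T - g * A) / (T ^ 2 + A ^ 2) * T := by
    field_simp
    linear_combination A * hb'
  have hC2 : g = -((h √ω 0 * T - g * A) / (T ^ 2 + A ^ 2) * A) := by
    field_simp
    linear_combination T * hb'
  set C := (h √ω 0 * T - g * A) / (T ^ 2 + A ^ 2) with hC
  refine ⟨C, ?_, hC1, hC2⟩
  have hφ := soliton_pos hμ hω (0 + s)
  set k := C / (√ω * soliton μ ω (0 + s)) with hkdef
  have hcomb := hs.linearCombination (solitonDeriv_sol hμ hω s) 1 (k : ℂ)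
  have hbd : ∀ x, |ω - (2 * μ + 1) * well μ ω s x - 0| ≤ ω + |2 * μ + 1| * (ω * (μ + 1)) := by
    intro x
    rw [sub_zero]
    exact abs_sub_mul_well_le hμ hω _ s x
  have i1 : 1 * h √ω 0 + k * (-√ω * T * soliton μ ω (0 + s)) = 0 := by
    rw [hC1, hkdef]
    field_simp
    ring
  have i2 : 1 * g + k * (ω * ((μ + 1) * T ^ 2 - μ) * soliton μ ω (0 + s)) = 0 := by
    have hω2 : ω * ((μ + 1) * T ^ 2 - μ) = √ω * A := by
      rw [hA, ← mul_assoc, Real.mul_self_sqrt hω.le]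
    rw [hC2, hω2, hkdef]
    field_simp
    ring
  have hzero : ∀ x, 0 ≤ x → Real.exp (-(√ω * x)) * h √ω x =
      k * (√ω * tanhShift μ ω s x * soliton μ ω (x + s)) := by
    intro x hx
    have := (hcomb.eq_zero hbd
      (by simp only [e0, one_mul]; rw [one_mul] at i1; exact_mod_cast i1)
      (by simp only [e0, one_mul]; rw [one_mul] at i2; exact_mod_cast i2) hx).1
    have h2 : 1 * (Real.exp (-(√ω * x)) * h √ω x) +
        k * (-√ω * tanhShift μ ω s x * soliton μ ω (x + s)) = 0 := by exact_mod_cast this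
    linear_combination h2
  -- The sign of `C` is read off far out, where the decaying solution and `√ω T φ_ω` are both
  -- positive.
  obtain ⟨x, hx1, hx2, hx3⟩ := ((J.eventually_pos le_rfl).and
    ((eventually_ge_atTop 0).and (eventually_gt_atTop (-s)))).exists
  rw [hzero x hx2] at hx1
  have hk2 := pos_of_mul_pos_left hx1 (mul_pos (mul_pos hk
    (tanhShift_pos hμ hω (by linarith))) (soliton_pos hμ hω _)).le
  rw [hkdef] at hk2
  exact (div_pos_iff_of_pos_right (by positivity)).1 hk2

/-- The matching function of the decaying solutions has a zero. -/
lemma ShiftRelations.exists_matching {μ τ v ω sm sp Bm Bp : ℝ} (r : ShiftRelations μ τ v ω sm sp)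
    {hm pm hp pp : ℝ → ℝ → ℝ}
    (Jm : JostFamily √ω (fun x => (2 * μ + 1) * well μ ω sm x) hm pm Bm)
    (Jp : JostFamily √ω (fun x => (2 * μ + 1) * well μ ω sp x) hp pp Bp) :
    ∃ κ, √ω < κ ∧ (pm κ 0 - κ * hm κ 0) * hp κ 0 + τ ^ 2 * (pp κ 0 - κ * hp κ 0) * hm κ 0 +
      v * (hm κ 0 * hp κ 0) = 0 := by
  let F : ℝ → ℝ := fun κ => (pm κ 0 - κ * hm κ 0) * hp κ 0 +
    τ ^ 2 * (pp κ 0 - κ * hp κ 0) * hm κ 0 + v * (hm κ 0 * hp κ 0)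
  have c1 := Jm.continuous_fun
  have c2 := Jp.continuous_fun
  have c3 := Jm.continuous_deriv
  have c4 := Jp.continuous_deriv
  have cF : Continuous F := by fun_prop
  have hk := Real.sqrt_pos.2 r.hω
  -- At `κ = √ω` the data come from `φ_ω'`, and the matching function equals `-Cm Cp √ω` times the
  -- determinant of `det_neg`.
  have F0 : 0 < F √ω := by
    obtain ⟨Cm, Cm0, a1, a2⟩ := Jm.initial_data r.hμ r.hω
    obtain ⟨Cp, Cp0, b1, b2⟩ := Jp.initial_data r.hμ r.hω
    simp only [F]
    rw [a2, b2, a1, b1, ← r.deriv_eq]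
    have := mul_pos (mul_pos (mul_pos Cm0 Cp0) hk) (neg_pos.2 r.det_neg)
    linarith
  -- For large `κ` the potential is negligible: `h(κ, 0) → 1` and `p(κ, 0)/κ → 0`.
  have tF : Tendsto (fun κ => F κ / κ) atTop (𝓝 (-(1 + τ ^ 2))) := by
    have t1 := Jm.tendsto_fun_zero
    have t2 := Jp.tendsto_fun_zero
    have t3 := Jm.tendsto_deriv_div
    have t4 := Jp.tendsto_deriv_div
    have t5 : Tendsto (fun κ : ℝ => v / κ) atTop (𝓝 0) := tendsto_const_nhds.div_atTop tendsto_id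
    have := (((t3.sub t1).mul t2).add (((t4.sub t2).const_mul (τ ^ 2)).mul t1)).add
      (t5.mul (t1.mul t2))
    have e : (0 - 1) * 1 + τ ^ 2 * (0 - 1) * 1 + 0 * (1 * 1) = -(1 + τ ^ 2) := by ring
    rw [e] at this
    refine this.congr' ?_
    filter_upwards [eventually_gt_atTop 0] with κ hκ
    simp only [F]
    field_simp
  obtain ⟨K, hK1, hK2⟩ := ((tF.eventually_lt_const (neg_lt_zero.2
    (by positivity : 0 < 1 + τ ^ 2))).and (eventually_gt_atTop √ω)).exists
  have hFK : F K < 0 := by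
    by_contra h
    exact absurd hK1 (not_lt.2 (div_nonneg (not_lt.1 h) (hk.trans hK2).le))
  obtain ⟨κ, hκ, hFκ⟩ := intermediate_value_Icc' hK2.le cF.continuousOn ⟨hFK.le, F0.le⟩
  refine ⟨κ, lt_of_le_of_ne hκ.1 ?_, hFκ⟩
  rintro rfl
  exact F0.ne' hFκ

/-- A vanishing determinant yields nontrivial coefficients `c`, `d` for the two branches. When `a =
b = 0`, the condition on values is void and only the one on derivatives has to be solved. -/
lemma exists_matching_coefficients {τ v a b a' b' : ℝ} (hτ : τ ≠ 0)
    (h : a' * b + τ ^ 2 * b' * a + v * (a * b) = 0) :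
    ∃ c d : ℝ, (c ≠ 0 ∨ d ≠ 0) ∧ d * b = τ * (c * a) ∧ c * a' + τ * (d * b') = -(v * (c * a)) := by
  by_cases hb : b = 0
  · by_cases ha : a = 0
    · subst ha hb
      by_cases hb' : b' = 0
      · exact ⟨0, 1, Or.inr one_ne_zero, by ring, by rw [hb']; ring⟩
      · exact ⟨τ * b', -a', Or.inl (mul_ne_zero hτ hb'), by ring, by ring⟩
    · exact ⟨b, τ * a, Or.inr (mul_ne_zero hτ ha), by ring, by linear_combination h⟩
  · exact ⟨b, τ * a, Or.inl hb, by ring, by linear_combination h⟩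

lemma glue_not_ae_eq_zero {L R : ℝ → ℂ}
    (h : (∀ᶠ x in atTop, L x ≠ 0) ∨ ∀ᶠ x in atTop, R x ≠ 0) : ¬ glue L R =ᵐ[volume] 0 := by
  intro h0
  rcases h with h | h
  · obtain ⟨a, ha⟩ := eventually_atTop.1 h
    have h3 : ∀ᵐ x : ℝ, x ∉ Set.Iio (min (-a) 0) := by
      filter_upwards [h0] with x hx hxa
      have hx' := lt_min_iff.1 (Set.mem_Iio.1 hxa)
      have e : glue L R x = L (-x) := if_pos hx'.2
      rw [e] at hx
      exact ha (-x) (by linarith) hx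
    have h4 := measure_eq_zero_iff_ae_notMem.2 h3
    rw [Real.volume_Iio] at h4
    exact ENNReal.top_ne_zero h4
  · obtain ⟨a, ha⟩ := eventually_atTop.1 h
    have h3 : ∀ᵐ x : ℝ, x ∉ Set.Ioi (max a 0) := by
      filter_upwards [h0] with x hx hxa
      have hx' := max_lt_iff.1 (Set.mem_Ioi.1 hxa)
      rw [glue_of_pos hx'.2] at hx
      exact ha x hx'.1.le hx
    have h4 := measure_eq_zero_iff_ae_notMem.2 h3
    rw [Real.volume_Ioi] at h4
    exact ENNReal.top_ne_zero h4

/-- At a zero `κ > √ω` of the matching function the decaying solutions glue to an eigenfunction with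
eigenvalue `ω - κ²`. It is not zero because a branch with nonzero coefficient does not vanish far
out. -/
lemma exists_negative_eigenvalue {μ τ v ω : ℝ} {hμ : 0 < μ}
    (r : ShiftRelations μ τ v ω (-xMinus μ τ v ω) (xPlus μ τ v ω)) :
    ∃ l : ℝ, l < 0 ∧ IsEigenvalue (linearized₁ hμ τ v ω) l := by
  have hω := r.hω
  have hk := Real.sqrt_pos.2 hω
  obtain ⟨hm, pm, Bm, Jm⟩ := exists_jostFamily_well hμ hω (-xMinus μ τ v ω)
  obtain ⟨hp, pp, Bp, Jp⟩ := exists_jostFamily_well hμ hω (xPlus μ τ v ω)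
  obtain ⟨κ, hκ, hF⟩ := r.exists_matching Jm Jp
  obtain ⟨c, d, hcd, e1, e2⟩ := exists_matching_coefficients r.hτ hF
  have hC : ∀ s x, |(2 * μ + 1) * well μ ω s x| ≤ (2 * μ + 1) * (ω * (μ + 1)) := fun s x => by
    rw [abs_mul, abs_of_pos (by linarith)]
    exact mul_le_mul_of_nonneg_left (abs_well_le hμ hω s x) (by linarith)
  have hc : ∀ s, Continuous fun x => (2 * μ + 1) * well μ ω s x := fun s =>
    (continuous_well μ ω s).const_mul _
  have e0 : Real.exp (-(κ * 0)) = 1 := by simp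
  have hκω : ω < κ ^ 2 := by
    rw [← Real.sqrt_lt' (hk.trans hκ)]
    exact hκ
  obtain ⟨u, hu, hL⟩ := exists_eigenfunction (τ := τ) (v := v) (ω := ω) (c := 2 * μ + 1)
    (V := potential μ τ v ω) (hV := memLp_potential hμ τ v ω) (z := ((ω - κ ^ 2 : ℝ) : ℂ))
    (fun x => (Jm.psi_hasDerivAt hκ.le x).const_mul (c : ℂ))
    (fun x => (Jm.dpsi_hasDerivAt hκ.le x).const_mul (c : ℂ))
    (fun x => (Jp.psi_hasDerivAt hκ.le x).const_mul (d : ℂ))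
    (fun x => (Jp.dpsi_hasDerivAt hκ.le x).const_mul (d : ℂ))
    ((Jm.psi_memLp hk hκ.le).const_mul _) ((Jm.dpsi_memLp hk hκ.le).const_mul _)
    ((Jm.ddpsi_memLp hk hκ.le (hc _) (hC _)).const_mul _)
    ((Jp.psi_memLp hk hκ.le).const_mul _) ((Jp.dpsi_memLp hk hκ.le).const_mul _)
    ((Jp.ddpsi_memLp hk hκ.le (hc _) (hC _)).const_mul _)
    (by simp only [e0, one_mul]; exact_mod_cast e1)
    (by simp only [e0, one_mul]; exact_mod_cast e2)
    (fun x hx => by rw [potential_left hμ hω x hx]; push_cast; ring)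
    (fun x hx => by rw [potential_right hμ hω r.hτ x hx]; push_cast; ring)
  refine ⟨ω - κ ^ 2, by linarith, u, fun h0 => ?_, hL⟩
  have hpsi : ∀ {k : ℝ} {f : ℝ → ℝ}, k ≠ 0 → (∀ᶠ x in atTop, 0 < f x) →
      ∀ᶠ x in atTop, (k : ℂ) * ((f x : ℝ) : ℂ) ≠ 0 := fun hk hf => by
    filter_upwards [hf] with x hx
    exact mul_ne_zero (Complex.ofReal_ne_zero.2 hk) (Complex.ofReal_ne_zero.2 hx.ne')
  refine glue_not_ae_eq_zero (hcd.imp (fun h => hpsi h (Jm.eventually_pos hκ.le))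
    fun h => hpsi h (Jp.eventually_pos hκ.le)) (hu.symm.trans ?_)
  exact (Lp.eq_zero_iff_ae_eq_zero (f := (u : L2))).1 (by rw [h0]; rfl)

lemma finrank_eigenspace_linearized₁ {μ τ v ω : ℝ} {hμ : 0 < μ}
    (r : ShiftRelations μ τ v ω (-xMinus μ τ v ω) (xPlus μ τ v ω)) {l : ℝ}
    (h : IsEigenvalue (linearized₁ hμ τ v ω) l) :
    Module.finrank ℂ (eigenspace (linearized₁ hμ τ v ω) l) = 1 := by
  obtain ⟨u, hu, hL⟩ := h
  have hu' : (u : L2) ≠ 0 := fun h => hu (Subtype.ext h)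
  have e : eigenspace (linearized₁ hμ τ v ω) l = Submodule.span ℂ {(u : L2)} := by
    ext w
    rw [mem_eigenspace_iff, Submodule.mem_span_singleton]
    constructor
    · rintro ⟨w, hw, rfl⟩
      exact exists_smul_of_eigenfunction (c := 2 * μ + 1) (z := l)
        (hV := memLp_potential hμ τ v ω) r.hτ
        (potential_right hμ r.hω r.hτ) (potential_left hμ r.hω)
        (continuous_well _ _ _) (continuous_well _ _ _) (abs_well_le hμ r.hω _)
        (abs_well_le hμ r.hω _) hL hw hu'
    · rintro ⟨k, rfl⟩
      refine ⟨k • u, ?_, rfl⟩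
      rw [LinearPMap.map_smul, hL]
      exact smul_comm _ _ _
  rw [e, finrank_span_singleton hu']

end FulopTsutsui

theorem mainTheorem6 (μ τ v ω : ℝ) (hμ : 0 < μ) (hτ0 : τ ≠ 0) (hτ1 : τ ≠ 1) (hτ2 : τ ≠ -1)
    (hv : 0 < v) (hω : v ^ 2 / (τ ^ 2 + 1) ^ 2 < ω) :
    (FulopTsutsui.kernel (FulopTsutsui.linearized₁ hμ τ v ω) = ⊥ ∧
      ∃ l : ℝ, l < 0 ∧
        FulopTsutsui.IsEigenvalue (FulopTsutsui.linearized₁ hμ τ v ω) l ∧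
        Module.finrank ℂ
          (FulopTsutsui.eigenspace (FulopTsutsui.linearized₁ hμ τ v ω) l) = 1 ∧
        ∀ l' : ℝ, l' < 0 →
          FulopTsutsui.IsEigenvalue (FulopTsutsui.linearized₁ hμ τ v ω) l' → l' = l) ∧
    ((∀ u : (FulopTsutsui.linearized₂ hμ τ v ω).domain,
        0 ≤ (inner ℂ (u : FulopTsutsui.L2) (FulopTsutsui.linearized₂ hμ τ v ω u)).re ∧
        (inner ℂ (u : FulopTsutsui.L2) (FulopTsutsui.linearized₂ hμ τ v ω u)).im = 0) ∧
      FulopTsutsui.kernel (FulopTsutsui.linearized₂ hμ τ v ω) =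
        Submodule.span ℂ
          {FulopTsutsui.stateL2 hμ (lt_of_le_of_lt (by positivity) hω) τ v}) := by
  have r := FulopTsutsui.shiftRelations hμ hτ0 hτ1 hτ2 hv hω
  refine ⟨⟨FulopTsutsui.kernel_linearized₁ r, ?_⟩, FulopTsutsui.linearized₂_nonneg r,
    FulopTsutsui.kernel_linearized₂ r.hω r⟩
  obtain ⟨l, hl, he⟩ := FulopTsutsui.exists_negative_eigenvalue (hμ := hμ) r
  obtain ⟨ℓ, hℓ⟩ := r.exists_functional
  refine ⟨l, hl, he, FulopTsutsui.finrank_eigenspace_linearized₁ r he, fun l' hl' he' => ?_⟩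
  exact FulopTsutsui.eigenvalue_unique (c := 2 * μ + 1)
    (hV := FulopTsutsui.memLp_potential hμ τ v ω)
    (FulopTsutsui.potential_right hμ r.hω r.hτ) (FulopTsutsui.potential_left hμ r.hω)
    (FulopTsutsui.continuous_well _ _ _) (FulopTsutsui.continuous_well _ _ _)
    (FulopTsutsui.abs_sub_mul_well_le hμ r.hω _ _) (FulopTsutsui.abs_sub_mul_well_le hμ r.hω _ _)
    ℓ hℓ hl' hl he' he
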